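/- Conventions. An almost paracontact metric structure on a smooth $(2n+1)$-manifold $M$ consists of smooth tensor fields: a $(1,1)$-tensor $\varphi$, a vector field $\xi$, a $1$-form $\eta$ and a semi-Riemannian metric $g$, with $\eta(\xi)=1$, $\varphi^2=I-\eta\otimes\xi$, with the eigendistributions of $\varphi$ for $1$ and $-1$ both of dimension $n$, and with $g(\varphi X,\varphi Y)=-g(X,Y)+\eta(X)\eta(Y)$. It is a paracontact metric structure if moreover $d\eta(X,Y)=g(X,\varphi Y)$, where $d\eta(X,Y)=\tfrac12\big(X\eta(Y)-Y\eta(X)-\eta([X,Y])\big)$. Put $h=\frac12 L_\xi\varphi$. The structure is a $(-1,0)$-space if $R(X,Y)\xi=-(\eta(Y)X-\eta(X)Y)$ for all vector fields $X,Y$, where $R(X,Y)Z=\nabla_X\nabla_YZ-\nabla_Y\nabla_XZ-\nabla_{[X,Y]}Z$ and $\nabla$ is the Levi-Civita connection of $g$. Let $n\ge 2$ and $m\in\{2,\dots,n\}$. Consider the real $(2n+1)$-dimensional Lie algebra $\mathfrak g$ with basis $\{\xi,X_1,Y_1,\dots,X_n,Y_n\}$ whose only non-zero brackets are, up to antisymmetry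 (cases whose index range is empty being dropped), \begin{align*} &[\xi,X_1]=X_1+X_2+Y_1,\quad [\xi,Y_1]=-Y_1+Y_2,\quad [\xi,X_2]=X_1+X_2+Y_2,\quad [\xi,Y_2]=Y_1-Y_2,\\ &[\xi,X_i]=X_i+Y_i,\quad [\xi,Y_i]=-Y_i\quad (3\le i\le m),\\ &[X_1,X_2]=\sqrt2X_1,\quad [X_2,X_j]=-\sqrt2X_j\ (3\le j\le m),\quad [X_i,X_j]=\sqrt2[\xi,X_i]\ (1\le i\le m<j\le n),\\ &[Y_1,Y_2]=\sqrt2(-Y_1+Y_2),\quad [Y_i,Y_j]=\sqrt2Y_j\ (i=1,2,\ 3\le j\le m),\\ &[X_1,Y_1]=2\xi+\sqrt2(X_2+Y_2),\quad [X_2,Y_2]=-2\xi+\sqrt2X_1,\\ &[X_i,Y_i]=-2\xi+\sqrt2(X_1-X_2-Y_2)\ (3\le i\le m),\quad [X_i,Y_i]=-2\xi-\sqrt2X_i\ (m<i\le n),\\ &[X_1,Y_2]=\sqrt2(Y_1+X_2),\quad [X_2,Y_1]=\sqrt2X_1,\quad [X_i,Y_j]=\sqrt2X_j\ (i=1,2,\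 3\le j\le m),\\ &[X_i,Y_2]=\sqrt2Y_i\ (3\le i\le m),\quad [X_i,Y_j]=-\sqrt2[\xi,Y_j]\ (m<i\le n,\ 1\le j\le m). \end{align*} There is a Lie group $G$ whose Lie algebra is $\mathfrak g$. Every such $G$ carries a left-invariant paracontact metric structure $(\varphi,\xi,\eta,g)$ given by $\varphi\xi=0$, $\varphi X_i=X_i$, $\varphi Y_i=-Y_i$, $\eta(\xi)=1$, $\eta(X_i)=\eta(Y_i)=0$ for $1\le i\le n$, where the only non-vanishing components of $g$ are $g(\xi,\xi)=g(X_1,Y_1)=1$ and $g(X_i,Y_i)=-1$ for $2\le i\le n$. For this structure $h\xi=0$, $hX_i=Y_i$ for $i\le m$, $hX_i=0$ for $m<i\le n$, and $hY_i=0$ for all $i$; hence $h^2=0$, $\operatorname{rank}(h)=m$ and $h\ne0$ at every point. Moreover, it is a $(-1,0)$-space. Furthermore, for every $n\ge1$ and every $m\in\{1,\dots,n\}$ there is a non-empty smooth $(2n+1)$-dimensional manifold with a paracontact metric structure that is a $(-1,0)$-space with $h^2=0$ and $\operatorname{rank}(h)=m$ at every point. -/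

import Mathlib

open Bundle VectorField
open scoped Manifold ContDiff

namespace Paracontact

noncomputable section

section Structures

variable {E : Type*} [NormedAddCommGroup E] [NormedSpace ℝ E] [FiniteDimensional ℝ E]
  {H : Type*} [TopologicalSpace H] (I : ModelWithCorners ℝ E H)
  (M : Type*) [TopologicalSpace M] [ChartedSpace H M] [IsManifold I ∞ M]

/-- An almost paracontact structure `(φ, ξ, η)` on a smooth manifold: smooth tensor fields with
`η ξ = 1`, `φ² = id - η ⊗ ξ`, and eigendistributions of `φ` for `1` and `-1` both of dimension `n`
(so that the manifold has dimension `2n + 1`). -/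
structure AlmostParacontactStructure (n : ℕ) where
  φ : ∀ p : M, TangentSpace I p →L[ℝ] TangentSpace I p
  ξ : ∀ p : M, TangentSpace I p
  η : ∀ p : M, TangentSpace I p →L[ℝ] ℝ
  smooth_φ : ContMDiff I (I.prod 𝓘(ℝ, E →L[ℝ] E)) ∞ fun p : M =>
    (TotalSpace.mk' (E →L[ℝ] E) p (φ p) :
      TotalSpace (E →L[ℝ] E) fun p : M => TangentSpace I p →L[ℝ] TangentSpace I p)
  smooth_ξ : ContMDiff I I.tangent ∞ fun p : M => (⟨p, ξ p⟩ : TangentBundle I M)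
  smooth_η : ContMDiff I (I.prod 𝓘(ℝ, E →L[ℝ] ℝ)) ∞ fun p : M =>
    (TotalSpace.mk' (E →L[ℝ] ℝ) p (η p) :
      TotalSpace (E →L[ℝ] ℝ) fun p : M => TangentSpace I p →L[ℝ] ℝ)
  η_ξ : ∀ p, η p (ξ p) = 1
  φ_φ : ∀ p v, φ p (φ p v) = v - η p v • ξ p
  finrank_pos : ∀ p, Module.finrank ℝ
    (Module.End.eigenspace (φ p : TangentSpace I p →ₗ[ℝ] TangentSpace I p) 1) = n
  finrank_neg : ∀ p, Module.finrank ℝ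
    (Module.End.eigenspace (φ p : TangentSpace I p →ₗ[ℝ] TangentSpace I p) (-1)) = n

/-- An almost paracontact metric structure: an almost paracontact structure together with a
semi-Riemannian metric `g` (smooth, symmetric, nondegenerate) such that
`g (φ X) (φ Y) = - g X Y + η X η Y`. -/
structure AlmostParacontactMetricStructure (n : ℕ) extends AlmostParacontactStructure I M n where
  g : ∀ p : M, TangentSpace I p →L[ℝ] TangentSpace I p →L[ℝ] ℝ
  smooth_g : ContMDiff I (I.prod 𝓘(ℝ, E →L[ℝ] E →L[ℝ] ℝ)) ∞ fun p : M =>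
    (TotalSpace.mk' (E →L[ℝ] E →L[ℝ] ℝ) p (g p) :
      TotalSpace (E →L[ℝ] E →L[ℝ] ℝ) fun p : M =>
        TangentSpace I p →L[ℝ] TangentSpace I p →L[ℝ] ℝ)
  symm_g : ∀ p v w, g p v w = g p w v
  nondegenerate_g : ∀ p v, (∀ w, g p v w = 0) → v = 0
  g_φ_φ : ∀ p v w, g p (φ p v) (φ p w) = - g p v w + η p v * η p w

variable {I M} in
/-- The exterior derivative of a `1`-form evaluated on two vector fields,
`dη(X, Y) = ½ (X(η Y) - Y(η X) - η [X, Y])`. -/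
def extDerivOneForm (η : ∀ p : M, TangentSpace I p →L[ℝ] ℝ) (X Y : ∀ p : M, TangentSpace I p)
    (p : M) : ℝ :=
  1 / 2 * (mvfderiv I (fun q => η q (Y q)) p (X p) - mvfderiv I (fun q => η q (X q)) p (Y p)
    - η p (mlieBracket I X Y p))

/-- A paracontact metric structure: an almost paracontact metric structure with `dη = Φ`, where
`Φ(X, Y) = g(X, φ Y)` is the fundamental `2`-form. -/
structure ParacontactMetricStructure (n : ℕ) extends AlmostParacontactMetricStructure I M n where
  dη_eq : ∀ (X Y : ∀ p : M, TangentSpace I p) (p : M),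
    ContMDiffAt I I.tangent ∞ (fun q => (⟨q, X q⟩ : TangentBundle I M)) p →
    ContMDiffAt I I.tangent ∞ (fun q => (⟨q, Y q⟩ : TangentBundle I M)) p →
    extDerivOneForm η X Y p = g p (X p) (φ p (Y p))

variable {I M}

/-- The Lie derivative `(L_ξ φ) X = [ξ, φ X] - φ [ξ, X]` of an endomorphism field, evaluated on a
vector field. -/
def lieDerivEnd (ξ : ∀ p : M, TangentSpace I p)
    (φ : ∀ p : M, TangentSpace I p →L[ℝ] TangentSpace I p) (X : ∀ p : M, TangentSpace I p)
    (p : M) : TangentSpace I p :=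
  mlieBracket I ξ (fun q => φ q (X q)) p - φ p (mlieBracket I ξ X p)

/-- The curvature `R(X, Y) Z = ∇_X ∇_Y Z - ∇_Y ∇_X Z - ∇_[X,Y] Z`. In Mathlib, `∇_X Z` at `p` is
`cov Z p (X p)`. -/
def curvature (cov : CovariantDerivative I E (TangentSpace I : M → Type _))
    (X Y Z : ∀ p : M, TangentSpace I p) (p : M) : TangentSpace I p :=
  cov (fun q => cov Z q (Y q)) p (X p) - cov (fun q => cov Z q (X q)) p (Y p)
    - cov Z p (mlieBracket I X Y p)

/-- `cov` is the Levi-Civita connection of the semi-Riemannian metric `g`: it is metric and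
torsion-free. By Koszul's formula these conditions determine `∇_X Y` for differentiable `Y`. -/
structure IsLeviCivita (g : ∀ p : M, TangentSpace I p →L[ℝ] TangentSpace I p →L[ℝ] ℝ)
    (cov : CovariantDerivative I E (TangentSpace I : M → Type _)) : Prop where
  metric : ∀ (Y Z : ∀ p : M, TangentSpace I p) (p : M),
    MDifferentiableAt I I.tangent (fun q => (⟨q, Y q⟩ : TangentBundle I M)) p →
    MDifferentiableAt I I.tangent (fun q => (⟨q, Z q⟩ : TangentBundle I M)) p →
    ∀ v : TangentSpace I p, mvfderiv I (fun q => g q (Y q) (Z q)) p v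
      = g p (cov Y p v) (Z p) + g p (Y p) (cov Z p v)
  torsion_free : cov.torsion = 0

namespace AlmostParacontactStructure

variable {n : ℕ} (S : AlmostParacontactStructure I M n)

theorem mdifferentiableAt_φ_apply {X : ∀ p : M, TangentSpace I p} {p : M}
    (hX : MDifferentiableAt I I.tangent (fun q => (⟨q, X q⟩ : TangentBundle I M)) p) :
    MDifferentiableAt I I.tangent (fun q => (⟨q, S.φ q (X q)⟩ : TangentBundle I M)) p :=
  MDifferentiableAt.clm_bundle_apply (F₁ := E) (F₂ := E)
    ((S.smooth_φ p).mdifferentiableAt (by simp)) hX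

theorem tensorialAt_lieDerivEnd (p : M) :
    TensorialAt I E (fun X : ∀ p : M, TangentSpace I p => (1 / 2 : ℝ) • lieDerivEnd S.ξ S.φ X p)
      p where
  smul {f X} hf hX := by
    have h1 : (fun q => S.φ q ((f • X) q)) = f • fun q => S.φ q (X q) := by
      funext q; simp
    simp only [lieDerivEnd, h1]
    rw [mlieBracket_smul_right hf (S.mdifferentiableAt_φ_apply hX), mlieBracket_smul_right hf hX]
    simp only [map_add, map_smul]
    module
  add {X Y} hX hY := by
    have h1 : (fun q => S.φ q ((X + Y) q)) = (fun q => S.φ q (X q)) + fun q => S.φ q (Y q) := by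
      funext q; simp
    simp only [lieDerivEnd, h1]
    rw [mlieBracket_add_right (S.mdifferentiableAt_φ_apply hX) (S.mdifferentiableAt_φ_apply hY),
      mlieBracket_add_right hX hY]
    simp only [map_add]
    module

/-- The tensor field `h = ½ L_ξ φ`. -/
def h (p : M) : TangentSpace I p →L[ℝ] TangentSpace I p :=
  TensorialAt.mkHom (fun X : ∀ p : M, TangentSpace I p => (1 / 2 : ℝ) • lieDerivEnd S.ξ S.φ X p) p
    (S.tensorialAt_lieDerivEnd p)

theorem h_apply {X : ∀ p : M, TangentSpace I p} {p : M}
    (hX : MDifferentiableAt I I.tangent (fun q => (⟨q, X q⟩ : TangentBundle I M)) p) :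
    S.h p (X p) = (1 / 2 : ℝ) • lieDerivEnd S.ξ S.φ X p :=
  TensorialAt.mkHom_apply (S.tensorialAt_lieDerivEnd p) hX

end AlmostParacontactStructure

/-- A paracontact metric manifold is a `(κ, μ)`-space if
`R(X, Y) ξ = κ (η(Y) X - η(X) Y) + μ (η(Y) h X - η(X) h Y)` for all smooth vector fields `X, Y`,
where `R` is the curvature of the Levi-Civita connection. -/
def ParacontactMetricStructure.IsKappaMuSpace {n : ℕ} (S : ParacontactMetricStructure I M n)
    (κ μ : ℝ) : Prop :=
  ∃ cov : CovariantDerivative I E (TangentSpace I : M → Type _), IsLeviCivita S.g cov ∧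
    ∀ X Y : ∀ p : M, TangentSpace I p,
      ContMDiff I I.tangent ∞ (fun q => (⟨q, X q⟩ : TangentBundle I M)) →
      ContMDiff I I.tangent ∞ (fun q => (⟨q, Y q⟩ : TangentBundle I M)) →
      ∀ p, curvature cov X Y S.ξ p = κ • (S.η p (Y p) • X p - S.η p (X p) • Y p)
        + μ • (S.η p (Y p) • S.h p (X p) - S.η p (X p) • S.h p (Y p))

end Structures

section LieGroups

variable {E : Type*} [NormedAddCommGroup E] [NormedSpace ℝ E] [FiniteDimensional ℝ E]
  {H : Type*} [TopologicalSpace H] {I : ModelWithCorners ℝ E H}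
  {G : Type*} [TopologicalSpace G] [ChartedSpace H G] [Group G] [LieGroup I ∞ G] {n : ℕ}

/-- All structure tensors are preserved by the left translations of the Lie group. -/
structure ParacontactMetricStructure.IsLeftInvariant (S : ParacontactMetricStructure I G n) :
    Prop where
  φ_inv : ∀ (a p : G) (v : TangentSpace I p),
    S.φ (a * p) (mfderiv I I (a * ·) p v) = mfderiv I I (a * ·) p (S.φ p v)
  ξ_inv : ∀ a p : G, S.ξ (a * p) = mfderiv I I (a * ·) p (S.ξ p)
  η_inv : ∀ (a p : G) (v : TangentSpace I p), S.η (a * p) (mfderiv I I (a * ·) p v) = S.η p v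
  g_inv : ∀ (a p : G) (v w : TangentSpace I p),
    S.g (a * p) (mfderiv I I (a * ·) p v) (mfderiv I I (a * ·) p w) = S.g p v w

end LieGroups

section LieAlgebra

variable {L : Type*} [AddCommGroup L] [Module ℝ L]

/-- The family `ξ, X_1, …, X_n, Y_1, …, Y_n`. -/
def frame (n : ℕ) (ξ : L) (X Y : ℕ → L) : Option (Fin n ⊕ Fin n) → L
  | none => ξ
  | some (Sum.inl i) => X (i + 1)
  | some (Sum.inr i) => Y (i + 1)

/-- The prescribed value of `[ξ, X_i]`. -/
def bracketξX (m : ℕ) (X Y : ℕ → L) (i : ℕ) : L :=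
  if i = 1 then X 1 + X 2 + Y 1
  else if i = 2 then X 1 + X 2 + Y 2
  else if i ≤ m then X i + Y i
  else 0

/-- The prescribed value of `[ξ, Y_i]`. -/
def bracketξY (m : ℕ) (Y : ℕ → L) (i : ℕ) : L :=
  if i = 1 then -Y 1 + Y 2
  else if i = 2 then Y 1 - Y 2
  else if i ≤ m then -Y i
  else 0

/-- The prescribed value of `[X_i, X_j]` for `i < j`. -/
def bracketXX (m : ℕ) (X Y : ℕ → L) (i j : ℕ) : L :=
  if i = 1 ∧ j = 2 then √2 • X 1
  else if i = 2 ∧ 3 ≤ j ∧ j ≤ m then -√2 • X j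
  else if i ≤ m ∧ m < j then √2 • bracketξX m X Y i
  else 0

/-- The prescribed value of `[Y_i, Y_j]` for `i < j`. -/
def bracketYY (m : ℕ) (Y : ℕ → L) (i j : ℕ) : L :=
  if i = 1 ∧ j = 2 then √2 • (-Y 1 + Y 2)
  else if i ≤ 2 ∧ 3 ≤ j ∧ j ≤ m then √2 • Y j
  else 0

/-- The prescribed value of `[X_i, Y_j]`. -/
def bracketXY (m : ℕ) (ξ : L) (X Y : ℕ → L) (i j : ℕ) : L :=
  if i = j then
    if i = 1 then (2 : ℝ) • ξ + √2 • (X 2 + Y 2)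
    else if i = 2 then (-2 : ℝ) • ξ + √2 • X 1
    else if i ≤ m then (-2 : ℝ) • ξ + √2 • (X 1 - X 2 - Y 2)
    else (-2 : ℝ) • ξ - √2 • X i
  else if i = 1 ∧ j = 2 then √2 • (Y 1 + X 2)
  else if i = 2 ∧ j = 1 then √2 • X 1
  else if i ≤ 2 ∧ 3 ≤ j ∧ j ≤ m then √2 • X j
  else if 3 ≤ i ∧ i ≤ m ∧ j = 2 then √2 • Y i
  else if m < i ∧ j ≤ m then -√2 • bracketξY m Y j
  else 0

/-- `ξ, X_1, Y_1, …, X_n, Y_n` is a basis of the Lie algebra `L` with the prescribed brackets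
(only the values of `X` and `Y` at `1, …, n` matter). -/
structure IsExampleBasis [Bracket L L] (n m : ℕ) (ξ : L) (X Y : ℕ → L) : Prop where
  linearIndependent : LinearIndependent ℝ (frame n ξ X Y)
  span_eq_top : Submodule.span ℝ (Set.range (frame n ξ X Y)) = ⊤
  lie_ξ_X : ∀ i ∈ Finset.Icc 1 n, ⁅ξ, X i⁆ = bracketξX m X Y i
  lie_ξ_Y : ∀ i ∈ Finset.Icc 1 n, ⁅ξ, Y i⁆ = bracketξY m Y i
  lie_X_X : ∀ i ∈ Finset.Icc 1 n, ∀ j ∈ Finset.Icc 1 n, i < j → ⁅X i, X j⁆ = bracketXX m X Y i j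
  lie_Y_Y : ∀ i ∈ Finset.Icc 1 n, ∀ j ∈ Finset.Icc 1 n, i < j → ⁅Y i, Y j⁆ = bracketYY m Y i j
  lie_X_Y : ∀ i ∈ Finset.Icc 1 n, ∀ j ∈ Finset.Icc 1 n, ⁅X i, Y j⁆ = bracketXY m ξ X Y i j

end LieAlgebra

/-- The values at the identity of the left-invariant structure of the example: `ξ` is the given
vector, `φ ξ = 0`, `φ X_i = X_i`, `φ Y_i = -Y_i`, `η ξ = 1`, `η X_i = η Y_i = 0`, and the only
non-vanishing components of `g` are `g(ξ, ξ) = g(X_1, Y_1) = 1` and `g(X_i, Y_i) = -1` for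
`i ≥ 2`. -/
structure HasExampleValues {E : Type*} [NormedAddCommGroup E] [NormedSpace ℝ E]
    [FiniteDimensional ℝ E] {H : Type*} [TopologicalSpace H] {I : ModelWithCorners ℝ E H}
    {G : Type*} [TopologicalSpace G] [ChartedSpace H G] [Group G] [LieGroup I ∞ G] {n : ℕ}
    (S : ParacontactMetricStructure I G n) (ξ : GroupLieAlgebra I G)
    (X Y : ℕ → GroupLieAlgebra I G) : Prop where
  ξ_one : S.ξ 1 = ξ
  φ_ξ : S.φ 1 ξ = 0
  φ_X : ∀ i ∈ Finset.Icc 1 n, S.φ 1 (X i) = X i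
  φ_Y : ∀ i ∈ Finset.Icc 1 n, S.φ 1 (Y i) = -Y i
  η_ξ : S.η 1 ξ = 1
  η_X : ∀ i ∈ Finset.Icc 1 n, S.η 1 (X i) = 0
  η_Y : ∀ i ∈ Finset.Icc 1 n, S.η 1 (Y i) = 0
  g_ξ_ξ : S.g 1 ξ ξ = 1
  g_ξ_X : ∀ i ∈ Finset.Icc 1 n, S.g 1 ξ (X i) = 0
  g_ξ_Y : ∀ i ∈ Finset.Icc 1 n, S.g 1 ξ (Y i) = 0
  g_X_X : ∀ i ∈ Finset.Icc 1 n, ∀ j ∈ Finset.Icc 1 n, S.g 1 (X i) (X j) = 0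
  g_Y_Y : ∀ i ∈ Finset.Icc 1 n, ∀ j ∈ Finset.Icc 1 n, S.g 1 (Y i) (Y j) = 0
  g_X_Y : ∀ i ∈ Finset.Icc 1 n, ∀ j ∈ Finset.Icc 1 n,
    S.g 1 (X i) (Y j) = if i = j then (if i = 1 then 1 else -1) else 0

end

end Paracontact

/-!
All structures here are invariant: they have constant coefficients with respect to a global frame
whose structure functions are constant, such as the left-invariant frame of a Lie group. The
Levi-Civita connection is then given by the algebraic Koszul formula, and everything reduces to
linear algebra on one vector space with a Lie bracket.

Put `B = -φ - h`. If `h` maps the `1`-eigenspace of `φ` to the `(-1)`-eigenspace and kills the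
latter, then `B v = ∇_v ξ`, `B` kills `ξ`, and `B` is an involution of `ker η`. The identity
`R(x, y) ξ = -(η(y) x - η(x) y)` is bilinear and skew, so it may be checked on `ξ` and on
eigenvectors of `B`. For `x = ξ` it says that `ad ξ` commutes with `B`; for two eigenvectors with
the same eigenvalue, that the eigenspaces of `B` are subalgebras; for two eigenvectors with
different eigenvalues it follows from the closedness of `dη` and from the invariance of the form
`g (h ·) ·` on the `(-1)`-eigenspace of `B` under the bracket with the `1`-eigenspace. These are
the conditions of `LinearModel.IsNullModel`, and the identity is
`LinearModel.IsNullModel.curvature_eq`; `Parallelization.isKappaMuSpace` carries it over to all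
vector fields on the manifold.

For the Lie algebra of the example the `(-1)`-eigenspace of `B` is spanned by the vectors
`X_i + Y_i / 2` (`i ≤ m`) and `X_i` (`i > m`), and the `1`-eigenspace by the `Y_i`, so that the
conditions are read off from the multiplication table (`IsExampleTable.isNullBasis`).

A Lie group with this Lie algebra exists because the Lie algebra is isomorphic to
`(gl₂ ⋉ heis) ⊕ aff(ℝ)^(n - m)`, where `heis` is the Heisenberg algebra of dimension
`2 (m - 2) + 1`. The corresponding group is realised without matrices, as the set of points `x` of
a vector space where an affine map `y ↦ x + L x y` is invertible (`EtaleLaw`, `exampleLaw`,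
`exists_exampleGroup`).

The example gives the last claim for `m ≥ 2`. For `m = 1` a frame on `ℝ^(2 n + 1)` whose structure
functions are those of `sl₂ ⊕ aff(ℝ)^(n - 1)` does the same (`exists_rankOne`); a global frame
suffices there, no group is needed.
-/

namespace Paracontact

noncomputable section

/-! ### The linear algebra of a left-invariant structure -/

section LinearModel

variable {E : Type*} [NormedAddCommGroup E] [NormedSpace ℝ E]

theorem eq_zero_of_eq_neg {v : E} (h : v = -v) : v = 0 := by
  have h2 : (2 : ℝ) • v = 0 := by
    rw [two_smul]
    nth_rewrite 1 [h]
    exact neg_add_cancel v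
  exact (smul_eq_zero.mp h2).resolve_left two_ne_zero

/-- The linear data of an invariant paracontact metric structure: tensors `(φ, ξ, η, g)` on a
vector space with a bilinear bracket `br`, satisfying pointwise the axioms of an almost paracontact
metric structure. The last field is `dη(v, w) = g(v, φ w)` for invariant fields, whose `η` is
constant, so that only the bracket term of `dη` survives. -/
structure LinearModel (n : ℕ) (br : E →ₗ[ℝ] E →ₗ[ℝ] E) where
  φ : E →L[ℝ] E
  ξ : E
  η : E →L[ℝ] ℝ
  g : E →L[ℝ] E →L[ℝ] ℝ
  η_ξ : η ξ = 1
  φ_φ : ∀ v, φ (φ v) = v - η v • ξ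
  finrank_pos : Module.finrank ℝ (Module.End.eigenspace (φ : E →ₗ[ℝ] E) 1) = n
  finrank_neg : Module.finrank ℝ (Module.End.eigenspace (φ : E →ₗ[ℝ] E) (-1)) = n
  symm_g : ∀ v w, g v w = g w v
  nondegenerate_g : ∀ v, (∀ w, g v w = 0) → v = 0
  g_φ_φ : ∀ v w, g (φ v) (φ w) = - g v w + η v * η w
  η_br : ∀ v w, η (br v w) = -2 * g v (φ w)

namespace LinearModel

variable {n : ℕ} {br : E →ₗ[ℝ] E →ₗ[ℝ] E} (A : LinearModel n br)

theorem φ_ξ : A.φ A.ξ = 0 := by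
  have h1 := A.φ_φ (A.φ A.ξ)
  have h2 := A.φ_φ A.ξ
  simp only [A.η_ξ, one_smul, sub_self] at h2
  rw [h2, map_zero] at h1
  have h3 : A.φ A.ξ = A.η (A.φ A.ξ) • A.ξ := (sub_eq_zero.mp h1.symm)
  have h4 : A.φ (A.φ A.ξ) = A.η (A.φ A.ξ) • A.φ A.ξ := by
    conv_lhs => rw [h3]
    rw [map_smul]
  rw [h2, eq_comm, smul_eq_zero] at h4
  rcases h4 with h4 | h4
  · rw [h3, h4, zero_smul]
  · exact h4

theorem η_φ (v : E) : A.η (A.φ v) = 0 := by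
  have h1 := A.φ_φ (A.φ v)
  rw [A.φ_φ v, map_sub, map_smul, A.φ_ξ, smul_zero, sub_zero, eq_comm, sub_eq_self] at h1
  have := congrArg A.η h1
  simpa [A.η_ξ] using this

theorem g_ξ (v : E) : A.g v A.ξ = A.η v := by
  have h := A.g_φ_φ v A.ξ
  rw [A.φ_ξ, map_zero, A.η_ξ] at h
  linarith

theorem g_φ_left (v w : E) : A.g (A.φ v) w = - A.g v (A.φ w) := by
  have h := A.g_φ_φ v (A.φ w)
  rw [A.φ_φ w, map_sub, map_smul, A.g_ξ, A.η_φ, A.η_φ] at h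
  simpa using h

theorem η_br_ξ (v : E) : A.η (br A.ξ v) = 0 := by
  rw [A.η_br, A.symm_g, A.g_ξ, A.η_φ, mul_zero]

/-- The `(-1)`-eigenspace of `φ` is isotropic. It contains the `1`-eigenspace of the operator
`-φ - h`, which accounts for the name. -/
theorem g_pos_pos {b b' : E} (hb : A.φ b = -b) (hb' : A.φ b' = -b') : A.g b b' = 0 := by
  have h1 := A.g_φ_φ b b'
  have h2 : A.η b = 0 := by
    have := A.η_φ b
    rw [hb, map_neg, neg_eq_zero] at this
    exact this
  rw [hb, hb', h2] at h1
  simp only [map_neg, neg_apply, neg_neg, zero_mul, add_zero] at h1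
  linarith

theorem ext_g {v w : E} (h : ∀ z, A.g v z = A.g w z) : v = w :=
  sub_eq_zero.mp (A.nondegenerate_g _ fun z => by simp [h z])

/-- The Koszul formula for invariant fields defines a bilinear map `Γ`, where `Γ v w` is `∇_v w`. -/
theorem exists_koszul [FiniteDimensional ℝ E] : ∃ Γ : E →L[ℝ] E →L[ℝ] E, ∀ x y z,
    2 * A.g (Γ x y) z = A.g (br x y) z - A.g (br x z) y - A.g (br y z) x := by
  let gl : E →ₗ[ℝ] (E →L[ℝ] ℝ) := A.g
  have hinj : Function.Injective gl := fun v w h => A.ext_g fun z => by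
    exact congrArg (fun f : E →L[ℝ] ℝ => f z) h
  have hdim : Module.finrank ℝ E = Module.finrank ℝ (E →L[ℝ] ℝ) := by
    rw [← (LinearMap.toContinuousLinearMap (𝕜 := ℝ) (E := E) (F' := ℝ)).finrank_eq]
    exact Subspace.dual_finrank_eq.symm
  let e : E ≃ₗ[ℝ] (E →L[ℝ] ℝ) := LinearEquiv.ofInjectiveOfFinrankEq gl hinj hdim
  have he : ∀ f z, A.g (e.symm f) z = f z := fun f z => by
    have : gl (e.symm f) = f := by
      change e (e.symm f) = f
      simp
    exact congrArg (fun f : E →L[ℝ] ℝ => f z) this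
  let K : E → E → (E →L[ℝ] ℝ) := fun x y => (1 / 2 : ℝ) • LinearMap.toContinuousLinearMap
    ((A.g (br x y) : E →ₗ[ℝ] ℝ) - (A.g y : E →ₗ[ℝ] ℝ) ∘ₗ br x - (A.g x : E →ₗ[ℝ] ℝ) ∘ₗ br y)
  have hK : ∀ x y z, K x y z = 1 / 2 * (A.g (br x y) z - A.g y (br x z) - A.g x (br y z)) :=
    fun x y z => by simp [K]
  let Γ₀ : E →ₗ[ℝ] E →ₗ[ℝ] E := LinearMap.mk₂ ℝ (fun x y => e.symm (K x y))
    (fun x x' y => by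
      rw [← map_add]; congr 1; ext z; simp only [hK, add_apply, map_add,
        LinearMap.add_apply]; ring)
    (fun c x y => by
      rw [← map_smul]; congr 1; ext z; simp only [hK, smul_apply, map_smul,
        LinearMap.smul_apply, smul_eq_mul]; ring)
    (fun x y y' => by
      rw [← map_add]; congr 1; ext z; simp only [hK, add_apply, map_add,
        LinearMap.add_apply]; ring)
    (fun c x y => by
      rw [← map_smul]; congr 1; ext z; simp only [hK, smul_apply, map_smul,
        LinearMap.smul_apply, smul_eq_mul]; ring)
  refine ⟨LinearMap.toContinuousLinearMap
    ((LinearMap.toContinuousLinearMap (𝕜 := ℝ) (E := E) (F' := E)).toLinearMap ∘ₗ Γ₀), ?_⟩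
  intro x y z
  change 2 * A.g (e.symm (K x y)) z = _
  rw [he, hK, A.symm_g y, A.symm_g x]
  ring

/-- Invariant structures whose tensor `h` maps the `1`-eigenspace of `φ` to the `(-1)`-eigenspace
and kills the latter, and that satisfy the `(-1, 0)`-condition. The latter is phrased through the
operator `-φ - h`, which is `v ↦ ∇_v ξ`: its `±1`-eigenspaces are subalgebras, it commutes with
`ad ξ`, and the form `g (h ·) ·` on the `(-1)`-eigenspace is invariant under the `1`-eigenspace. -/
structure IsNullModel (h : E →L[ℝ] E) : Prop where
  skew : ∀ v w, br v w = - br w v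
  jacobi : ∀ u v w, br u (br v w) = br (br u v) w + br v (br u w)
  two_h : ∀ v, (2 : ℝ) • h v = br A.ξ (A.φ v) - A.φ (br A.ξ v)
  h_φ : ∀ v, h (A.φ v) = h v
  br_ξ : ∀ v, br A.ξ (-A.φ v - h v) = -A.φ (br A.ξ v) - h (br A.ξ v)
  br_pos : ∀ v w, A.φ v = -v → h v = 0 → A.φ w = -w → h w = 0 →
    A.φ (br v w) = - br v w ∧ h (br v w) = 0
  br_neg : ∀ v w, A.φ v = v - h v → A.φ w = w - h w → A.φ (br v w) = br v w - h (br v w)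
  g_h : ∀ u v w, A.φ u = -u → h u = 0 → A.φ v = v - h v → A.φ w = w - h w →
    A.g (br u v) (h w) + A.g (br u w) (h v) = 0

namespace IsNullModel

variable {A} {h : E →L[ℝ] E} (N : A.IsNullModel h)
include N

theorem η_h (v : E) : A.η (h v) = 0 := by
  have := congrArg A.η (N.two_h v)
  simpa [A.η_br_ξ, A.η_φ] using this

theorem φ_h (v : E) : A.φ (h v) = - h v := by
  have h1 := congrArg A.φ (N.two_h v)
  have h2 := N.two_h (A.φ v)
  rw [map_sub, A.φ_φ, A.η_br_ξ, zero_smul, sub_zero, map_smul] at h1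
  rw [A.φ_φ, map_sub, map_smul, N.h_φ] at h2
  have h3 : br A.ξ A.ξ = 0 := by
    have := N.skew A.ξ A.ξ
    exact eq_zero_of_eq_neg this
  rw [h3, smul_zero, sub_zero] at h2
  have h4 : (2 : ℝ) • A.φ (h v) = (2 : ℝ) • (- h v) := by
    rw [h1, smul_neg, h2]; abel
  exact smul_right_injective E (two_ne_zero) h4

theorem h_h (v : E) : h (h v) = 0 := by
  have h1 := N.h_φ (h v)
  rw [N.φ_h, map_neg] at h1
  exact eq_zero_of_eq_neg h1.symm

theorem h_ξ : h A.ξ = 0 := by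
  rw [← N.h_φ, A.φ_ξ, map_zero]

/-- The Jacobi identity says that `dη` is closed. -/
theorem closed (u v w : E) :
    A.g (br u v) (A.φ w) + A.g (br v w) (A.φ u) + A.g (br w u) (A.φ v) = 0 := by
  have h1 := congrArg A.η (N.jacobi u v w)
  rw [map_add, N.skew u (br v w), N.skew v (br u w), N.skew u w] at h1
  simp only [map_neg, LinearMap.neg_apply, neg_neg, A.η_br] at h1
  linarith

theorem g_br_ξ_φ (v w : E) : A.g (br A.ξ v) (A.φ w) = A.g (br A.ξ w) (A.φ v) := by
  have h1 := N.closed A.ξ v w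
  rw [A.φ_ξ, map_zero, N.skew w A.ξ, map_neg] at h1
  simp only [neg_apply] at h1
  linarith

/-- `h` is `g`-symmetric, because `ad ξ` preserves `dη`. -/
theorem g_h_symm (v w : E) : A.g (h v) w = A.g (h w) v := by
  have key : ∀ v w, 2 * A.g (h v) w = A.g (br A.ξ (A.φ v)) w + A.g (br A.ξ v) (A.φ w) := by
    intro v w
    have := congrArg (fun z => A.g z w) (N.two_h v)
    simp only [map_smul, map_sub, smul_apply, sub_apply,
      smul_eq_mul, A.g_φ_left] at this
    linarith
  have h1 := N.g_br_ξ_φ (A.φ v) (A.φ w)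
  rw [A.φ_φ, A.φ_φ, map_sub, map_sub, map_smul, map_smul, A.g_ξ, A.g_ξ, A.η_br_ξ, A.η_br_ξ] at h1
  have h2 := N.g_br_ξ_φ v w
  have h3 := key v w
  have h4 := key w v
  simp only [smul_zero, sub_zero] at h1
  linarith

/-- `∇_v ξ = -φ v - h v`. -/
theorem koszul_ξ {Γ : E →L[ℝ] E →L[ℝ] E} (hΓ : ∀ x y z,
    2 * A.g (Γ x y) z = A.g (br x y) z - A.g (br x z) y - A.g (br y z) x) (v : E) :
    Γ v A.ξ = -A.φ v - h v := by
  refine A.ext_g fun z => ?_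
  have h1 := hΓ v A.ξ z
  rw [A.g_ξ, A.η_br] at h1
  -- the symmetric part of `ad ξ` is `-φ h`, because `ad ξ` preserves `dη`
  have h2 := N.g_br_ξ_φ v (A.φ z)
  rw [A.φ_φ, map_sub, map_smul, A.g_ξ, A.η_br_ξ] at h2
  have h3 := congrArg (fun y => A.g y (A.φ v)) (N.two_h z)
  have h4 := A.g_φ_φ (br A.ξ z) v
  rw [A.η_br_ξ] at h4
  have h5 : A.g (h z) (A.φ v) = A.g (h v) z := by
    rw [N.g_h_symm v z, A.symm_g, A.g_φ_left, N.φ_h, map_neg, neg_neg, A.symm_g]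
  simp only [map_smul, map_sub, smul_apply, sub_apply, smul_eq_mul, h5, h4]
    at h2 h3
  rw [N.skew v A.ξ] at h1
  simp only [map_neg, map_sub, neg_apply, sub_apply,
    A.g_φ_left] at h1 ⊢
  linarith

/-- The `1`-eigenspace of `-φ - h` consists of `(-1)`-eigenvectors of `φ` killed by `h`. -/
theorem pos_of {b : E} (hb : -A.φ b - h b = b) : A.φ b = -b ∧ h b = 0 := by
  have h1 := congrArg h hb
  rw [map_sub, map_neg, N.h_φ, N.h_h, sub_zero] at h1
  have h2 : h b = 0 := eq_zero_of_eq_neg h1.symm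
  rw [h2, sub_zero] at hb
  exact ⟨by rw [← neg_eq_iff_eq_neg, hb], h2⟩

theorem η_neg {a : E} (ha : A.φ a = a - h a) : A.η a = 0 := by
  have := A.η_φ a
  rw [ha, map_sub, N.η_h, sub_zero] at this
  exact this

/-- The space is the sum of the line of `ξ` and the `±1`-eigenspaces of `-φ - h`, since this
operator kills `ξ` and squares to the identity on `ker η`. The vectors `a` and `b` are the
components for `-1` and `1`. -/
theorem exists_decomp (v : E) : ∃ a b : E, v = A.η v • A.ξ + a + b ∧ A.φ a = a - h a ∧
    A.φ b = -b ∧ h b = 0 := by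
  have hB : ∀ v, -A.φ (-A.φ v - h v) - h (-A.φ v - h v) = v - A.η v • A.ξ := by
    intro v
    simp only [map_sub, map_neg, A.φ_φ, N.φ_h, N.h_h, N.h_φ]
    abel
  have hB' : ∀ v, -A.φ (v - A.η v • A.ξ) - h (v - A.η v • A.ξ) = -A.φ v - h v := by
    intro v; simp [A.φ_ξ, N.h_ξ]
  obtain ⟨w, hw⟩ : ∃ w, w = -A.φ v - h v := ⟨_, rfl⟩
  obtain ⟨u, hu⟩ : ∃ u, u = v - A.η v • A.ξ := ⟨_, rfl⟩
  refine ⟨(1 / 2 : ℝ) • (u - w), (1 / 2 : ℝ) • (u + w), ?_, ?_, N.pos_of ?_⟩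
  · linear_combination (norm := module) -hu
  · have h1 : -A.φ (u - w) - h (u - w) = -(u - w) := by
      have e1 := hB v
      have e2 := hB' v
      simp only [map_sub]
      rw [← hw, ← hu] at e1 e2
      linear_combination (norm := module) e2 - e1
    rw [map_smul, map_smul, ← smul_sub]
    congr 1
    linear_combination (norm := module) -h1
  · have h1 : -A.φ (u + w) - h (u + w) = u + w := by
      have e1 := hB v
      have e2 := hB' v
      rw [map_add, map_add]
      rw [← hw, ← hu] at e1 e2
      linear_combination (norm := module) e2 + e1
    rw [map_smul, map_smul, ← smul_neg, ← smul_sub, h1]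

/-- The mixed case of the curvature identity: here closedness of `dη` and invariance of the form
`g (h ·) ·` enter. -/
theorem koszul_mixed {Γ : E →L[ℝ] E →L[ℝ] E} (hΓ : ∀ x y z,
    2 * A.g (Γ x y) z = A.g (br x y) z - A.g (br x z) y - A.g (br y z) x) {a b : E}
    (ha : A.φ a = a - h a) (hb : A.φ b = -b) (hb' : h b = 0) :
    Γ a b + Γ b a = -A.φ (br a b) - h (br a b) := by
  have hsum : ∀ z, A.g (Γ a b + Γ b a) z = - A.g (br a z) b - A.g (br b z) a := by
    intro z
    have h1 := hΓ a b z
    have h2 := hΓ b a z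
    rw [N.skew b a] at h2
    simp only [map_add, map_neg, add_apply, neg_apply]
      at h1 h2 ⊢
    linarith
  have hη : A.η b = 0 := by
    have := A.η_φ b
    rw [hb, map_neg, neg_eq_zero] at this
    exact this
  -- the identity is tested against `ξ` and the two eigenspaces
  have hξ : A.g (Γ a b + Γ b a) A.ξ = A.g (-A.φ (br a b) - h (br a b)) A.ξ := by
    rw [hsum, A.g_ξ, map_sub, map_neg, A.η_φ, N.η_h, N.skew a, N.skew b]
    have h1 := N.g_br_ξ_φ a b
    rw [ha, hb] at h1
    have h2 : A.g (br A.ξ b) (h a) = 0 := by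
      have e1 := N.br_ξ b
      rw [hb, hb', neg_neg, sub_zero] at e1
      obtain ⟨e2, -⟩ := N.pos_of e1.symm
      exact A.g_pos_pos e2 (N.φ_h a)
    simp only [map_neg, map_sub, neg_apply, h2] at h1 ⊢
    linarith
  have hpos : ∀ c, A.φ c = -c → h c = 0 →
      A.g (Γ a b + Γ b a) c = A.g (-A.φ (br a b) - h (br a b)) c := by
    intro c hc hc'
    have h1 := N.closed a b c
    obtain ⟨e1, e2⟩ := N.br_pos b c hb hb' hc hc'
    have h2 : A.g (br b c) (h a) = 0 := A.g_pos_pos e1 (N.φ_h a)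
    have h3 : A.g (h (br a b)) c = 0 := A.g_pos_pos (N.φ_h _) hc
    rw [hsum]
    rw [ha, hb, hc, N.skew c a] at h1
    simp only [map_neg, map_sub, neg_apply, sub_apply,
      h2, h3, A.g_φ_left, hc] at h1 ⊢
    linarith
  have hneg : ∀ c, A.φ c = c - h c →
      A.g (Γ a b + Γ b a) c = A.g (-A.φ (br a b) - h (br a b)) c := by
    intro c hc
    have h1 := N.closed a c b
    have h2 := N.g_h b a c hb hb' ha hc
    rw [N.skew b a, N.skew b c] at h2
    have h3 : A.g (h (br a b)) c = A.g (br a b) (h c) := by rw [N.g_h_symm, A.symm_g]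
    rw [hsum]
    rw [ha, hb, hc, N.skew b a] at h1
    rw [N.skew b c]
    simp only [map_neg, map_sub, neg_apply, sub_apply,
      h3, A.g_φ_left, hc] at h1 h2 ⊢
    linarith
  refine A.ext_g fun z => ?_
  obtain ⟨c, d, hz, hc, hd, hd'⟩ := N.exists_decomp z
  have hlin : ∀ y, A.g y z = A.η z * A.g y A.ξ + A.g y c + A.g y d := fun y => by
    conv_lhs => rw [hz]
    rw [map_add, map_add, map_smul, smul_eq_mul]
  rw [hlin, hlin, hξ, hpos d hd hd', hneg c hc]

/-- The curvature identity `R(x, y) ξ = -(η(y) x - η(x) y)` on invariant fields, where `∇_v ξ` is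
`-φ v - h v`. On the `±1`-eigenspaces of this operator it expresses their closure under the
bracket. -/
theorem curvature_eq {Γ : E →L[ℝ] E →L[ℝ] E} (hΓ : ∀ x y z,
    2 * A.g (Γ x y) z = A.g (br x y) z - A.g (br x z) y - A.g (br y z) x) (x y : E) :
    Γ x (-A.φ y - h y) - Γ y (-A.φ x - h x) - (-A.φ (br x y) - h (br x y))
      = -(A.η y • x - A.η x • y) := by
  have htor : ∀ x y, Γ x y - Γ y x = br x y := by
    intro x y
    refine A.ext_g fun z => ?_
    have h1 := hΓ x y z
    have h2 := hΓ y x z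
    rw [N.skew y x] at h2
    simp only [map_sub, map_neg, sub_apply, neg_apply]
      at h1 h2 ⊢
    linarith
  let T : E →ₗ[ℝ] E →ₗ[ℝ] E := LinearMap.mk₂ ℝ
    (fun x y => Γ x (-A.φ y - h y) - Γ y (-A.φ x - h x) - (-A.φ (br x y) - h (br x y))
      + (A.η y • x - A.η x • y))
    (by intros; simp only [map_add, map_sub, map_neg, add_apply,
          LinearMap.add_apply]; module)
    (by intros; simp only [map_smul, map_sub, map_neg, smul_apply,
          LinearMap.smul_apply, smul_eq_mul]; module)
    (by intros; simp only [map_add, map_sub, map_neg, add_apply]; module)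
    (by intros; simp only [map_smul, map_sub, map_neg, smul_apply, smul_eq_mul]; module)
  have hT : ∀ x y, T x y = Γ x (-A.φ y - h y) - Γ y (-A.φ x - h x)
      - (-A.φ (br x y) - h (br x y)) + (A.η y • x - A.η x • y) := fun x y => rfl
  have hskew : ∀ x y, T x y = - T y x := by
    intro x y
    rw [hT, hT, N.skew y x]
    simp only [map_neg]
    module
  have hξ : ∀ z, T A.ξ z = 0 := by
    intro z
    have h1 := htor A.ξ (-A.φ z - h z)
    rw [N.koszul_ξ hΓ, N.br_ξ] at h1
    rw [hT, A.φ_ξ, N.h_ξ, A.η_ξ]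
    simp only [neg_zero, sub_zero, map_zero, one_smul]
    simp only [map_sub, map_neg, A.φ_φ, N.φ_h, N.h_h, N.h_φ] at h1 ⊢
    linear_combination (norm := module) h1
  have hneg : ∀ a c, A.φ a = a - h a → A.φ c = c - h c → T a c = 0 := by
    intro a c ha hc
    rw [hT, N.br_neg a c ha hc, ha, hc, N.η_neg ha, N.η_neg hc]
    have h1 := htor a c
    simp only [neg_sub, sub_sub_cancel_left, zero_smul, sub_zero, add_zero, map_neg]
    linear_combination (norm := module) -h1
  have hpos : ∀ b d, A.φ b = -b → h b = 0 → A.φ d = -d → h d = 0 → T b d = 0 := by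
    intro b d hb hb' hd hd'
    have e1 : A.η b = 0 := by
      have := A.η_φ b
      rw [hb, map_neg, neg_eq_zero] at this
      exact this
    have e2 : A.η d = 0 := by
      have := A.η_φ d
      rw [hd, map_neg, neg_eq_zero] at this
      exact this
    obtain ⟨e3, e4⟩ := N.br_pos b d hb hb' hd hd'
    rw [hT, e3, e4, hb, hb', hd, hd', e1, e2]
    have h1 := htor b d
    simp only [neg_neg, sub_zero, zero_smul, add_zero]
    linear_combination (norm := module) h1
  have hmix : ∀ a b, A.φ a = a - h a → A.φ b = -b → h b = 0 → T a b = 0 := by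
    intro a b ha hb hb'
    have e1 : A.η b = 0 := by
      have := A.η_φ b
      rw [hb, map_neg, neg_eq_zero] at this
      exact this
    have h1 := N.koszul_mixed hΓ ha hb hb'
    rw [hT, hb, hb', ha, N.η_neg ha, e1]
    simp only [neg_neg, neg_sub, sub_sub_cancel_left, sub_zero, zero_smul, add_zero, map_neg]
    linear_combination (norm := module) h1
  have hzero : T x y = 0 := by
    obtain ⟨a, b, hx, ha, hb, hb'⟩ := N.exists_decomp x
    obtain ⟨c, d, hy, hc, hd, hd'⟩ := N.exists_decomp y
    rw [hx, hy]
    simp only [map_add, map_smul, LinearMap.add_apply, LinearMap.smul_apply, hξ, hneg a c ha hc,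
      hpos b d hb hb' hd hd', hmix a d ha hd hd', hskew b c, hmix c b hc hb hb', hskew a A.ξ,
      hskew b A.ξ]
    simp
  rw [hT] at hzero
  linear_combination (norm := module) hzero

end IsNullModel

end LinearModel

end LinearModel

/-! ### Parallelizations -/

section Parallelization

variable {E : Type*} [NormedAddCommGroup E] [NormedSpace ℝ E] [FiniteDimensional ℝ E]
  {H : Type*} [TopologicalSpace H] (I : ModelWithCorners ℝ E H)
  (M : Type*) [TopologicalSpace M] [ChartedSpace H M] [IsManifold I ∞ M]

/-- A smooth parallelization of `M` with constant structure functions: each vector `v` of the model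
space gives the vector field `p ↦ F p v`, called invariant, and the Lie bracket of the
invariant fields of `v` and `w` is the invariant field of `br v w`. -/
structure Parallelization where
  F : ∀ p : M, E ≃L[ℝ] TangentSpace I p
  contMDiff_F : ∀ v, ContMDiff I I.tangent ∞ fun p : M => (⟨p, F p v⟩ : TangentBundle I M)
  br : E →ₗ[ℝ] E →ₗ[ℝ] E
  mlieBracket_F : ∀ v w (p : M),
    mlieBracket I (fun q : M => F q v) (fun q : M => F q w) p = F p (br v w)

namespace Parallelization

variable {I M} (P : Parallelization I M)

theorem mdifferentiableAt_F (v : E) (p : M) :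
    MDifferentiableAt I I.tangent (fun q : M => (⟨q, P.F q v⟩ : TangentBundle I M)) p :=
  (P.contMDiff_F v p).mdifferentiableAt (by simp)

theorem br_skew (p : M) (v w : E) : P.br v w = - P.br w v := by
  apply (P.F p).injective
  rw [map_neg, ← P.mlieBracket_F, ← P.mlieBracket_F, mlieBracket_swap_apply]

theorem br_jacobi (p : M) (u v w : E) :
    P.br u (P.br v w) = P.br (P.br u v) w + P.br v (P.br u w) := by
  have h : ∀ v w, (fun q : M => P.F q (P.br v w))
      = mlieBracket I (fun q : M => P.F q v) (fun q : M => P.F q w) := fun v w => by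
    funext q; exact (P.mlieBracket_F v w q).symm
  apply (P.F p).injective
  rw [map_add, ← P.mlieBracket_F, ← P.mlieBracket_F, ← P.mlieBracket_F, h, h, h]
  have hs : ∀ v, ContMDiffAt I I.tangent (minSmoothness ℝ 2)
      (fun q : M => (⟨q, P.F q v⟩ : TangentBundle I M)) p := fun v =>
    (P.contMDiff_F v p).of_le (by simpa using ENat.LEInfty.out)
  have : IsManifold I (minSmoothness ℝ 3) M := IsManifold.of_le (n := ∞)
    (by simpa using ENat.LEInfty.out)
  exact leibniz_identity_mlieBracket_apply (hs u) (hs v) (hs w)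

/-- A map into continuous linear maps on a finite-dimensional space is smooth as soon as all its
evaluations are. -/
theorem _root_.contMDiffAt_clm_of_apply {F₂ : Type*} [NormedAddCommGroup F₂] [NormedSpace ℝ F₂]
    {f : M → E →L[ℝ] F₂} {p : M} (h : ∀ v, ContMDiffAt I 𝓘(ℝ, F₂) ∞ (fun q => f q v) p) :
    ContMDiffAt I 𝓘(ℝ, E →L[ℝ] F₂) ∞ f p := by
  let b := Module.finBasis ℝ E
  have hf : f = fun q => ∑ i, ContinuousLinearMap.smulRightL ℝ E F₂
      (LinearMap.toContinuousLinearMap (b.coord i)) (f q (b i)) := by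
    funext q
    ext v
    simp only [FunLike.coe_sum, Finset.sum_apply]
    change f q v = ∑ i, b.repr v i • f q (b i)
    simp_rw [← map_smul, ← map_sum, b.sum_repr]
  rw [hf]
  refine contMDiffAt_finsetSum fun i _ => ?_
  exact (ContinuousLinearMap.contMDiff _).contMDiffAt.comp p (h (b i))

/-- A section of the bundle of homomorphisms from the tangent bundle to `V` is smooth as soon as its
values on the invariant fields are: in trivializations it is the composition of these values with
the inverse of the matrix of the frame. -/
theorem contMDiffAt_hom {F₂ : Type*} [NormedAddCommGroup F₂] [NormedSpace ℝ F₂] {V : M → Type*}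
    [TopologicalSpace (TotalSpace F₂ V)] [∀ q, AddCommGroup (V q)] [∀ q, Module ℝ (V q)]
    [∀ q, TopologicalSpace (V q)] [∀ q, IsTopologicalAddGroup (V q)] [∀ q, ContinuousSMul ℝ (V q)]
    [FiberBundle F₂ V] [VectorBundle ℝ F₂ V] [ContMDiffVectorBundle ∞ F₂ V I]
    (ψ : ∀ q : M, TangentSpace I q →L[ℝ] V q) (p : M)
    (h : ∀ v, ContMDiffAt I (I.prod 𝓘(ℝ, F₂)) ∞
      (fun q : M => TotalSpace.mk' F₂ q (ψ q (P.F q v))) p) :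
    ContMDiffAt I (I.prod 𝓘(ℝ, E →L[ℝ] F₂)) ∞ (fun q : M => (TotalSpace.mk' (E →L[ℝ] F₂) q (ψ q) :
      TotalSpace (E →L[ℝ] F₂) fun q : M => TangentSpace I q →L[ℝ] V q)) p := by
  rw [contMDiffAt_hom_bundle]
  refine ⟨contMDiffAt_id, ?_⟩
  let e₁ := trivializationAt E (TangentSpace I : M → Type _) p
  let e₂ := trivializationAt F₂ V p
  let A : M → E →L[ℝ] E := fun q => e₁.continuousLinearMapAt ℝ q ∘L (P.F q : E →L[ℝ] _)
  let C : M → E →L[ℝ] F₂ := fun q => e₂.continuousLinearMapAt ℝ q ∘L ψ q ∘L (P.F q : E →L[ℝ] _)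
  have hb₁ : e₁.baseSet ∈ nhds p := e₁.open_baseSet.mem_nhds (mem_baseSet_trivializationAt E _ p)
  have hb₂ : e₂.baseSet ∈ nhds p := e₂.open_baseSet.mem_nhds (mem_baseSet_trivializationAt F₂ _ p)
  have hA : ContMDiffAt I 𝓘(ℝ, E →L[ℝ] E) ∞ A p := by
    refine contMDiffAt_clm_of_apply fun v => ?_
    have h1 := (contMDiffAt_totalSpace.mp (P.contMDiff_F v p)).2
    refine h1.congr_of_eventuallyEq ?_
    filter_upwards [hb₁] with q hq
    simp [A, e₁.coe_linearMapAt_of_mem hq, e₁]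
  have hC : ContMDiffAt I 𝓘(ℝ, E →L[ℝ] F₂) ∞ C p := by
    refine contMDiffAt_clm_of_apply fun v => ?_
    have h1 := (contMDiffAt_totalSpace.mp (h v)).2
    refine h1.congr_of_eventuallyEq ?_
    filter_upwards [hb₂] with q hq
    simp [C, e₂.coe_linearMapAt_of_mem hq, e₂]
  have hAeq : ∀ q (hq : q ∈ e₁.baseSet), A q = ((P.F q).trans (e₁.continuousLinearEquivAt ℝ q hq) :
      E →L[ℝ] E) := by
    intro q hq
    ext v
    simp [A, e₁.coe_linearMapAt_of_mem hq]
  have hinv : ContMDiffAt I 𝓘(ℝ, E →L[ℝ] E) ∞ (fun q => (A q).inverse) p := by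
    have h1 : ContDiffAt ℝ ∞ ContinuousLinearMap.inverse (A p) := by
      rw [hAeq p (mem_of_mem_nhds hb₁)]
      exact contDiffAt_map_inverse _
    exact h1.contMDiffAt.comp p hA
  refine (hC.clm_comp hinv).congr_of_eventuallyEq ?_
  filter_upwards [hb₁] with q hq
  ext v
  simp only [ContinuousLinearMap.inCoordinates, ContinuousLinearMap.comp_apply, C]
  rw [hAeq q hq, ContinuousLinearMap.inverse_equiv]
  simp [e₁, e₂, Trivialization.symmL_apply _ hq]

end Parallelization

end Parallelization

section Parallelization

variable {E : Type*} [NormedAddCommGroup E] [NormedSpace ℝ E] [FiniteDimensional ℝ E]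
  {H : Type*} [TopologicalSpace H] {I : ModelWithCorners ℝ E H}
  {M : Type*} [TopologicalSpace M] [ChartedSpace H M] [IsManifold I ∞ M]

theorem finrank_eigenspace_conj {V W : Type*} [AddCommGroup V] [Module ℝ V] [AddCommGroup W]
    [Module ℝ W] (e : V ≃ₗ[ℝ] W) (f : V →ₗ[ℝ] V) (μ : ℝ) :
    Module.finrank ℝ (Module.End.eigenspace (e.toLinearMap ∘ₗ f ∘ₗ e.symm.toLinearMap) μ)
      = Module.finrank ℝ (Module.End.eigenspace f μ) := by
  have h : Module.End.eigenspace (e.toLinearMap ∘ₗ f ∘ₗ e.symm.toLinearMap) μ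
      = (Module.End.eigenspace f μ).map e.toLinearMap := by
    ext w
    simp only [Module.End.mem_eigenspace_iff, Submodule.mem_map_equiv, LinearMap.comp_apply,
      LinearEquiv.coe_coe]
    rw [← e.symm.injective.eq_iff]
    simp
  rw [h]
  exact LinearEquiv.finrank_map_eq e _

theorem mvfderiv_clm_comp {F₁ F₂ : Type*} [NormedAddCommGroup F₁] [NormedSpace ℝ F₁]
    [NormedAddCommGroup F₂] [NormedSpace ℝ F₂] (L : F₁ →L[ℝ] F₂) {f : M → F₁} {p : M}
    (hf : MDifferentiableAt I 𝓘(ℝ, F₁) f p) (v : TangentSpace I p) :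
    mvfderiv I (fun q => L (f q)) p v = L (mvfderiv I f p v) := by
  have h := L.hasMFDerivAt.comp p hf.hasMFDerivAt
  have h2 : mfderiv I 𝓘(ℝ, F₂) (fun q => L (f q)) p = _ := h.mfderiv
  simp only [mvfderiv]
  rw [h2]
  rfl

theorem mvfderiv_bilin_comp {F₁ F₂ F₃ : Type*} [NormedAddCommGroup F₁] [NormedSpace ℝ F₁]
    [NormedAddCommGroup F₂] [NormedSpace ℝ F₂] [NormedAddCommGroup F₃] [NormedSpace ℝ F₃]
    (B : F₁ →L[ℝ] F₂ →L[ℝ] F₃) {f : M → F₁} {g : M → F₂} {p : M}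
    (hf : MDifferentiableAt I 𝓘(ℝ, F₁) f p) (hg : MDifferentiableAt I 𝓘(ℝ, F₂) g p)
    (v : TangentSpace I p) :
    mvfderiv I (fun q => B (f q) (g q)) p v
      = B (mvfderiv I f p v) (g p) + B (f p) (mvfderiv I g p v) := by
  have hB := (B.isBoundedBilinearMap.hasFDerivAt (f p, g p)).hasMFDerivAt
  have hfg : HasMFDerivAt I 𝓘(ℝ, F₁ × F₂) (fun q => (f q, g q)) p
      ((mvfderiv I f p).prod (mvfderiv I g p)) :=
    ⟨hf.continuousAt.prodMk hg.continuousAt, hf.hasMFDerivAt.2.prodMk hg.hasMFDerivAt.2⟩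
  have h := HasMFDerivAt.comp (g := fun z : F₁ × F₂ => B z.1 z.2) p hB hfg
  have h2 : mfderiv I 𝓘(ℝ, F₃) (fun q => B (f q) (g q)) p = _ := h.mfderiv
  simp only [mvfderiv]
  rw [h2]
  change B (f p) (mvfderiv I g p v) + B (mvfderiv I f p v) (g p) = _
  rw [add_comm]
  rfl

namespace Parallelization

variable (P : Parallelization I M)

/-- The components of a vector field with respect to a parallelization. -/
def coord (X : ∀ p : M, TangentSpace I p) (p : M) : E := (P.F p).symm (X p)

@[simp]
theorem F_coord (X : ∀ p : M, TangentSpace I p) (p : M) : P.F p (P.coord X p) = X p :=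
  (P.F p).apply_symm_apply _

@[simp]
theorem coord_F (v : E) (p : M) : P.coord (fun q => P.F q v) p = v :=
  (P.F p).symm_apply_apply _

theorem coord_add (X Y : ∀ p : M, TangentSpace I p) : P.coord (X + Y) = P.coord X + P.coord Y := by
  funext p; exact map_add (P.F p).symm _ _

theorem coord_smul (f : M → ℝ) (X : ∀ p : M, TangentSpace I p) :
    P.coord (f • X) = f • P.coord X := by
  funext p; exact map_smul (P.F p).symm _ _

theorem mdifferentiableAt_coord {X : ∀ p : M, TangentSpace I p} {p : M}
    (hX : MDifferentiableAt I I.tangent (fun q => (⟨q, X q⟩ : TangentBundle I M)) p) :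
    MDifferentiableAt I 𝓘(ℝ, E) (P.coord X) p := by
  have h1 := P.contMDiffAt_hom (V := Bundle.Trivial M E) (F₂ := E)
    (fun q => ((P.F q).symm : TangentSpace I q →L[ℝ] E)) p (fun v => by
      refine contMDiffAt_totalSpace.mpr ⟨contMDiffAt_id, ?_⟩
      refine (contMDiffAt_const (c := v)).congr_of_eventuallyEq (.of_forall fun q => ?_)
      simp)
  have h2 := MDifferentiableAt.clm_bundle_apply (F₁ := E) (F₂ := E)
    (h1.mdifferentiableAt (by simp)) hX
  exact ((mdifferentiableAt_totalSpace ..).mp h2).2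

/-- The flat connection for which the invariant vector fields are parallel. -/
def flat : CovariantDerivative I E (TangentSpace I : M → Type _) where
  toFun Y p := (P.F p : E →L[ℝ] TangentSpace I p) ∘L mvfderiv I (P.coord Y) p
  isCovariantDerivativeOnUniv :=
    { add := fun {Y Z p} hY hZ _ => by
        rw [coord_add, mvfderiv_add (P.mdifferentiableAt_coord hY) (P.mdifferentiableAt_coord hZ)]
        ext v; simp
      leibniz := fun {Y f p} hY hf _ => by
        rw [coord_smul, mvfderiv_smul hf (P.mdifferentiableAt_coord hY)]
        ext v; simp }

theorem flat_apply (Y : ∀ p : M, TangentSpace I p) (p : M) (v : TangentSpace I p) :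
    P.flat Y p v = P.F p (mvfderiv I (P.coord Y) p v) := rfl

theorem flat_F (v : E) (p : M) : P.flat (fun q => P.F q v) p = 0 := by
  ext w
  rw [flat_apply]
  have : P.coord (fun q => P.F q v) = fun _ => v := funext fun q => P.coord_F v q
  rw [this, mvfderiv_const]
  simp

/-- The Lie bracket of arbitrary vector fields in terms of their components. -/
theorem coord_mlieBracket {X Y : ∀ p : M, TangentSpace I p} {p : M}
    (hX : MDifferentiableAt I I.tangent (fun q => (⟨q, X q⟩ : TangentBundle I M)) p)
    (hY : MDifferentiableAt I I.tangent (fun q => (⟨q, Y q⟩ : TangentBundle I M)) p) :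
    (P.F p).symm (mlieBracket I X Y p) = mvfderiv I (P.coord Y) p (X p)
      - mvfderiv I (P.coord X) p (Y p) + P.br (P.coord X p) (P.coord Y p) := by
  have : IsManifold I 2 M := IsManifold.of_le (n := ∞) ENat.LEInfty.out
  -- the torsion of the flat connection is `-br` on invariant fields, hence on all fields
  have h1 := P.flat.torsion_apply (P.mdifferentiableAt_F (P.coord X p) p)
    (P.mdifferentiableAt_F (P.coord Y p) p)
  have h2 := P.flat.torsion_apply hX hY
  rw [P.F_coord, P.F_coord, h2, flat_F, flat_F, P.mlieBracket_F, flat_apply, flat_apply] at h1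
  have h3 : mlieBracket I X Y p = P.F p (mvfderiv I (P.coord Y) p (X p)
      - mvfderiv I (P.coord X) p (Y p) + P.br (P.coord X p) (P.coord Y p)) := by
    simp only [map_add, map_sub]
    simp only [zero_apply] at h1
    linear_combination (norm := module) -h1
  rw [h3, ContinuousLinearEquiv.symm_apply_apply]

/-- The invariant paracontact metric structure with given linear data. -/
def paracontact {n : ℕ} (A : LinearModel n P.br) : ParacontactMetricStructure I M n where
  φ p := (P.F p : E →L[ℝ] TangentSpace I p) ∘L A.φ ∘L ((P.F p).symm : TangentSpace I p →L[ℝ] E)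
  ξ p := P.F p A.ξ
  η p := A.η ∘L ((P.F p).symm : TangentSpace I p →L[ℝ] E)
  g p := (ContinuousLinearMap.precomp ℝ ((P.F p).symm : TangentSpace I p →L[ℝ] E)) ∘L A.g ∘L
    ((P.F p).symm : TangentSpace I p →L[ℝ] E)
  smooth_φ p := P.contMDiffAt_hom (V := (TangentSpace I : M → Type _)) (F₂ := E) _ p fun v => by
    simpa using P.contMDiff_F (A.φ v) p
  smooth_ξ := P.contMDiff_F A.ξ
  smooth_η p := P.contMDiffAt_hom (V := Bundle.Trivial M ℝ) (F₂ := ℝ) _ p fun v => by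
    refine contMDiffAt_totalSpace.mpr ⟨contMDiffAt_id, ?_⟩
    refine (contMDiffAt_const (c := A.η v)).congr_of_eventuallyEq (.of_forall fun q => ?_)
    simp
  smooth_g p := P.contMDiffAt_hom (V := fun q : M => TangentSpace I q →L[ℝ] Bundle.Trivial M ℝ q)
    (F₂ := E →L[ℝ] ℝ) _ p fun v =>
      P.contMDiffAt_hom (V := Bundle.Trivial M ℝ) (F₂ := ℝ) _ p fun w => by
    refine contMDiffAt_totalSpace.mpr ⟨contMDiffAt_id, ?_⟩
    refine (contMDiffAt_const (c := A.g v w)).congr_of_eventuallyEq (.of_forall fun q => ?_)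
    simp
  η_ξ p := by simp [A.η_ξ]
  φ_φ p v := by simp [A.φ_φ]
  finrank_pos p := (finrank_eigenspace_conj (P.F p).toLinearEquiv A.φ 1).trans A.finrank_pos
  finrank_neg p := (finrank_eigenspace_conj (P.F p).toLinearEquiv A.φ (-1)).trans A.finrank_neg
  symm_g p v w := A.symm_g _ _
  nondegenerate_g p v h := by
    have := A.nondegenerate_g ((P.F p).symm v) fun w => by simpa using h (P.F p w)
    simpa using this
  g_φ_φ p v w := by simp [A.g_φ_φ]
  dη_eq X Y p hX hY := by
    have hX' := hX.mdifferentiableAt (by simp)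
    have hY' := hY.mdifferentiableAt (by simp)
    have h1 := mvfderiv_clm_comp A.η (P.mdifferentiableAt_coord hX') (Y p)
    have h2 := mvfderiv_clm_comp A.η (P.mdifferentiableAt_coord hY') (X p)
    change 1 / 2 * (mvfderiv I (fun q => A.η (P.coord Y q)) p (X p)
      - mvfderiv I (fun q => A.η (P.coord X q)) p (Y p)
      - A.η ((P.F p).symm (mlieBracket I X Y p)))
      = A.g (P.coord X p) ((P.F p).symm (P.F p (A.φ (P.coord Y p))))
    rw [h1, h2, P.coord_mlieBracket hX' hY', ContinuousLinearEquiv.symm_apply_apply]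
    simp only [map_add, map_sub, A.η_br]
    ring

section Invariant

variable {n : ℕ} (A : LinearModel n P.br)

theorem paracontact_φ_F (p : M) (v : E) :
    (P.paracontact A).φ p (P.F p v) = P.F p (A.φ v) := by
  simp [paracontact]

theorem paracontact_h_F {h : E →L[ℝ] E}
    (hh : ∀ v, (2 : ℝ) • h v = P.br A.ξ (A.φ v) - A.φ (P.br A.ξ v)) (p : M) (v : E) :
    (P.paracontact A).h p (P.F p v) = P.F p (h v) := by
  have h1 := (P.paracontact A).h_apply (P.mdifferentiableAt_F v p)
  rw [h1, lieDerivEnd]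
  simp only [paracontact_φ_F]
  change (1 / 2 : ℝ) • (mlieBracket I (fun q => P.F q A.ξ) (fun q => P.F q (A.φ v)) p
    - (P.paracontact A).φ p (mlieBracket I (fun q => P.F q A.ξ) (fun q => P.F q v) p)) = _
  rw [P.mlieBracket_F, P.mlieBracket_F, paracontact_φ_F, ← map_sub, ← hh, map_smul, smul_smul]
  norm_num

/-- The connection with `∇_{F v} (F w) = F (Γ v w)` on invariant fields. -/
def connection (Γ : E →L[ℝ] E →L[ℝ] E) :
    CovariantDerivative I E (TangentSpace I : M → Type _) :=
  P.flat.addOneForm fun p => (ContinuousLinearMap.precomp (TangentSpace I p)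
    ((P.F p).symm : TangentSpace I p →L[ℝ] E)) ∘L
      (ContinuousLinearMap.postcomp E (P.F p : E →L[ℝ] TangentSpace I p)) ∘L Γ.flip ∘L
        ((P.F p).symm : TangentSpace I p →L[ℝ] E)

theorem connection_apply (Γ : E →L[ℝ] E →L[ℝ] E) (Y : ∀ p : M, TangentSpace I p) (p : M)
    (v : TangentSpace I p) :
    P.connection Γ Y p v
      = P.F p (mvfderiv I (P.coord Y) p v + Γ ((P.F p).symm v) (P.coord Y p)) := by
  rw [map_add]
  rfl

theorem coord_connection (Γ : E →L[ℝ] E →L[ℝ] E) (Y : ∀ p : M, TangentSpace I p) (p : M)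
    (v : TangentSpace I p) :
    (P.F p).symm (P.connection Γ Y p v)
      = mvfderiv I (P.coord Y) p v + Γ ((P.F p).symm v) (P.coord Y p) := by
  rw [connection_apply, ContinuousLinearEquiv.symm_apply_apply]

/-- The Koszul formula on invariant fields gives the Levi-Civita connection. -/
theorem isLeviCivita {Γ : E →L[ℝ] E →L[ℝ] E} (hskew : ∀ v w, P.br v w = - P.br w v)
    (hΓ : ∀ x y z, 2 * A.g (Γ x y) z
      = A.g (P.br x y) z - A.g (P.br x z) y - A.g (P.br y z) x) :
    IsLeviCivita (P.paracontact A).g (P.connection Γ) where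
  metric Y Z p hY hZ v := by
    have h1 := mvfderiv_bilin_comp A.g (P.mdifferentiableAt_coord hY)
      (P.mdifferentiableAt_coord hZ) v
    change mvfderiv I (fun q => A.g (P.coord Y q) (P.coord Z q)) p v
      = A.g ((P.F p).symm (P.connection Γ Y p v)) (P.coord Z p)
        + A.g (P.coord Y p) ((P.F p).symm (P.connection Γ Z p v))
    rw [h1, coord_connection, coord_connection]
    have h2 := hΓ ((P.F p).symm v) (P.coord Y p) (P.coord Z p)
    have h3 := hΓ ((P.F p).symm v) (P.coord Z p) (P.coord Y p)
    rw [hskew (P.coord Z p)] at h3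
    rw [A.symm_g (P.coord Y p) (_ + _)]
    simp only [map_add, map_neg, add_apply, neg_apply] at h3 ⊢
    rw [A.symm_g (mvfderiv I (P.coord Z) p v)]
    linarith
  torsion_free := by
    have : IsManifold I 2 M := IsManifold.of_le (n := ∞) ENat.LEInfty.out
    rw [CovariantDerivative.torsion_eq_zero_iff]
    intro X Y p hX hY
    have htor : Γ (P.coord X p) (P.coord Y p) - Γ (P.coord Y p) (P.coord X p)
        = P.br (P.coord X p) (P.coord Y p) := by
      refine A.ext_g fun z => ?_
      have h1 := hΓ (P.coord X p) (P.coord Y p) z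
      have h2 := hΓ (P.coord Y p) (P.coord X p) z
      rw [hskew (P.coord Y p) (P.coord X p)] at h2
      simp only [map_sub, map_neg, sub_apply, neg_apply] at h1 h2 ⊢
      linarith
    apply (P.F p).symm.injective
    rw [map_sub, coord_connection, coord_connection, P.coord_mlieBracket hX hY, ← htor]
    change _ + Γ (P.coord X p) (P.coord Y p) - (_ + Γ (P.coord Y p) (P.coord X p)) = _
    abel

/-- The curvature identity on invariant fields implies the `(-1, 0)`-condition for all vector
fields. -/
theorem isKappaMuSpace {h : E →L[ℝ] E} (N : A.IsNullModel h) :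
    (P.paracontact A).IsKappaMuSpace (-1) 0 := by
  obtain ⟨Γ, hΓ⟩ := A.exists_koszul
  have hLC := P.isLeviCivita A N.skew hΓ
  refine ⟨P.connection Γ, hLC, fun X Y hX hY p => ?_⟩
  have : IsManifold I 2 M := IsManifold.of_le (n := ∞) ENat.LEInfty.out
  have hX' := (hX p).mdifferentiableAt (by simp)
  have hY' := (hY p).mdifferentiableAt (by simp)
  let B : E →L[ℝ] E := -A.φ - h
  have hξ : ∀ q v, P.connection Γ (P.paracontact A).ξ q v = P.F q (B ((P.F q).symm v)) := by
    intro q v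
    change P.connection Γ (fun q => P.F q A.ξ) q v = _
    have h1 : P.coord (fun q : M => P.F q A.ξ) = fun _ => A.ξ := funext fun q => P.coord_F _ q
    rw [connection_apply, h1, mvfderiv_const, N.koszul_ξ hΓ]
    simp [B]
  have hξ2 : ∀ Z : ∀ p : M, TangentSpace I p, ∀ v : TangentSpace I p,
      MDifferentiableAt I I.tangent (fun q => (⟨q, Z q⟩ : TangentBundle I M)) p →
      P.connection Γ (fun q => P.connection Γ (P.paracontact A).ξ q (Z q)) p v
        = P.F p (B (mvfderiv I (P.coord Z) p v) + Γ ((P.F p).symm v) (B (P.coord Z p))) := by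
    intro Z v hZ
    have h1 : P.coord (fun q => P.connection Γ (P.paracontact A).ξ q (Z q))
        = fun q => B (P.coord Z q) := by
      funext q
      rw [coord, hξ, ContinuousLinearEquiv.symm_apply_apply]
      rfl
    rw [connection_apply, h1, mvfderiv_clm_comp B (P.mdifferentiableAt_coord hZ)]
  apply (P.F p).symm.injective
  rw [curvature, hξ2 Y _ hY', hξ2 X _ hX', hξ, ← map_sub, ← map_sub,
    ContinuousLinearEquiv.symm_apply_apply, P.coord_mlieBracket hX' hY']
  have h2 := N.curvature_eq hΓ (P.coord X p) (P.coord Y p)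
  have h3 : (P.F p).symm ((-1 : ℝ) • ((P.paracontact A).η p (Y p) • X p
      - (P.paracontact A).η p (X p) • Y p) + (0 : ℝ) • ((P.paracontact A).η p (Y p) •
        (P.paracontact A).h p (X p) - (P.paracontact A).η p (X p) • (P.paracontact A).h p (Y p)))
      = -(A.η (P.coord Y p) • P.coord X p - A.η (P.coord X p) • P.coord Y p) := by
    rw [zero_smul, add_zero, neg_one_smul, map_neg, map_sub, map_smul, map_smul]
    rfl
  rw [h3, ← h2]
  simp only [map_add, map_sub]
  simp only [B, sub_apply, neg_apply]
  change _ + Γ (P.coord X p) _ - (_ + Γ (P.coord Y p) _) - _ = _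
  simp only [map_sub, map_neg]
  abel

end Invariant

end Parallelization

end Parallelization

/-! ### Lie groups -/

section LieGroupParallelization

variable {E : Type*} [NormedAddCommGroup E] [NormedSpace ℝ E] [FiniteDimensional ℝ E]
  {H : Type*} [TopologicalSpace H] (I : ModelWithCorners ℝ E H)
  (G : Type*) [TopologicalSpace G] [ChartedSpace H G] [Group G] [LieGroup I ∞ G]

variable {G} in
theorem mdifferentiableAt_mul_left (a p : G) : MDifferentiableAt I I (a * ·) p :=
  (contMDiff_mul_left (I := I) (n := ∞) (a := a)).contMDiffAt.mdifferentiableAt (by simp)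

variable {G} in
theorem mfderiv_mul_left_comp (a b p : G) (v : TangentSpace I p) :
    mfderiv I I (a * ·) (b * p) (mfderiv I I (b * ·) p v) = mfderiv I I (a * b * ·) p v := by
  have h1 : (fun x : G => a * b * x) = (a * ·) ∘ (b * ·) := by
    funext x; simp [mul_assoc]
  rw [h1, mfderiv_comp (I' := I) p (mdifferentiableAt_mul_left I a (b * p))
    (mdifferentiableAt_mul_left I b p)]
  rfl

variable {G} in
theorem mfderiv_mul_left_inv (a b p : G) (h : a * b = 1) (v : TangentSpace I p) :
    mfderiv I I (a * ·) (b * p) (mfderiv I I (b * ·) p v) = v := by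
  rw [mfderiv_mul_left_comp]
  have h1 : (fun x : G => a * b * x) = id := by funext x; simp [h]
  rw [h1, mfderiv_id]
  rfl

variable {I G} in
/-- Left-invariant vector fields on a smooth Lie group are smooth. Mathlib's
`contMDiff_mulInvariantVectorField` gives only smoothness of order `minSmoothness ℝ 2`. -/
theorem contMDiff_mulInvariantVectorField_infty (v : GroupLieAlgebra I G) :
    ContMDiff I I.tangent ∞
      (fun g : G => (⟨g, mulInvariantVectorField v g⟩ : TangentBundle I G)) := by
  -- the field is `g ↦ Dμ (0_g, v)`, where `μ` is the multiplication
  let F₁ : G → TangentBundle I G × TangentBundle I G :=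
    fun g => (TotalSpace.mk' E g 0, TotalSpace.mk' E 1 v)
  have S₁ : ContMDiff I (I.tangent.prod I.tangent) ∞ F₁ :=
    (contMDiff_zeroSection ℝ (TangentSpace I : G → Type _)).prodMk contMDiff_const
  let F₂ : TangentBundle I G × TangentBundle I G → TangentBundle (I.prod I) (G × G) :=
    (equivTangentBundleProd I G I G).symm
  have S₂ : ContMDiff (I.tangent.prod I.tangent) (I.prod I).tangent ∞ F₂ :=
    contMDiff_equivTangentBundleProd_symm
  let F₃ : TangentBundle (I.prod I) (G × G) → TangentBundle I G :=
    tangentMap (I.prod I) I (fun p : G × G => p.1 * p.2)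
  have S₃ : ContMDiff (I.prod I).tangent I.tangent ∞ F₃ :=
    ContMDiff.contMDiff_tangentMap (m := ∞) (n := ∞) (contMDiff_mul I ∞) (by simp)
  convert! (S₃.comp S₂).comp S₁ with g
  · simp [F₁, F₂, F₃]
  · simp only [Function.comp_apply, tangentMap, F₃, F₂, F₁]
    rw [mfderiv_prod_eq_add_apply ((contMDiff_mul I ∞).mdifferentiableAt (by simp))]
    exact (zero_add _).symm.trans (congrArg (· + mfderiv I I (g * ·) 1 v)
      (map_zero (mfderiv I I (· * (1 : G)) g)).symm)

theorem lieGroup_minSmoothness : LieGroup I (minSmoothness ℝ 3) G := by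
  rw [minSmoothness_of_isRCLikeNormedField]
  infer_instance

/-- The Lie bracket of the Lie algebra of a Lie group as a bilinear map. -/
def lieBracketBilin : GroupLieAlgebra I G →ₗ[ℝ] GroupLieAlgebra I G →ₗ[ℝ] GroupLieAlgebra I G :=
  haveI := lieGroup_minSmoothness I G
  LinearMap.mk₂ ℝ (fun v w => ⁅v, w⁆) add_lie smul_lie lie_add lie_smul

/-- The parallelization of a Lie group by its left-invariant vector fields. -/
def leftParallelization : Parallelization I G where
  F p := ContinuousLinearEquiv.equivOfInverse (mfderiv I I (p * ·) (1 : G))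
    (mfderiv I I (p⁻¹ * ·) p) (fun v => by
      have h := mfderiv_mul_left_inv I p⁻¹ p 1 (inv_mul_cancel p) v
      rwa [mul_one] at h) (fun v => by
      have h := mfderiv_mul_left_inv I p p⁻¹ p (mul_inv_cancel p) v
      rwa [inv_mul_cancel] at h)
  contMDiff_F v := contMDiff_mulInvariantVectorField_infty v
  br := lieBracketBilin I G
  mlieBracket_F v w p :=
    haveI := lieGroup_minSmoothness I G
    (congrFun (mulInvariantVector_mlieBracket (I := I) (G := G) v w) p).symm

theorem leftParallelization_one (v : E) : (leftParallelization I G).F 1 v = v := by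
  change mfderiv I I ((1 : G) * ·) (1 : G) v = v
  have h1 : (fun x : G => 1 * x) = id := by funext x; simp
  rw [h1, mfderiv_id]
  rfl

variable {G} in
theorem leftParallelization_mul (a p : G) (v : E) :
    mfderiv I I (a * ·) p ((leftParallelization I G).F p v) = (leftParallelization I G).F (a * p) v
    := by
  have h := mfderiv_mul_left_comp I a p 1 v
  rw [mul_one] at h
  exact h

theorem isLeftInvariant {n : ℕ} (A : LinearModel n (leftParallelization I G).br) :
    ((leftParallelization I G).paracontact A).IsLeftInvariant := by
  have key : ∀ (a p : G) (v : TangentSpace I p), ((leftParallelization I G).F (a * p)).symm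
      (mfderiv I I (a * ·) p v) = ((leftParallelization I G).F p).symm v := by
    intro a p v
    apply ((leftParallelization I G).F (a * p)).injective
    rw [ContinuousLinearEquiv.apply_symm_apply, ← leftParallelization_mul,
      ContinuousLinearEquiv.apply_symm_apply]
  refine ⟨fun a p v => ?_, fun a p => ?_, fun a p v => ?_, fun a p v w => ?_⟩
  · change (leftParallelization I G).F (a * p) (A.φ (((leftParallelization I G).F (a * p)).symm
      (mfderiv I I (a * ·) p v))) = _
    rw [key, ← leftParallelization_mul]
    rfl
  · exact (leftParallelization_mul I a p A.ξ).symm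
  · change A.η (((leftParallelization I G).F (a * p)).symm (mfderiv I I (a * ·) p v)) = _
    rw [key]
    rfl
  · change A.g (((leftParallelization I G).F (a * p)).symm (mfderiv I I (a * ·) p v))
      (((leftParallelization I G).F (a * p)).symm (mfderiv I I (a * ·) p w)) = _
    rw [key, key]
    rfl

end LieGroupParallelization

/-! ### Adapted bases -/

section AdaptedBasis

variable {E : Type*} [NormedAddCommGroup E] [NormedSpace ℝ E] [FiniteDimensional ℝ E] {n : ℕ}
  (b : Module.Basis (Option (Fin n ⊕ Fin n)) ℝ E)

/-- The vector `ξ` of a basis `ξ, X_i, Y_i`. -/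
def basisξ : E := b none

/-- The vectors `X_i` of a basis `ξ, X_i, Y_i`. -/
def basisX (i : Fin n) : E := b (some (Sum.inl i))

/-- The vectors `Y_i` of a basis `ξ, X_i, Y_i`. -/
def basisY (i : Fin n) : E := b (some (Sum.inr i))

theorem basis_ext {F : Type*} [AddCommGroup F] [Module ℝ F] {f f' : E →ₗ[ℝ] F}
    (hξ : f (basisξ b) = f' (basisξ b)) (hX : ∀ i, f (basisX b i) = f' (basisX b i))
    (hY : ∀ i, f (basisY b i) = f' (basisY b i)) : f = f' :=
  b.ext fun a => by
    rcases a with _ | i | i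
    exacts [hξ, hX i, hY i]

/-- The linear map with prescribed values on a basis `ξ, X_i, Y_i`. -/
def basisMap {F : Type*} [AddCommGroup F] [Module ℝ F] (u : F) (x y : Fin n → F) : E →ₗ[ℝ] F :=
  b.constr ℝ fun a => a.elim u (Sum.elim x y)

section basisMap

variable {F : Type*} [AddCommGroup F] [Module ℝ F] (u : F) (x y : Fin n → F)

@[simp] theorem basisMap_ξ : basisMap b u x y (basisξ b) = u := by simp [basisMap, basisξ]

@[simp] theorem basisMap_X (i : Fin n) : basisMap b u x y (basisX b i) = x i := by
  simp [basisMap, basisX]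

@[simp] theorem basisMap_Y (i : Fin n) : basisMap b u x y (basisY b i) = y i := by
  simp [basisMap, basisY]

end basisMap

/-- `φ ξ = 0`, `φ X_i = X_i`, `φ Y_i = -Y_i`. -/
def basisφ : E →L[ℝ] E :=
  LinearMap.toContinuousLinearMap (basisMap b 0 (basisX b) fun i => -basisY b i)

/-- `η ξ = 1`, `η X_i = η Y_i = 0`. -/
def basisη : E →L[ℝ] ℝ :=
  LinearMap.toContinuousLinearMap (basisMap b 1 0 0)

/-- `h ξ = 0`, `h X_i = e_i Y_i`, `h Y_i = 0`. -/
def basish (e : Fin n → ℝ) : E →L[ℝ] E :=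
  LinearMap.toContinuousLinearMap (basisMap b 0 (fun i => e i • basisY b i) 0)

/-- The symmetric form whose only non-vanishing components are `g(ξ, ξ) = 1` and
`g(X_i, Y_i) = s_i`. -/
def basisg (s : Fin n → ℝ) : E →L[ℝ] E →L[ℝ] ℝ :=
  LinearMap.toContinuousLinearMap (LinearMap.toContinuousLinearMap.toLinearMap ∘ₗ
    basisMap b (basisMap b (1 : ℝ) 0 0) (fun i => basisMap b 0 0 (Pi.single i (s i)))
      (fun i => basisMap b 0 (Pi.single i (s i)) 0))

@[simp] theorem basisφ_ξ : basisφ b (basisξ b) = 0 := by simp [basisφ]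
@[simp] theorem basisφ_X (i : Fin n) : basisφ b (basisX b i) = basisX b i := by simp [basisφ]
@[simp] theorem basisφ_Y (i : Fin n) : basisφ b (basisY b i) = -basisY b i := by simp [basisφ]
@[simp] theorem basisη_ξ : basisη b (basisξ b) = 1 := by simp [basisη]
@[simp] theorem basisη_X (i : Fin n) : basisη b (basisX b i) = 0 := by simp [basisη]
@[simp] theorem basisη_Y (i : Fin n) : basisη b (basisY b i) = 0 := by simp [basisη]

section basish

variable (e : Fin n → ℝ)

@[simp] theorem basish_ξ : basish b e (basisξ b) = 0 := by simp [basish]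
@[simp] theorem basish_X (i : Fin n) : basish b e (basisX b i) = e i • basisY b i := by
  simp [basish]
@[simp] theorem basish_Y (i : Fin n) : basish b e (basisY b i) = 0 := by simp [basish]

end basish

section basisg

variable (s : Fin n → ℝ)

@[simp] theorem basisg_ξ_ξ : basisg b s (basisξ b) (basisξ b) = 1 := by simp [basisg]
@[simp] theorem basisg_ξ_X (i : Fin n) : basisg b s (basisξ b) (basisX b i) = 0 := by
  simp [basisg]
@[simp] theorem basisg_ξ_Y (i : Fin n) : basisg b s (basisξ b) (basisY b i) = 0 := by
  simp [basisg]
@[simp] theorem basisg_X_ξ (i : Fin n) : basisg b s (basisX b i) (basisξ b) = 0 := by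
  simp [basisg]
@[simp] theorem basisg_Y_ξ (i : Fin n) : basisg b s (basisY b i) (basisξ b) = 0 := by
  simp [basisg]
@[simp] theorem basisg_X_X (i j : Fin n) : basisg b s (basisX b i) (basisX b j) = 0 := by
  simp [basisg]
@[simp] theorem basisg_Y_Y (i j : Fin n) : basisg b s (basisY b i) (basisY b j) = 0 := by
  simp [basisg]
@[simp] theorem basisg_X_Y (i j : Fin n) :
    basisg b s (basisX b i) (basisY b j) = if i = j then s i else 0 := by
  simp [basisg, Pi.single_apply, eq_comm]
@[simp] theorem basisg_Y_X (i j : Fin n) :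
    basisg b s (basisY b i) (basisX b j) = if i = j then s i else 0 := by
  simp [basisg, Pi.single_apply, eq_comm]

end basisg

/-- The brackets of a basis `ξ, X_i, Y_i` are those of an invariant `(-1, 0)`-structure with
`g(X_i, Y_i) = s_i` and `h X_i = e_i Y_i`. The vectors `X_i + (e_i / 2) Y_i` and `Y_i` are
eigenvectors of `-φ - h` for `-1` and `1`; the fields are the conditions of
`LinearModel.IsNullModel` and of `dη(v, w) = g(v, φ w)` on these vectors. -/
structure IsNullBasis (br : E →ₗ[ℝ] E →ₗ[ℝ] E) (s e : Fin n → ℝ) : Prop where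
  skew : ∀ v w, br v w = - br w v
  jacobi : ∀ u v w, br u (br v w) = br (br u v) w + br v (br u w)
  sign_ne_zero : ∀ i, s i ≠ 0
  η_ξ_X : ∀ i, basisη b (br (basisξ b) (basisX b i)) = 0
  η_X_X : ∀ i j, i < j → basisη b (br (basisX b i) (basisX b j)) = 0
  η_X_Y : ∀ i j, basisη b (br (basisX b i) (basisY b j)) = if i = j then 2 * s i else 0
  φ_ξ_Y : ∀ i, basisφ b (br (basisξ b) (basisY b i)) = - br (basisξ b) (basisY b i)
  φ_ξ_X : ∀ i, br (basisξ b) (basisX b i) - basisφ b (br (basisξ b) (basisX b i))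
    = (2 * e i) • basisY b i
  ad_ξ_X : ∀ i, br (basisξ b) (basisX b i + e i • basisY b i)
    = basisφ b (br (basisξ b) (basisX b i)) + basish b e (br (basisξ b) (basisX b i))
  φ_Y_Y : ∀ i j, i < j → basisφ b (br (basisY b i) (basisY b j)) = - br (basisY b i) (basisY b j)
  φ_tilde : ∀ i j, i < j →
    ∀ z, z = br (basisX b i + (e i / 2) • basisY b i) (basisX b j + (e j / 2) • basisY b j) →
      basisφ b z = z - basish b e z
  g_h : ∀ i j k, e k * basisg b s (br (basisX b i) (basisY b j)) (basisY b k)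
    + e i * basisg b s (br (basisX b k) (basisY b j)) (basisY b i) = 0

theorem basisφ_basisφ (v : E) : basisφ b (basisφ b v) = v - basisη b v • basisξ b := by
  have : (basisφ b : E →ₗ[ℝ] E) ∘ₗ (basisφ b : E →ₗ[ℝ] E)
      = LinearMap.id - (basisη b : E →ₗ[ℝ] ℝ).smulRight (basisξ b) :=
    basis_ext b (by simp) (by simp) (by simp)
  exact LinearMap.congr_fun this v

theorem basisg_symm (s : Fin n → ℝ) (v w : E) : basisg b s v w = basisg b s w v := by
  let gl : E →ₗ[ℝ] E →ₗ[ℝ] ℝ := ContinuousLinearMap.coeLM ℝ ∘ₗ (basisg b s : E →ₗ[ℝ] E →L[ℝ] ℝ)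
  have : gl = gl.flip := by
    refine basis_ext b ?_ (fun i => ?_) (fun i => ?_) <;>
    refine basis_ext b ?_ (fun j => ?_) (fun j => ?_) <;>
    simp [gl] <;> split_ifs <;> simp_all
  exact LinearMap.congr_fun₂ this v w

theorem basisg_φ_φ (s : Fin n → ℝ) (v w : E) : basisg b s (basisφ b v) (basisφ b w)
    = - basisg b s v w + basisη b v * basisη b w := by
  let gl : E →ₗ[ℝ] E →ₗ[ℝ] ℝ := ContinuousLinearMap.coeLM ℝ ∘ₗ (basisg b s : E →ₗ[ℝ] E →L[ℝ] ℝ)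
  have : gl.compl₁₂ (basisφ b : E →ₗ[ℝ] E) (basisφ b : E →ₗ[ℝ] E)
      = - gl + (LinearMap.mul ℝ ℝ).compl₁₂ (basisη b : E →ₗ[ℝ] ℝ) (basisη b : E →ₗ[ℝ] ℝ) := by
    refine basis_ext b ?_ (fun i => ?_) (fun i => ?_) <;>
    refine basis_ext b ?_ (fun j => ?_) (fun j => ?_) <;>
    simp [gl]
  exact LinearMap.congr_fun₂ this v w

theorem basisg_nondegenerate (s : Fin n → ℝ) (hs : ∀ i, s i ≠ 0) (v : E)
    (h : ∀ w, basisg b s v w = 0) : v = 0 := by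
  have hξ : (basisg b s).flip (basisξ b) = LinearMap.toContinuousLinearMap (b.coord none) := by
    ext w
    refine LinearMap.congr_fun (basis_ext b (f := ((basisg b s).flip (basisξ b) : E →ₗ[ℝ] ℝ))
      (f' := b.coord none) ?_ (fun j => ?_) (fun j => ?_)) w <;>
    simp <;> simp [basisξ, basisX, basisY]
  have hX : ∀ i, (basisg b s).flip (basisX b i)
      = LinearMap.toContinuousLinearMap (s i • b.coord (some (Sum.inr i))) := by
    intro i
    ext w
    refine LinearMap.congr_fun (basis_ext b (f := ((basisg b s).flip (basisX b i) : E →ₗ[ℝ] ℝ))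
      (f' := s i • b.coord (some (Sum.inr i))) ?_ (fun j => ?_) (fun j => ?_)) w <;>
    simp <;> simp [basisξ, basisX, basisY, Finsupp.single_apply] <;> split_ifs <;> simp_all
  have hY : ∀ i, (basisg b s).flip (basisY b i)
      = LinearMap.toContinuousLinearMap (s i • b.coord (some (Sum.inl i))) := by
    intro i
    ext w
    refine LinearMap.congr_fun (basis_ext b (f := ((basisg b s).flip (basisY b i) : E →ₗ[ℝ] ℝ))
      (f' := s i • b.coord (some (Sum.inl i))) ?_ (fun j => ?_) (fun j => ?_)) w <;>
    simp <;> simp [basisξ, basisX, basisY, Finsupp.single_apply] <;> split_ifs <;> simp_all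
  apply b.repr.injective
  rw [map_zero]
  ext a
  rcases a with _ | i | i
  · have := congrArg (fun f : E →L[ℝ] ℝ => f v) hξ
    simpa [h] using this.symm
  · have := congrArg (fun f : E →L[ℝ] ℝ => f v) (hY i)
    simpa [h, hs] using this.symm
  · have := congrArg (fun f : E →L[ℝ] ℝ => f v) (hX i)
    simpa [h, hs] using this.symm

theorem basisφ_add_mem (v : E) :
    basisφ b (basisφ b v) + basisφ b v ∈ Submodule.span ℝ (Set.range (basisX b)) := by
  have hv := b.mem_span v
  induction hv using Submodule.span_induction with
  | mem x hx =>
    obtain ⟨_ | i | i, rfl⟩ := hx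
    · change basisφ b (basisφ b (basisξ b)) + basisφ b (basisξ b) ∈ _
      simp
    · change basisφ b (basisφ b (basisX b i)) + basisφ b (basisX b i) ∈ _
      simp only [basisφ_X]
      exact add_mem (Submodule.subset_span ⟨i, rfl⟩) (Submodule.subset_span ⟨i, rfl⟩)
    · change basisφ b (basisφ b (basisY b i)) + basisφ b (basisY b i) ∈ _
      simp
  | zero => simp
  | add x y _ _ hx hy =>
    have := add_mem hx hy
    simp only [map_add]
    convert this using 1
    abel
  | smul c x _ hx =>
    have := Submodule.smul_mem _ c hx
    simpa only [map_smul, smul_add] using this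

theorem basisφ_sub_mem (v : E) :
    basisφ b (basisφ b v) - basisφ b v ∈ Submodule.span ℝ (Set.range (basisY b)) := by
  have hv := b.mem_span v
  induction hv using Submodule.span_induction with
  | mem x hx =>
    obtain ⟨_ | i | i, rfl⟩ := hx
    · change basisφ b (basisφ b (basisξ b)) - basisφ b (basisξ b) ∈ _
      simp
    · change basisφ b (basisφ b (basisX b i)) - basisφ b (basisX b i) ∈ _
      simp
    · change basisφ b (basisφ b (basisY b i)) - basisφ b (basisY b i) ∈ _
      simp only [basisφ_Y, map_neg, neg_neg, sub_neg_eq_add]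
      exact add_mem (Submodule.subset_span ⟨i, rfl⟩) (Submodule.subset_span ⟨i, rfl⟩)
  | zero => simp
  | add x y _ _ hx hy =>
    have := add_mem hx hy
    simp only [map_add]
    convert this using 1
    abel
  | smul c x _ hx =>
    have := Submodule.smul_mem _ c hx
    simpa only [map_smul, smul_sub] using this

theorem mem_span_X {v : E} (h : basisφ b v = v) :
    v ∈ Submodule.span ℝ (Set.range (basisX b)) := by
  have h1 := Submodule.smul_mem _ (1 / 2 : ℝ) (basisφ_add_mem b v)
  rw [h, h] at h1
  convert h1 using 1
  module

theorem mem_span_Y {v : E} (h : basisφ b v = -v) :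
    v ∈ Submodule.span ℝ (Set.range (basisY b)) := by
  have h1 := Submodule.smul_mem _ (1 / 2 : ℝ) (basisφ_sub_mem b v)
  rw [h, map_neg, h] at h1
  convert h1 using 1
  module

theorem basish_of_neg (e : Fin n → ℝ) {v : E} (h : basisφ b v = -v) : basish b e v = 0 := by
  have hv := mem_span_Y b h
  clear h
  induction hv using Submodule.span_induction with
  | mem x hx => obtain ⟨i, rfl⟩ := hx; simp
  | zero => simp
  | add x y _ _ hx hy => simp [hx, hy]
  | smul c x _ hx => simp [hx]

theorem basisφ_basish (e : Fin n → ℝ) (v : E) : basisφ b (basish b e v) = - basish b e v := by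
  have : (basisφ b : E →ₗ[ℝ] E) ∘ₗ (basish b e : E →ₗ[ℝ] E) = - (basish b e : E →ₗ[ℝ] E) :=
    basis_ext b (by simp) (by simp) (by simp)
  exact LinearMap.congr_fun this v

/-- The vectors `X_i + (e_i / 2) Y_i` span the `(-1)`-eigenspace of `-φ - h`. -/
theorem mem_span_tilde (e : Fin n → ℝ) {v : E} (h : basisφ b v = v - basish b e v) :
    v ∈ Submodule.span ℝ (Set.range fun i => basisX b i + (e i / 2) • basisY b i) := by
  obtain ⟨w, hw⟩ : ∃ w, w = v - (1 / 2 : ℝ) • basish b e v := ⟨_, rfl⟩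
  have hhw : basish b e w = basish b e v := by
    rw [hw, map_sub, map_smul, basish_of_neg b e (basisφ_basish b e v), smul_zero, sub_zero]
  have hv : v = w + (1 / 2 : ℝ) • basish b e w := by rw [hhw, hw]; module
  have hw2 : w ∈ Submodule.span ℝ (Set.range (basisX b)) := by
    apply mem_span_X
    rw [hw, map_sub, map_smul, basisφ_basish, h]
    module
  rw [hv]
  clear hv hhw hw
  induction hw2 using Submodule.span_induction with
  | mem x hx =>
    obtain ⟨i, rfl⟩ := hx
    refine Submodule.subset_span ⟨i, ?_⟩
    rw [basish_X]
    module
  | zero => simp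
  | add x y _ _ hx hy =>
    have := add_mem hx hy
    simp only [map_add]
    convert this using 1
    module
  | smul c x _ hx =>
    have := Submodule.smul_mem _ c hx
    simp only [map_smul]
    convert this using 1
    module

theorem bilin_eq_zero_of_span {ι F : Type*} [AddCommGroup F] [Module ℝ F] (D : E →ₗ[ℝ] E →ₗ[ℝ] F)
    (u : ι → E) (h : ∀ i j, D (u i) (u j) = 0) {v w : E}
    (hv : v ∈ Submodule.span ℝ (Set.range u)) (hw : w ∈ Submodule.span ℝ (Set.range u)) :
    D v w = 0 := by
  induction hv using Submodule.span_induction with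
  | mem x hx =>
    obtain ⟨i, rfl⟩ := hx
    induction hw using Submodule.span_induction with
    | mem y hy => obtain ⟨j, rfl⟩ := hy; exact h i j
    | zero => simp
    | add x y _ _ hx hy => simp [hx, hy]
    | smul c x _ hx => simp [hx]
  | zero => simp
  | add x y _ _ hx hy => simp [hx, hy]
  | smul c x _ hx => simp [hx]

theorem finrank_eigenspace_one :
    Module.finrank ℝ (Module.End.eigenspace (basisφ b : E →ₗ[ℝ] E) 1) = n := by
  have h : Module.End.eigenspace (basisφ b : E →ₗ[ℝ] E) 1
      = Submodule.span ℝ (Set.range (basisX b)) := by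
    apply le_antisymm
    · intro v hv
      rw [Module.End.mem_eigenspace_iff, one_smul] at hv
      exact mem_span_X b hv
    · rw [Submodule.span_le]
      rintro _ ⟨i, rfl⟩
      simp
  have hli : LinearIndependent ℝ (basisX b) :=
    b.linearIndependent.comp (fun i => some (Sum.inl i)) fun i j hij => by simpa using hij
  rw [h, finrank_span_eq_card hli, Fintype.card_fin]

theorem finrank_eigenspace_neg_one :
    Module.finrank ℝ (Module.End.eigenspace (basisφ b : E →ₗ[ℝ] E) (-1)) = n := by
  have h : Module.End.eigenspace (basisφ b : E →ₗ[ℝ] E) (-1)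
      = Submodule.span ℝ (Set.range (basisY b)) := by
    apply le_antisymm
    · intro v hv
      rw [Module.End.mem_eigenspace_iff, neg_one_smul] at hv
      exact mem_span_Y b hv
    · rw [Submodule.span_le]
      rintro _ ⟨i, rfl⟩
      simp
  have hli : LinearIndependent ℝ (basisY b) :=
    b.linearIndependent.comp (fun i => some (Sum.inr i)) fun i j hij => by simpa using hij
  rw [h, finrank_span_eq_card hli, Fintype.card_fin]

/-- When the first `m` coefficients are `1` and the others `0`, the rank of `h` is `m`. -/
theorem range_basish (e : Fin n → ℝ) (m : ℕ) (hm : m ≤ n)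
    (he : ∀ i : Fin n, e i = if (i : ℕ) < m then 1 else 0) :
    Module.finrank ℝ (basish b e).range = m := by
  have h : (basish b e).range
      = Submodule.span ℝ (Set.range fun i : Fin m => basisY b (Fin.castLE hm i)) := by
    apply le_antisymm
    · rintro _ ⟨v, rfl⟩
      have hv := b.mem_span v
      induction hv using Submodule.span_induction with
      | mem x hx =>
        obtain ⟨_ | i | i, rfl⟩ := hx
        · change basish b e (basisξ b) ∈ _
          simp
        · change basish b e (basisX b i) ∈ _
          rw [basish_X, he]
          split_ifs with hi
          · rw [one_smul]
            exact Submodule.subset_span ⟨⟨i, hi⟩, rfl⟩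
          · simp
        · change basish b e (basisY b i) ∈ _
          simp
      | zero => simp
      | add x y _ _ hx hy => simpa only [map_add] using add_mem hx hy
      | smul c x _ hx => simpa only [map_smul] using Submodule.smul_mem _ c hx
    · rw [Submodule.span_le]
      rintro _ ⟨i, rfl⟩
      refine ⟨basisX b (Fin.castLE hm i), ?_⟩
      simp [he]
  have hli : LinearIndependent ℝ fun i : Fin m => basisY b (Fin.castLE hm i) :=
    b.linearIndependent.comp (fun i => some (Sum.inr (Fin.castLE hm i))) fun i j hij => by
      simpa using hij
  rw [h, finrank_span_eq_card hli, Fintype.card_fin]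

namespace IsNullBasis

variable {b} {br : E →ₗ[ℝ] E →ₗ[ℝ] E} {s e : Fin n → ℝ} (N : IsNullBasis b br s e)
include N

theorem br_self (v : E) : br v v = 0 := eq_zero_of_eq_neg (N.skew v v)

theorem η_br (v w : E) : basisη b (br v w) = -2 * basisg b s v (basisφ b w) := by
  have hneg : ∀ v w, basisη b (br v w) = 0 → basisη b (br w v) = 0 := by
    intro v w h
    rw [N.skew, map_neg, h, neg_zero]
  have hξY : ∀ i, basisη b (br (basisξ b) (basisY b i)) = 0 := by
    intro i
    have h1 := congrArg (basisη b) (basisφ_basisφ b (br (basisξ b) (basisY b i)))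
    rw [N.φ_ξ_Y, map_neg, N.φ_ξ_Y, neg_neg] at h1
    simpa using h1
  have hYY : ∀ i j, i < j → basisη b (br (basisY b i) (basisY b j)) = 0 := by
    intro i j hij
    have h1 := congrArg (basisη b) (basisφ_basisφ b (br (basisY b i) (basisY b j)))
    rw [N.φ_Y_Y i j hij, map_neg, N.φ_Y_Y i j hij, neg_neg] at h1
    simpa using h1
  let gl : E →ₗ[ℝ] E →ₗ[ℝ] ℝ := ContinuousLinearMap.coeLM ℝ ∘ₗ (basisg b s : E →ₗ[ℝ] E →L[ℝ] ℝ)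
  have : br.compr₂ (basisη b : E →ₗ[ℝ] ℝ)
      = (-2 : ℝ) • gl.compl₂ (basisφ b : E →ₗ[ℝ] E) := by
    refine basis_ext b ?_ (fun i => ?_) (fun i => ?_) <;>
    refine basis_ext b ?_ (fun j => ?_) (fun j => ?_)
    · simp [gl, N.br_self]
    · simp [gl, N.η_ξ_X]
    · simp [gl, hξY]
    · simp [gl, hneg _ _ (N.η_ξ_X i)]
    · rcases lt_trichotomy i j with h | rfl | h
      · simp [gl, N.η_X_X i j h]
      · simp [gl, N.br_self]
      · simp [gl, hneg _ _ (N.η_X_X j i h)]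
    · simp [gl, N.η_X_Y]
    · simp [gl, hneg _ _ (hξY i)]
    · have h1 := N.η_X_Y j i
      rw [N.skew, map_neg] at h1
      by_cases hij : i = j
      · subst hij
        simp [gl] at h1 ⊢
        linarith
      · simpa [gl, hij, Ne.symm hij] using h1
    · rcases lt_trichotomy i j with h | rfl | h
      · simp [gl, hYY i j h]
      · simp [gl, N.br_self]
      · simp [gl, hneg _ _ (hYY j i h)]
  exact LinearMap.congr_fun₂ this v w

/-- The linear data of the invariant structure attached to an adapted basis. -/
def model : LinearModel n br where
  φ := basisφ b
  ξ := basisξ b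
  η := basisη b
  g := basisg b s
  η_ξ := basisη_ξ b
  φ_φ := basisφ_basisφ b
  finrank_pos := finrank_eigenspace_one b
  finrank_neg := finrank_eigenspace_neg_one b
  symm_g := basisg_symm b s
  nondegenerate_g := basisg_nondegenerate b s N.sign_ne_zero
  g_φ_φ := basisg_φ_φ b s
  η_br := N.η_br

/-- By linearity the conditions on a null model need only be tested on the basis, where they are
the fields of `IsNullBasis`. -/
theorem isNullModel : N.model.IsNullModel (basish b e) where
  skew := N.skew
  jacobi := N.jacobi
  two_h v := by
    have : (2 : ℝ) • (basish b e : E →ₗ[ℝ] E) = br (basisξ b) ∘ₗ (basisφ b : E →ₗ[ℝ] E)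
        - (basisφ b : E →ₗ[ℝ] E) ∘ₗ br (basisξ b) := by
      refine basis_ext b ?_ (fun i => ?_) (fun i => ?_)
      · simp [N.br_self]
      · simp [N.φ_ξ_X, smul_smul]
      · simp [N.φ_ξ_Y]
    exact LinearMap.congr_fun this v
  h_φ v := by
    have : (basish b e : E →ₗ[ℝ] E) ∘ₗ (basisφ b : E →ₗ[ℝ] E) = (basish b e : E →ₗ[ℝ] E) :=
      basis_ext b (by simp) (by simp) (by simp)
    exact LinearMap.congr_fun this v
  br_ξ v := by
    have : br (basisξ b) ∘ₗ (-(basisφ b : E →ₗ[ℝ] E) - (basish b e : E →ₗ[ℝ] E))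
        = (-(basisφ b : E →ₗ[ℝ] E) - (basish b e : E →ₗ[ℝ] E)) ∘ₗ br (basisξ b) := by
      refine basis_ext b ?_ (fun i => ?_) (fun i => ?_)
      · simp [N.br_self]
      · have h1 := N.ad_ξ_X i
        rw [map_add, map_smul] at h1
        simp only [LinearMap.comp_apply, LinearMap.sub_apply, LinearMap.neg_apply,
          ContinuousLinearMap.coe_coe, basisφ_X, basish_X, map_sub, map_neg, map_smul]
        linear_combination (norm := module) -h1
      · have h1 := basish_of_neg b e (N.φ_ξ_Y i)
        simp [N.φ_ξ_Y, h1]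
    exact LinearMap.congr_fun this v
  br_pos v w hv _ hw _ := by
    have h1 := bilin_eq_zero_of_span
      (br.compr₂ ((basisφ b : E →ₗ[ℝ] E) + LinearMap.id)) (basisY b) (fun i j => by
        rcases lt_trichotomy i j with h | rfl | h
        · simp [N.φ_Y_Y i j h]
        · simp [N.br_self]
        · simp [N.skew (basisY b i), N.φ_Y_Y j i h]) (mem_span_Y b hv) (mem_span_Y b hw)
    have h2 : basisφ b (br v w) = - br v w := by
      rw [← add_eq_zero_iff_eq_neg]
      exact h1
    exact ⟨h2, basish_of_neg b e h2⟩
  br_neg v w hv hw := by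
    have h1 := bilin_eq_zero_of_span
      (br.compr₂ ((basisφ b : E →ₗ[ℝ] E) - LinearMap.id + (basish b e : E →ₗ[ℝ] E)))
      (fun i => basisX b i + (e i / 2) • basisY b i) (fun i j => by
        have key : ∀ i j, i < j → basisφ b (br (basisX b i + (e i / 2) • basisY b i)
            (basisX b j + (e j / 2) • basisY b j)) - br (basisX b i + (e i / 2) • basisY b i)
            (basisX b j + (e j / 2) • basisY b j) + basish b e
            (br (basisX b i + (e i / 2) • basisY b i) (basisX b j + (e j / 2) • basisY b j)) = 0 :=
          fun i j h => by rw [N.φ_tilde i j h _ rfl]; abel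
        rcases lt_trichotomy i j with h | rfl | h
        · exact key i j h
        · simp only [LinearMap.compr₂_apply, N.br_self, map_zero]
        · have h2 := key j i h
          rw [N.skew] at h2
          change _ - _ + _ = (0 : E)
          simp only [map_neg] at h2
          linear_combination (norm := module) -h2)
      (mem_span_tilde b e hv) (mem_span_tilde b e hw)
    have h2 : basisφ b (br v w) - br v w + basish b e (br v w) = 0 := h1
    change basisφ b (br v w) = br v w - basish b e (br v w)
    linear_combination (norm := module) h2
  g_h u v w hu hu0 hv hw := by
    have hu' := mem_span_Y b hu
    clear hu hu0
    let gl : E →ₗ[ℝ] E →ₗ[ℝ] ℝ :=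
      ContinuousLinearMap.coeLM ℝ ∘ₗ (basisg b s : E →ₗ[ℝ] E →L[ℝ] ℝ)
    let D : E → E →ₗ[ℝ] E →ₗ[ℝ] ℝ := fun u =>
      (gl ∘ₗ br u).compl₂ (basish b e : E →ₗ[ℝ] E)
        + ((gl ∘ₗ br u).compl₂ (basish b e : E →ₗ[ℝ] E)).flip
    have hD : ∀ u v w, D u v w
        = basisg b s (br u v) (basish b e w) + basisg b s (br u w) (basish b e v) :=
      fun u v w => rfl
    change basisg b s (br u v) (basish b e w) + basisg b s (br u w) (basish b e v) = 0
    rw [← hD]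
    induction hu' using Submodule.span_induction with
    | mem x hx =>
      obtain ⟨j, rfl⟩ := hx
      refine bilin_eq_zero_of_span (D (basisY b j)) _ (fun i k => ?_)
        (mem_span_tilde b e hv) (mem_span_tilde b e hw)
      have hnull : ∀ i k, basisg b s (br (basisY b j) (basisY b i)) (basisY b k) = 0 := by
        intro i k
        have h1 : basisφ b (br (basisY b j) (basisY b i)) = - br (basisY b j) (basisY b i) := by
          rcases lt_trichotomy i j with h | rfl | h
          · rw [N.skew, map_neg, N.φ_Y_Y i j h]
          · simp [N.br_self]
          · exact N.φ_Y_Y j i h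
        exact LinearModel.g_pos_pos N.model h1 (basisφ_Y b k)
      have h1 := N.g_h i j k
      rw [N.skew, N.skew (basisX b k)] at h1
      rw [hD]
      simp only [map_add, map_smul, basish_X, basish_Y, smul_zero, add_zero, add_apply, smul_apply,
        hnull, smul_eq_mul, mul_zero]
      simp only [map_neg, neg_apply] at h1
      linarith
    | zero => simp [hD]
    | add x y _ _ hx hy =>
      rw [hD] at hx hy ⊢
      simp only [map_add, LinearMap.add_apply, add_apply]
      linarith
    | smul c x _ hx =>
      rw [hD] at hx ⊢
      simp only [map_smul, LinearMap.smul_apply, smul_apply, smul_eq_mul]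
      linear_combination c * hx

end IsNullBasis

end AdaptedBasis

/-! ### The brackets of the example -/

section ExampleBrackets

variable {E : Type*} [NormedAddCommGroup E] [NormedSpace ℝ E] [FiniteDimensional ℝ E] {n : ℕ}
  (b : Module.Basis (Option (Fin n ⊕ Fin n)) ℝ E)

/-- The signs `g(X_1, Y_1) = 1` and `g(X_i, Y_i) = -1` for `i ≥ 2`; indices start at `0`. -/
def exampleSign (i : Fin n) : ℝ := if (i : ℕ) = 0 then 1 else -1

/-- The coefficients in `h X_i = Y_i` for the first `m` indices and `h X_i = 0` for the others. -/
def rankCoeff (m : ℕ) (i : Fin n) : ℝ := if (i : ℕ) < m then 1 else 0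

theorem rankCoeff_of_le {m i : ℕ} (hi : i < n) (h : i + 1 ≤ m) :
    rankCoeff m (⟨i, hi⟩ : Fin n) = 1 := by
  rw [rankCoeff, if_pos (by simp only; omega)]

theorem rankCoeff_of_gt {m i : ℕ} (hi : i < n) (h : m < i + 1) :
    rankCoeff m (⟨i, hi⟩ : Fin n) = 0 := by
  rw [rankCoeff, if_neg (by simp only; omega)]

/-- The bilinear map `br` is a Lie bracket with the multiplication table of the example on the
basis `ξ, X_1, …, X_n, Y_1, …, Y_n`. -/
structure IsExampleTable (m : ℕ) (br : E →ₗ[ℝ] E →ₗ[ℝ] E) (ξ : E) (X Y : ℕ → E) : Prop where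
  two_le : 2 ≤ m
  le : m ≤ n
  skew : ∀ v w, br v w = - br w v
  jacobi : ∀ u v w, br u (br v w) = br (br u v) w + br v (br u w)
  eq_ξ : basisξ b = ξ
  eq_X : ∀ i : Fin n, basisX b i = X (i + 1)
  eq_Y : ∀ i : Fin n, basisY b i = Y (i + 1)
  br_ξ_X : ∀ i, 1 ≤ i → i ≤ n → br ξ (X i) = bracketξX m X Y i
  br_ξ_Y : ∀ i, 1 ≤ i → i ≤ n → br ξ (Y i) = bracketξY m Y i
  br_X_X : ∀ i j, 1 ≤ i → i ≤ n → 1 ≤ j → j ≤ n → i < j → br (X i) (X j) = bracketXX m X Y i j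
  br_Y_Y : ∀ i j, 1 ≤ i → i ≤ n → 1 ≤ j → j ≤ n → i < j → br (Y i) (Y j) = bracketYY m Y i j
  br_X_Y : ∀ i j, 1 ≤ i → i ≤ n → 1 ≤ j → j ≤ n → br (X i) (Y j) = bracketXY m ξ X Y i j

namespace IsExampleTable

variable {b} {m : ℕ} {br : E →ₗ[ℝ] E →ₗ[ℝ] E} {ξ : E} {X Y : ℕ → E}
  (T : IsExampleTable b m br ξ X Y)
include T

theorem X_eq (i : ℕ) (h1 : 1 ≤ i) (h2 : i ≤ n) : X i = basisX b ⟨i - 1, by omega⟩ := by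
  rw [T.eq_X]
  exact congrArg X (by simp only; omega)

theorem Y_eq (i : ℕ) (h1 : 1 ≤ i) (h2 : i ≤ n) : Y i = basisY b ⟨i - 1, by omega⟩ := by
  rw [T.eq_Y]
  exact congrArg Y (by simp only; omega)

theorem φ_ξ : basisφ b ξ = 0 := by rw [← T.eq_ξ, basisφ_ξ]

theorem φ_X (i : ℕ) (h1 : 1 ≤ i) (h2 : i ≤ n) : basisφ b (X i) = X i := by
  rw [T.X_eq i h1 h2, basisφ_X]

theorem φ_Y (i : ℕ) (h1 : 1 ≤ i) (h2 : i ≤ n) : basisφ b (Y i) = -Y i := by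
  rw [T.Y_eq i h1 h2, basisφ_Y]

theorem η_ξ : basisη b ξ = 1 := by rw [← T.eq_ξ, basisη_ξ]

theorem η_X (i : ℕ) (h1 : 1 ≤ i) (h2 : i ≤ n) : basisη b (X i) = 0 := by
  rw [T.X_eq i h1 h2, basisη_X]

theorem η_Y (i : ℕ) (h1 : 1 ≤ i) (h2 : i ≤ n) : basisη b (Y i) = 0 := by
  rw [T.Y_eq i h1 h2, basisη_Y]

theorem h_ξ : basish b (rankCoeff m) ξ = 0 := by rw [← T.eq_ξ, basish_ξ]

theorem h_X (i : ℕ) (h1 : 1 ≤ i) (h2 : i ≤ m) : basish b (rankCoeff m) (X i) = Y i := by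
  rw [T.X_eq i h1 (h2.trans T.le), basish_X, T.Y_eq i h1 (h2.trans T.le),
    rankCoeff_of_le _ (by omega), one_smul]

theorem h_X_of_gt (i : ℕ) (h1 : m < i) (h2 : i ≤ n) : basish b (rankCoeff m) (X i) = 0 := by
  rw [T.X_eq i (by omega) h2, basish_X, rankCoeff_of_gt _ (by omega), zero_smul]

theorem h_Y (i : ℕ) (h1 : 1 ≤ i) (h2 : i ≤ n) : basish b (rankCoeff m) (Y i) = 0 := by
  rw [T.Y_eq i h1 h2, basish_Y]

theorem g_ξ_ξ : basisg b exampleSign ξ ξ = 1 := by rw [← T.eq_ξ, basisg_ξ_ξ]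

theorem g_ξ_X (i : ℕ) (h1 : 1 ≤ i) (h2 : i ≤ n) : basisg b exampleSign ξ (X i) = 0 := by
  rw [← T.eq_ξ, T.X_eq i h1 h2, basisg_ξ_X]

theorem g_ξ_Y (i : ℕ) (h1 : 1 ≤ i) (h2 : i ≤ n) : basisg b exampleSign ξ (Y i) = 0 := by
  rw [← T.eq_ξ, T.Y_eq i h1 h2, basisg_ξ_Y]

theorem g_X_X (i j : ℕ) (h1 : 1 ≤ i) (h2 : i ≤ n) (h3 : 1 ≤ j) (h4 : j ≤ n) :
    basisg b exampleSign (X i) (X j) = 0 := by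
  rw [T.X_eq i h1 h2, T.X_eq j h3 h4, basisg_X_X]

theorem g_Y_Y (i j : ℕ) (h1 : 1 ≤ i) (h2 : i ≤ n) (h3 : 1 ≤ j) (h4 : j ≤ n) :
    basisg b exampleSign (Y i) (Y j) = 0 := by
  rw [T.Y_eq i h1 h2, T.Y_eq j h3 h4, basisg_Y_Y]

theorem g_X_Y (i j : ℕ) (h1 : 1 ≤ i) (h2 : i ≤ n) (h3 : 1 ≤ j) (h4 : j ≤ n) :
    basisg b exampleSign (X i) (Y j) = if i = j then (if i = 1 then 1 else -1) else 0 := by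
  rw [T.X_eq i h1 h2, T.Y_eq j h3 h4, basisg_X_Y]
  by_cases hij : i = j
  · subst hij
    simp only [if_true, exampleSign]
    exact if_congr (by omega) rfl rfl
  · rw [if_neg, if_neg hij]
    rw [Fin.mk.injEq]
    omega

theorem η_bracketXX (i j : ℕ) (h1 : 1 ≤ i) (hij : i < j) (h2 : j ≤ n) :
    basisη b (bracketXX m X Y i j) = 0 := by
  have hm := T.two_le
  have hmn := T.le
  unfold bracketXX bracketξX
  split_ifs <;>
  simp (disch := omega) only [map_add, map_smul, map_zero, T.η_X, T.η_Y, smul_zero, add_zero]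

theorem η_bracketXY (i j : ℕ) (h1 : 1 ≤ i) (h2 : i ≤ n) (h3 : 1 ≤ j) (h4 : j ≤ n) :
    basisη b (bracketXY m ξ X Y i j)
      = if i = j then 2 * (if i = 1 then 1 else -1) else 0 := by
  have hm := T.two_le
  have hmn := T.le
  unfold bracketXY bracketξY
  split_ifs <;> first
  | omega
  | simp (disch := omega) only [map_add, map_sub, map_neg, map_smul, map_zero, T.η_X, T.η_Y,
      T.η_ξ, add_zero, smul_eq_mul, neg_zero] <;> norm_num

/-- For `k ≤ m < i` the vector `[X_i, Y_j]` lies in the span of `ξ`, `X_i` and the `Y`'s, so it is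
orthogonal to `Y_k`. -/
theorem g_bracketXY_of_gt (i j k : ℕ) (h1 : m < i) (h2 : i ≤ n) (h3 : 1 ≤ j) (h4 : j ≤ n)
    (h5 : 1 ≤ k) (h6 : k ≤ m) :
    basisg b exampleSign (bracketXY m ξ X Y i j) (Y k) = 0 := by
  have hm := T.two_le
  have hmn := T.le
  have hik : i ≠ k := by omega
  unfold bracketXY bracketξY
  split_ifs <;> first
  | omega
  | simp (disch := omega) only [map_add, map_sub, map_neg, map_smul, map_zero, T.g_ξ_Y, T.g_Y_Y,
      T.g_X_Y, add_zero, smul_eq_mul, neg_zero, hik, add_apply, sub_apply, smul_apply,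
      neg_apply, if_false, sub_zero, zero_apply, mul_zero]

/-- For `i, k ≤ m` the expression is skew in `i` and `k`: the first two summands are exchanged with
opposite signs, and so are the last two. -/
theorem g_bracketXY (i j k : ℕ) (h1 : 1 ≤ i) (h2 : i ≤ m) (h3 : 1 ≤ j) (h4 : j ≤ n)
    (h5 : 1 ≤ k) (h6 : k ≤ m) :
    basisg b exampleSign (bracketXY m ξ X Y i j) (Y k)
      = √2 * ((if i ≤ 2 ∧ j = k ∧ 2 ≤ j then -1 else 0) + (if k ≤ 2 ∧ i = j ∧ 2 ≤ i then 1 else 0)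
        + (if j = 1 ∧ i = 1 ∧ k = 2 then -1 else 0) + (if j = 1 ∧ k = 1 ∧ i = 2 then 1 else 0)) := by
  have hm := T.two_le
  have hmn := T.le
  unfold bracketXY bracketξY
  split_ifs <;> first
  | omega
  | simp (disch := omega) only [map_add, map_sub, map_smul, map_zero, T.g_ξ_Y, T.g_Y_Y,
      T.g_X_Y, add_zero, smul_eq_mul, add_apply, sub_apply, smul_apply,
      sub_zero, zero_apply] <;> (try split_ifs) <;> first | omega | simp

/-- The vectors `X_i + Y_i / 2` (`i ≤ m`) and `X_i` (`i > m`) span a subalgebra, which is the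
`(-1)`-eigenspace of `-φ - h`. -/
theorem φ_br_tilde (i j : ℕ) (h1 : 1 ≤ i) (hij : i < j) (h2 : j ≤ n) (z : E) {ei ej : ℝ}
    (hi : i ≤ m → ei = 1) (hi' : m < i → ei = 0) (hj : j ≤ m → ej = 1) (hj' : m < j → ej = 0)
    (hz : z = br (X i + (ei / 2) • Y i) (X j + (ej / 2) • Y j)) :
    basisφ b z = z - basish b (rankCoeff m) z := by
  have hm := T.two_le
  have hmn := T.le
  have hz' : z = bracketXX m X Y i j + (ej / 2) • bracketXY m ξ X Y i j
      - (ei / 2) • bracketXY m ξ X Y j i + (ei / 2 * (ej / 2)) • bracketYY m Y i j := by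
    rw [hz, ← T.br_X_X _ _ (by omega) (by omega) (by omega) (by omega) (by omega),
      ← T.br_X_Y _ _ (by omega) (by omega) (by omega) (by omega),
      ← T.br_X_Y _ _ (by omega) (by omega) (by omega) (by omega),
      ← T.br_Y_Y _ _ (by omega) (by omega) (by omega) (by omega) (by omega)]
    simp only [map_add, map_smul, LinearMap.add_apply, LinearMap.smul_apply]
    rw [T.skew (Y i) (X j)]
    module
  clear hz
  rcases le_or_gt j m with hjm | hjm
  · rw [hi (by omega), hj hjm] at hz'
    obtain ⟨rfl, rfl⟩ | ⟨rfl, h3⟩ | ⟨rfl, h3⟩ | h3 : (i = 1 ∧ j = 2) ∨ (i = 1 ∧ 3 ≤ j) ∨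
      (i = 2 ∧ 3 ≤ j) ∨ 3 ≤ i := by omega
    · rw [show bracketXX m X Y 1 2 = √2 • X 1 by simp [bracketXX],
        show bracketXY m ξ X Y 1 2 = √2 • (Y 1 + X 2) by simp [bracketXY],
        show bracketXY m ξ X Y 2 1 = √2 • X 1 by simp [bracketXY],
        show bracketYY m Y 1 2 = √2 • (-Y 1 + Y 2) by simp [bracketYY]] at hz'
      rw [hz']
      simp (disch := omega) only [map_add, map_sub, map_neg, map_smul, T.φ_X, T.φ_Y, T.h_X, T.h_Y]
      module
    · rw [show bracketXX m X Y 1 j = 0 by unfold bracketXX; split_ifs <;> first | omega | rfl,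
        show bracketXY m ξ X Y 1 j = √2 • X j by
          unfold bracketXY; split_ifs <;> first | omega | rfl,
        show bracketXY m ξ X Y j 1 = 0 by unfold bracketXY; split_ifs <;> first | omega | rfl,
        show bracketYY m Y 1 j = √2 • Y j by
          unfold bracketYY; split_ifs <;> first | omega | rfl] at hz'
      rw [hz']
      simp (disch := omega) only [map_add, map_sub, map_zero, map_smul, T.φ_X, T.φ_Y, T.h_X, T.h_Y]
      module
    · rw [show bracketXX m X Y 2 j = -√2 • X j by
          unfold bracketXX; split_ifs <;> first | omega | rfl,
        show bracketXY m ξ X Y 2 j = √2 • X j by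
          unfold bracketXY; split_ifs <;> first | omega | rfl,
        show bracketXY m ξ X Y j 2 = √2 • Y j by
          unfold bracketXY; split_ifs <;> first | omega | rfl,
        show bracketYY m Y 2 j = √2 • Y j by
          unfold bracketYY; split_ifs <;> first | omega | rfl] at hz'
      rw [hz']
      simp (disch := omega) only [map_add, map_sub, map_smul, T.φ_X, T.φ_Y, T.h_X, T.h_Y]
      module
    · rw [show bracketXX m X Y i j = 0 by unfold bracketXX; split_ifs <;> first | omega | rfl,
        show bracketXY m ξ X Y i j = 0 by unfold bracketXY; split_ifs <;> first | omega | rfl,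
        show bracketXY m ξ X Y j i = 0 by unfold bracketXY; split_ifs <;> first | omega | rfl,
        show bracketYY m Y i j = 0 by unfold bracketYY; split_ifs <;> first | omega | rfl] at hz'
      simp [hz']
  · rw [hj' hjm, show bracketYY m Y i j = 0 by
      unfold bracketYY; split_ifs <;> first | omega | rfl] at hz'
    rcases le_or_gt i m with him | him
    · rw [hi him, show bracketXX m X Y i j = √2 • bracketξX m X Y i by
          unfold bracketXX; split_ifs <;> first | omega | rfl,
        show bracketXY m ξ X Y j i = -√2 • bracketξY m Y i by
          unfold bracketXY; split_ifs <;> first | omega | rfl] at hz'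
      rw [hz', bracketξX, bracketξY]
      split_ifs with h3 h4 <;> first
      | subst h3
        simp (disch := omega) only [map_add, map_sub, map_neg, map_smul, map_zero, T.φ_X, T.φ_Y,
          T.h_X, T.h_Y, zero_div, zero_smul, smul_zero, mul_zero]
        module
      | subst h4
        simp (disch := omega) only [map_add, map_sub, map_smul, map_zero, T.φ_X, T.φ_Y,
          T.h_X, T.h_Y, zero_div, zero_smul, smul_zero, mul_zero]
        module
      | simp (disch := omega) only [map_add, map_sub, map_neg, map_smul, map_zero, T.φ_X, T.φ_Y,
          T.h_X, T.h_Y, zero_div, zero_smul, smul_zero, mul_zero]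
        module
    · rw [hi' him, show bracketXX m X Y i j = 0 by
        unfold bracketXX; split_ifs <;> first | omega | rfl] at hz'
      simp [hz']

/-- The brackets of the example satisfy the conditions for an invariant `(-1, 0)`-structure. -/
theorem isNullBasis : IsNullBasis b br exampleSign (rankCoeff m) := by
  have hm := T.two_le
  have hmn := T.le
  refine ⟨T.skew, T.jacobi, fun i => by rw [exampleSign]; split_ifs <;> norm_num, ?_, ?_, ?_, ?_,
    ?_, ?_, ?_, ?_, ?_⟩ <;> simp only [T.eq_ξ, T.eq_X, T.eq_Y]
  · intro ⟨i, hi⟩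
    simp only
    rw [T.br_ξ_X _ (by omega) (by omega), bracketξX]
    split_ifs <;>
    simp (disch := omega) only [map_add, map_zero, T.η_X, T.η_Y, add_zero]
  · intro ⟨i, hi⟩ ⟨j, hj⟩ hij
    rw [Fin.mk_lt_mk] at hij
    rw [T.br_X_X _ _ (by omega) (by simp only; omega) (by omega) (by simp only; omega)
      (by simp only; omega), T.η_bracketXX _ _ (by omega) (by simp only; omega)
      (by simp only; omega)]
  · intro ⟨i, hi⟩ ⟨j, hj⟩
    rw [T.br_X_Y _ _ (by omega) (by simp only; omega) (by omega) (by simp only; omega),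
      T.η_bracketXY _ _ (by omega) (by simp only; omega) (by omega) (by simp only; omega),
      exampleSign]
    simp
  · intro ⟨i, hi⟩
    simp only
    rw [T.br_ξ_Y _ (by omega) (by omega), bracketξY]
    split_ifs <;> simp (disch := omega) only [map_add, map_sub, map_neg, map_zero,
      T.φ_Y, neg_zero] <;> abel
  · intro ⟨i, hi⟩
    rw [T.br_ξ_X _ (by omega) (by simp only; omega), bracketξX]
    simp only
    by_cases him : i + 1 ≤ m
    · rw [rankCoeff_of_le _ him]
      split_ifs with h1 h2 <;> first
      | simp (disch := omega) only [map_add, T.φ_X, T.φ_Y, h1]; module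
      | simp (disch := omega) only [map_add, T.φ_X, T.φ_Y, h2]; module
    · rw [rankCoeff_of_gt _ (by omega)]
      split_ifs <;> first | omega | simp
  · intro ⟨i, hi⟩
    simp only
    by_cases him : i + 1 ≤ m
    · rw [rankCoeff_of_le _ him, one_smul, map_add, T.br_ξ_X _ (by omega) (by omega),
        T.br_ξ_Y _ (by omega) (by omega), bracketξX, bracketξY]
      split_ifs <;>
      (simp (disch := omega) only [map_add, T.φ_X, T.φ_Y, T.h_X, T.h_Y]; module)
    · rw [rankCoeff_of_gt _ (by omega), zero_smul, add_zero, T.br_ξ_X _ (by omega) (by omega),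
        bracketξX]
      split_ifs <;> first | omega | simp
  · intro ⟨i, hi⟩ ⟨j, hj⟩ hij
    rw [Fin.mk_lt_mk] at hij
    simp only
    rw [T.br_Y_Y _ _ (by omega) (by omega) (by omega) (by omega) (by omega), bracketYY]
    split_ifs <;> simp (disch := omega) only [map_add, map_smul, map_neg, map_zero, T.φ_Y,
      neg_zero] <;> module
  · intro ⟨i, hi⟩ ⟨j, hj⟩ hij z hz
    rw [Fin.mk_lt_mk] at hij
    exact T.φ_br_tilde (i + 1) (j + 1) (by omega) (by omega) (by omega) z
      (rankCoeff_of_le hi) (rankCoeff_of_gt hi) (rankCoeff_of_le hj) (rankCoeff_of_gt hj) hz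
  · intro ⟨i, hi⟩ ⟨j, hj⟩ ⟨k, hk⟩
    simp only
    rw [T.br_X_Y _ _ (by omega) (by omega) (by omega) (by omega),
      T.br_X_Y _ _ (by omega) (by omega) (by omega) (by omega)]
    rcases le_or_gt (i + 1) m with h1 | h1 <;> rcases le_or_gt (k + 1) m with h2 | h2
    · rw [T.g_bracketXY _ _ _ (by omega) h1 (by omega) (by omega) (by omega) h2,
        T.g_bracketXY _ _ _ (by omega) h2 (by omega) (by omega) (by omega) h1,
        rankCoeff_of_le _ h1, rankCoeff_of_le _ h2]
      split_ifs <;> first | omega | ring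
    · rw [T.g_bracketXY_of_gt (k + 1) _ (i + 1) (by omega) (by omega) (by omega) (by omega)
        (by omega) h1, rankCoeff_of_gt _ h2]
      ring
    · rw [T.g_bracketXY_of_gt (i + 1) _ (k + 1) (by omega) (by omega) (by omega) (by omega)
        (by omega) h2, rankCoeff_of_gt _ h1]
      ring
    · rw [rankCoeff_of_gt _ h1, rankCoeff_of_gt _ h2]
      ring

end IsExampleTable

end ExampleBrackets

/-! ### Invariant structures of adapted bases -/

section InvariantStructure

variable {E : Type*} [NormedAddCommGroup E] [NormedSpace ℝ E] [FiniteDimensional ℝ E]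
  {H : Type*} [TopologicalSpace H] {I : ModelWithCorners ℝ E H}
  {M : Type*} [TopologicalSpace M] [ChartedSpace H M] [IsManifold I ∞ M]
  {P : Parallelization I M} {n : ℕ} {b : Module.Basis (Option (Fin n ⊕ Fin n)) ℝ E}
  {s e : Fin n → ℝ} (N : IsNullBasis b P.br s e)

/-- The invariant paracontact metric structure of an adapted basis. -/
def IsNullBasis.structure : ParacontactMetricStructure I M n := P.paracontact N.model

theorem IsNullBasis.structure_isKappaMuSpace : N.structure.IsKappaMuSpace (-1) 0 :=
  P.isKappaMuSpace _ N.isNullModel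

theorem IsNullBasis.structure_h_F (p : M) (v : E) :
    N.structure.h p (P.F p v) = P.F p (basish b e v) :=
  P.paracontact_h_F N.model N.isNullModel.two_h p v

theorem IsNullBasis.structure_h_comp_h (p : M) : N.structure.h p ∘L N.structure.h p = 0 := by
  ext v
  obtain ⟨w, rfl⟩ := (P.F p).surjective v
  change N.structure.h p (N.structure.h p (P.F p w)) = 0
  rw [N.structure_h_F, N.structure_h_F, N.isNullModel.h_h, map_zero]

theorem IsNullBasis.finrank_range_structure_h {m : ℕ} (hm : m ≤ n) (he : e = rankCoeff m)
    (p : M) : Module.finrank ℝ (N.structure.h p).range = m := by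
  have h1 : (N.structure.h p).range
      = (basish b e).range.map ((P.F p).toLinearEquiv : E →ₗ[ℝ] TangentSpace I p) := by
    ext v
    constructor
    · rintro ⟨w, rfl⟩
      obtain ⟨u, rfl⟩ := (P.F p).surjective w
      exact ⟨basish b e u, ⟨u, rfl⟩, (N.structure_h_F p u).symm⟩
    · rintro ⟨_, ⟨u, rfl⟩, rfl⟩
      exact ⟨P.F p u, N.structure_h_F p u⟩
  rw [h1, LinearEquiv.finrank_map_eq]
  exact range_basish b e m hm fun i => by rw [he]; rfl

end InvariantStructure

section ExampleStructure

variable {n m : ℕ} {E : Type*} [NormedAddCommGroup E] [NormedSpace ℝ E] [FiniteDimensional ℝ E]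
  {H : Type*} [TopologicalSpace H] {I : ModelWithCorners ℝ E H}
  {G : Type*} [TopologicalSpace G] [ChartedSpace H G] [Group G] [LieGroup I ∞ G]
  {ξ : GroupLieAlgebra I G} {X Y : ℕ → GroupLieAlgebra I G}

/-- The basis `ξ, X_1, …, X_n, Y_1, …, Y_n` of the example. -/
def IsExampleBasis.basis (B : IsExampleBasis n m ξ X Y) :
    Module.Basis (Option (Fin n ⊕ Fin n)) ℝ E :=
  Module.Basis.mk (M := E) (v := frame n ξ X Y) B.linearIndependent B.span_eq_top.ge

theorem IsExampleBasis.basis_apply (B : IsExampleBasis n m ξ X Y) (a : Option (Fin n ⊕ Fin n)) :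
    B.basis a = frame n ξ X Y a :=
  Module.Basis.mk_apply _ _ _

theorem IsExampleBasis.isExampleTable (B : IsExampleBasis n m ξ X Y) (h2 : 2 ≤ m) (hm : m ≤ n) :
    IsExampleTable B.basis m (leftParallelization I G).br ξ X Y where
  two_le := h2
  le := hm
  skew := (leftParallelization I G).br_skew 1
  jacobi := (leftParallelization I G).br_jacobi 1
  eq_ξ := B.basis_apply none
  eq_X i := B.basis_apply (some (Sum.inl i))
  eq_Y i := B.basis_apply (some (Sum.inr i))
  br_ξ_X i h1 h2 := B.lie_ξ_X i (Finset.mem_Icc.mpr ⟨h1, h2⟩)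
  br_ξ_Y i h1 h2 := B.lie_ξ_Y i (Finset.mem_Icc.mpr ⟨h1, h2⟩)
  br_X_X i j h1 h2 h3 h4 h :=
    B.lie_X_X i (Finset.mem_Icc.mpr ⟨h1, h2⟩) j (Finset.mem_Icc.mpr ⟨h3, h4⟩) h
  br_Y_Y i j h1 h2 h3 h4 h :=
    B.lie_Y_Y i (Finset.mem_Icc.mpr ⟨h1, h2⟩) j (Finset.mem_Icc.mpr ⟨h3, h4⟩) h
  br_X_Y i j h1 h2 h3 h4 :=
    B.lie_X_Y i (Finset.mem_Icc.mpr ⟨h1, h2⟩) j (Finset.mem_Icc.mpr ⟨h3, h4⟩)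

theorem IsExampleBasis.exists_structure (B : IsExampleBasis n m ξ X Y) (h2 : 2 ≤ m) (hm : m ≤ n) :
    ∃ S : ParacontactMetricStructure I G n,
      S.IsLeftInvariant ∧ HasExampleValues S ξ X Y ∧
      S.h 1 ξ = 0 ∧
      (∀ i ∈ Finset.Icc 1 m, S.h 1 (X i) = Y i) ∧
      (∀ i ∈ Finset.Icc (m + 1) n, S.h 1 (X i) = 0) ∧
      (∀ i ∈ Finset.Icc 1 n, S.h 1 (Y i) = 0) ∧
      (∀ p, S.h p ∘L S.h p = 0) ∧
      (∀ p, Module.finrank ℝ (S.h p).range = m) ∧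
      (∀ p, S.h p ≠ 0) ∧
      S.IsKappaMuSpace (-1) 0 := by
  have T := B.isExampleTable h2 hm
  have N := T.isNullBasis
  have F1 : ∀ v : E, (leftParallelization I G).F 1 v = v := leftParallelization_one I G
  have F1' : ∀ v : E, ((leftParallelization I G).F 1).symm v = v := fun v =>
    (ContinuousLinearEquiv.symm_apply_eq _).mpr (F1 v).symm
  have hφ : ∀ v : E, N.structure.φ 1 v = basisφ B.basis v := fun v => by
    change (leftParallelization I G).F 1 (basisφ B.basis
      (((leftParallelization I G).F 1).symm v)) = _
    rw [F1, F1']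
  have hη : ∀ v : E, N.structure.η 1 v = basisη B.basis v := fun v => by
    change basisη B.basis (((leftParallelization I G).F 1).symm v) = _
    rw [F1']
  have hg : ∀ v w : E, N.structure.g 1 v w = basisg B.basis exampleSign v w := fun v w => by
    change basisg B.basis exampleSign (((leftParallelization I G).F 1).symm v)
      (((leftParallelization I G).F 1).symm w) = _
    rw [F1', F1']
  have hh : ∀ v : E, N.structure.h 1 v = basish B.basis (rankCoeff m) v := fun v => by
    have h1 := N.structure_h_F 1 v
    rwa [F1, F1] at h1
  have hrank := N.finrank_range_structure_h hm rfl
  refine ⟨N.structure, isLeftInvariant I G N.model, ?_, ?_, ?_, ?_, ?_, N.structure_h_comp_h,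
    hrank, ?_, N.structure_isKappaMuSpace⟩
  · have hI : ∀ {i : ℕ}, i ∈ Finset.Icc 1 n → 1 ≤ i ∧ i ≤ n := Finset.mem_Icc.mp
    exact
      { ξ_one := (F1 _).trans T.eq_ξ
        φ_ξ := (hφ ξ).trans T.φ_ξ
        φ_X := fun i hi => (hφ (X i)).trans (T.φ_X i (hI hi).1 (hI hi).2)
        φ_Y := fun i hi => (hφ (Y i)).trans (T.φ_Y i (hI hi).1 (hI hi).2)
        η_ξ := (hη ξ).trans T.η_ξ
        η_X := fun i hi => (hη (X i)).trans (T.η_X i (hI hi).1 (hI hi).2)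
        η_Y := fun i hi => (hη (Y i)).trans (T.η_Y i (hI hi).1 (hI hi).2)
        g_ξ_ξ := (hg ξ ξ).trans T.g_ξ_ξ
        g_ξ_X := fun i hi => (hg ξ (X i)).trans (T.g_ξ_X i (hI hi).1 (hI hi).2)
        g_ξ_Y := fun i hi => (hg ξ (Y i)).trans (T.g_ξ_Y i (hI hi).1 (hI hi).2)
        g_X_X := fun i hi j hj => (hg (X i) (X j)).trans
          (T.g_X_X i j (hI hi).1 (hI hi).2 (hI hj).1 (hI hj).2)
        g_Y_Y := fun i hi j hj => (hg (Y i) (Y j)).trans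
          (T.g_Y_Y i j (hI hi).1 (hI hi).2 (hI hj).1 (hI hj).2)
        g_X_Y := fun i hi j hj => (hg (X i) (Y j)).trans
          (T.g_X_Y i j (hI hi).1 (hI hi).2 (hI hj).1 (hI hj).2) }
  · exact (hh ξ).trans T.h_ξ
  · intro i hi
    rw [Finset.mem_Icc] at hi
    exact (hh (X i)).trans (T.h_X i hi.1 hi.2)
  · intro i hi
    rw [Finset.mem_Icc] at hi
    exact (hh (X i)).trans (T.h_X_of_gt i hi.1 hi.2)
  · intro i hi
    rw [Finset.mem_Icc] at hi
    exact (hh (Y i)).trans (T.h_Y i hi.1 hi.2)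
  · intro p hp
    have h1 := hrank p
    rw [hp] at h1
    rw [show ((0 : TangentSpace I p →L[ℝ] TangentSpace I p)).range = ⊥ from LinearMap.range_zero,
      finrank_bot] at h1
    omega

end ExampleStructure

/-! ### Lie groups of affine transformations acting simply transitively on an open set -/

section Etale

/-- A smooth family `L` of endomorphisms of `E` such that the affine maps `y ↦ x + L x y` compose
according to the law `x * y = x + L x y`. The group acts simply transitively on the open set of the
`x` with `L x` invertible. -/
structure EtaleLaw (E : Type*) [NormedAddCommGroup E] [NormedSpace ℝ E] where
  L : E → E →L[ℝ] E
  contDiff_L : ContDiff ℝ ∞ L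
  L_zero : L 0 = 1
  L_mul : ∀ x y, L (x + L x y) = L x * L y

variable {E : Type*} [NormedAddCommGroup E] [NormedSpace ℝ E]

/-- The points where `L x` is invertible; they form a Lie group for `x * y = x + L x y`. -/
def EtaleLaw.Pts (A : EtaleLaw E) : Type _ := {x : E // IsUnit (A.L x)}

namespace EtaleLaw

variable {A : EtaleLaw E}

/-- The inclusion of the group into the vector space, an open embedding. -/
def val (x : A.Pts) : E := x.1

theorem isUnit_L (x : A.Pts) : IsUnit (A.L (val x)) := x.2

theorem val_injective : Function.Injective (val : A.Pts → E) := Subtype.val_injective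

instance : Mul A.Pts where
  mul x y := ⟨val x + A.L (val x) (val y), by rw [A.L_mul]; exact (isUnit_L x).mul (isUnit_L y)⟩

instance : One A.Pts where
  one := ⟨0, by rw [A.L_zero]; exact isUnit_one⟩

theorem val_mul (x y : A.Pts) : val (x * y) = val x + A.L (val x) (val y) := rfl

theorem val_one : val (1 : A.Pts) = 0 := rfl

theorem L_val_mul (x y : A.Pts) : A.L (val (x * y)) = A.L (val x) * A.L (val y) := A.L_mul _ _

theorem L_inverse_apply (x : A.Pts) (v : E) :
    A.L (val x) (Ring.inverse (A.L (val x)) v) = v := by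
  change (A.L (val x) * Ring.inverse (A.L (val x))) v = v
  rw [Ring.mul_inverse_cancel _ (isUnit_L x)]
  rfl

theorem L_neg_inverse (x : A.Pts) :
    A.L (-Ring.inverse (A.L (val x)) (val x)) = Ring.inverse (A.L (val x)) := by
  have h := A.L_mul (val x) (-Ring.inverse (A.L (val x)) (val x))
  rw [map_neg, L_inverse_apply, add_neg_cancel, A.L_zero] at h
  rw [← one_mul (A.L (-Ring.inverse (A.L (val x)) (val x))),
    ← Ring.inverse_mul_cancel _ (isUnit_L x), mul_assoc, ← h, mul_one]

instance : Inv A.Pts where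
  inv x := ⟨-Ring.inverse (A.L (val x)) (val x), by
    rw [L_neg_inverse]; exact (isUnit_L x).ringInverse⟩

theorem val_inv (x : A.Pts) : val x⁻¹ = -Ring.inverse (A.L (val x)) (val x) := rfl

instance : Group A.Pts :=
  Group.ofLeftAxioms
    (fun x y z => val_injective (by
      rw [val_mul, L_val_mul, val_mul, val_mul, val_mul, map_add, add_assoc]
      rfl))
    (fun x => val_injective (by
      rw [val_mul, val_one, A.L_zero, zero_add]
      rfl))
    (fun x => val_injective (by
      rw [val_mul, val_inv, L_neg_inverse, neg_add_cancel, val_one]))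

instance : TopologicalSpace A.Pts := inferInstanceAs (TopologicalSpace {x : E // IsUnit (A.L x)})

instance : T2Space A.Pts := inferInstanceAs (T2Space {x : E // IsUnit (A.L x)})

instance [FiniteDimensional ℝ E] : SecondCountableTopology A.Pts :=
  haveI := FiniteDimensional.proper_real E
  haveI : SecondCountableTopology E := inferInstance
  inferInstanceAs (SecondCountableTopology {x : E // IsUnit (A.L x)})

instance : Nonempty A.Pts := ⟨1⟩

variable [CompleteSpace E]

theorem isOpenEmbedding_val : Topology.IsOpenEmbedding (val : A.Pts → E) :=
  (Units.isOpen.preimage A.contDiff_L.continuous).isOpenEmbedding_subtypeVal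

instance : ChartedSpace E A.Pts := isOpenEmbedding_val.singletonChartedSpace

instance : IsManifold 𝓘(ℝ, E) ∞ A.Pts := isOpenEmbedding_val.isManifold_singleton

theorem contMDiff_val : ContMDiff 𝓘(ℝ, E) 𝓘(ℝ, E) ∞ (val : A.Pts → E) :=
  contMDiff_isOpenEmbedding isOpenEmbedding_val

instance : LieGroup 𝓘(ℝ, E) ∞ A.Pts where
  contMDiff_mul := by
    apply ContMDiff.of_comp_isOpenEmbedding isOpenEmbedding_val
    have h1 : ContMDiff (𝓘(ℝ, E).prod 𝓘(ℝ, E)) 𝓘(ℝ, E × E) ∞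
        (fun x : A.Pts × A.Pts => (val x.1, val x.2)) :=
      (contMDiff_val.comp contMDiff_fst).prodMk_space (contMDiff_val.comp contMDiff_snd)
    have h2 : ContDiff ℝ ∞ fun z : E × E => z.1 + A.L z.1 z.2 :=
      contDiff_fst.add ((A.contDiff_L.comp contDiff_fst).clm_apply contDiff_snd)
    exact (contMDiff_iff_contDiff.mpr h2).comp h1
  contMDiff_inv := by
    apply ContMDiff.of_comp_isOpenEmbedding isOpenEmbedding_val
    intro x
    have h2 : ContDiffAt ℝ ∞ (fun z : E => -Ring.inverse (A.L z) z) (val x) := by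
      obtain ⟨u, hu⟩ := isUnit_L x
      have h3 : ContDiffAt ℝ ∞ (Ring.inverse : (E →L[ℝ] E) → (E →L[ℝ] E)) (A.L (val x)) := by
        rw [← hu]
        exact contDiffAt_ringInverse ℝ u
      exact ((h3.comp (val x) A.contDiff_L.contDiffAt).clm_apply contDiffAt_id).neg
    exact (contMDiffAt_iff_contDiffAt.mpr h2).comp x (contMDiff_val x)

theorem hasMFDerivAt_val (x : A.Pts) :
    HasMFDerivAt 𝓘(ℝ, E) 𝓘(ℝ, E) (val : A.Pts → E) x (ContinuousLinearMap.id ℝ E) := by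
  refine ⟨isOpenEmbedding_val.continuous.continuousAt, ?_⟩
  have hx : extChartAt 𝓘(ℝ, E) x x = val x := rfl
  have h1 : writtenInExtChartAt 𝓘(ℝ, E) 𝓘(ℝ, E) x (val : A.Pts → E) =ᶠ[nhds (val x)] id := by
    filter_upwards [isOpenEmbedding_val.isOpen_range.mem_nhds ⟨x, rfl⟩] with y ⟨z, hz⟩
    subst hz
    exact congrArg val
      (isOpenEmbedding_val.toOpenPartialHomeomorph_left_inv (val : A.Pts → E) (x := z))
  exact ((hasFDerivAt_id (val x)).congr_of_eventuallyEq h1).hasFDerivWithinAt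

theorem mfderiv_val (x : A.Pts) :
    mfderiv 𝓘(ℝ, E) 𝓘(ℝ, E) (val : A.Pts → E) x = ContinuousLinearMap.id ℝ E :=
  (hasMFDerivAt_val x).mfderiv

variable [FiniteDimensional ℝ E]

theorem mulInvariantVectorField_eq (v : E) (x : A.Pts) :
    mulInvariantVectorField (I := 𝓘(ℝ, E)) (G := A.Pts) v x = A.L (val x) v := by
  have h1 : HasMFDerivAt 𝓘(ℝ, E) 𝓘(ℝ, E) (fun y : E => val x + A.L (val x) y) (val (1 : A.Pts))
      (A.L (val x)) :=
    ((A.L (val x)).hasFDerivAt.const_add (val x)).hasMFDerivAt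
  have h2 := h1.comp (1 : A.Pts) (hasMFDerivAt_val (1 : A.Pts))
  have h3 := (hasMFDerivAt_val (x * 1)).comp (1 : A.Pts)
    (mdifferentiableAt_mul_left 𝓘(ℝ, E) x 1).hasMFDerivAt
  exact congrArg (fun f : E →L[ℝ] E => f v) (hasMFDerivAt_unique
    (f := (fun y : E => val x + A.L (val x) y) ∘ (val : A.Pts → E)) h3 h2)

variable (A) in
/-- The left-invariant vector field of `v`, extended to the whole vector space. -/
def field (v x : E) : TangentSpace 𝓘(ℝ, E) x := A.L x v

theorem contDiff_field (v : E) : ContDiff ℝ ∞ (fun x : E => (A.field v x : E)) :=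
  A.contDiff_L.clm_apply contDiff_const

theorem mdifferentiableAt_field (v x : E) : MDifferentiableAt 𝓘(ℝ, E) 𝓘(ℝ, E).tangent
    (fun x : E => (⟨x, A.field v x⟩ : TangentBundle 𝓘(ℝ, E) E)) x :=
  (contMDiffAt_vectorSpace_iff_contDiffAt.mpr
    (A.contDiff_field v).contDiffAt).mdifferentiableAt (by simp : (∞ : ℕ∞ω) ≠ 0)

theorem mpullback_field (v : E) : mpullback 𝓘(ℝ, E) 𝓘(ℝ, E) (val : A.Pts → E) (A.field v)
    = mulInvariantVectorField (I := 𝓘(ℝ, E)) (G := A.Pts) v := by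
  funext x
  rw [mulInvariantVectorField_eq, mpullback_apply, mfderiv_val]
  exact congrArg (fun f : E →L[ℝ] E => f (A.L (val x) v)) (ContinuousLinearMap.inverse_id)

theorem fderiv_field (v w : E) : fderiv ℝ (fun x : E => A.L x v) 0 w = fderiv ℝ A.L 0 w v := by
  have h := ((A.contDiff_L.differentiable (by simp)) 0).hasFDerivAt.clm_apply
    (hasFDerivAt_const v (0 : E))
  rw [h.fderiv]
  simp

theorem mlieBracket_field (v w : E) : mlieBracket 𝓘(ℝ, E) (A.field v) (A.field w) (0 : E)
    = fderiv ℝ A.L 0 v w - fderiv ℝ A.L 0 w v := by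
  rw [← mlieBracketWithin_univ, mlieBracketWithin_eq_lieBracketWithin]
  have h : lieBracketWithin ℝ (fun x => A.L x v) (fun x => A.L x w) Set.univ 0
      = fderiv ℝ A.L 0 v w - fderiv ℝ A.L 0 w v := by
    rw [lieBracketWithin_univ, lieBracket_eq]
    simp only
    rw [fderiv_field, fderiv_field, A.L_zero]
    rfl
  exact h

variable (A) in
/-- The Lie bracket is the commutator of the derivative of `L` at `0`. -/
theorem lieBracketBilin_eq (v w : E) : lieBracketBilin 𝓘(ℝ, E) A.Pts v w
    = fderiv ℝ A.L 0 v w - fderiv ℝ A.L 0 w v := by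
  have h2 : minSmoothness ℝ 2 ≤ (∞ : ℕ∞ω) := by
    rw [minSmoothness_of_isRCLikeNormedField]
    exact WithTop.coe_le_coe.mpr le_top
  have : IsManifold 𝓘(ℝ, E) (minSmoothness ℝ 2) A.Pts := IsManifold.of_le (n := ∞) h2
  have h := mpullback_mlieBracket (A.mdifferentiableAt_field v _) (A.mdifferentiableAt_field w _)
    (contMDiff_val (1 : A.Pts)) h2
  have h3 := (congrArg₂ (fun V W => mlieBracket 𝓘(ℝ, E) V W (1 : A.Pts)) (mpullback_field v)
    (mpullback_field w)).symm.trans h.symm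
  refine Eq.trans h3 ?_
  rw [mpullback_apply, mfderiv_val]
  exact (congrArg (fun f : E →L[ℝ] E => f _) (ContinuousLinearMap.inverse_id)).trans
    (mlieBracket_field v w)

end EtaleLaw

end Etale

/-! ### A Lie group with the Lie algebra of the example -/

section ExampleGroup

namespace EtaleLaw

variable {E F : Type*} [NormedAddCommGroup E] [NormedSpace ℝ E] [NormedAddCommGroup F]
  [NormedSpace ℝ F]

/-- Transport of a group law along a linear isomorphism. -/
def conj (A : EtaleLaw F) (Φ : E ≃L[ℝ] F) : EtaleLaw E where
  L x := (Φ.symm : F →L[ℝ] E) ∘L A.L (Φ x) ∘L (Φ : E →L[ℝ] F)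
  contDiff_L := contDiff_const.clm_comp
    ((A.contDiff_L.comp Φ.contDiff).clm_comp contDiff_const)
  L_zero := by
    ext v
    simp [A.L_zero]
  L_mul x y := by
    ext v
    simp [A.L_mul]

/-- The derivative of `L` at `0` is the linear term of `L` along a line on which `L` is
quadratic. -/
theorem fderiv_L_apply (A : EtaleLaw E) {v w a c : E}
    (h : ∀ t : ℝ, A.L (t • v) w = w + t • a + t ^ 2 • c) : fderiv ℝ A.L 0 v w = a := by
  have h1 : HasDerivAt (fun t : ℝ => A.L (0 + t • v)) (fderiv ℝ A.L 0 v) 0 :=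
    ((A.contDiff_L.differentiable (by simp)) 0).hasFDerivAt.hasLineDerivAt v
  have h2 : HasDerivAt (fun t : ℝ => A.L (0 + t • v) w) (fderiv ℝ A.L 0 v w) 0 := by
    have := h1.clm_apply (hasDerivAt_const (0 : ℝ) w)
    rwa [map_zero, add_zero] at this
  have h3 : HasDerivAt (fun t : ℝ => w + t • a + t ^ 2 • c) a 0 := by
    have := (((hasDerivAt_id' (0 : ℝ)).smul_const a).const_add w).fun_add
      (((hasDerivAt_id' (0 : ℝ)).fun_pow 2).smul_const c)
    simpa using this
  simp only [zero_add, h] at h2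
  exact h2.unique h3

end EtaleLaw

/-- Coordinates `(u, v, c, p, q)` for the group of the example. The first two columns of the
`2 × (k + 2)` matrix with rows `u`, `v` form a matrix `A`, and `1 + A` acts on the columns. -/
abbrev ExampleSpace (k l : ℕ) : Type :=
  (Fin (k + 2) → ℝ) × (Fin (k + 2) → ℝ) × ℝ × (Fin l → ℝ) × (Fin l → ℝ)

variable {k l : ℕ}

/-- The linear part `y ↦ L x y` of the group law. -/
def exampleL (x : ExampleSpace k l) : ExampleSpace k l →ₗ[ℝ] ExampleSpace k l where
  toFun y :=
    ((1 + x.1 0) • y.1 + x.1 1 • y.2.1, x.2.1 0 • y.1 + (1 + x.2.1 1) • y.2.1,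
      ((1 + x.1 0) * (1 + x.2.1 1) - x.1 1 * x.2.1 0) * y.2.2.1
        + 1 / 2 * (x.1 ⬝ᵥ (x.2.1 0 • y.1 + (1 + x.2.1 1) • y.2.1)
          - x.2.1 ⬝ᵥ ((1 + x.1 0) • y.1 + x.1 1 • y.2.1)),
      (1 + x.2.2.2.1) * y.2.2.2.1, (1 + x.2.2.2.1) * y.2.2.2.2)
  map_add' y z := by
    refine Prod.ext ?_ (Prod.ext ?_ (Prod.ext ?_ (Prod.ext ?_ ?_)))
    · simp only [Prod.fst_add, Prod.snd_add]
      module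
    · simp only [Prod.fst_add, Prod.snd_add]
      module
    · simp only [Prod.fst_add, Prod.snd_add, dotProduct_add, dotProduct_smul, smul_eq_mul]
      ring
    · simp only [Prod.fst_add, Prod.snd_add]
      ring
    · simp only [Prod.snd_add]
      ring
  map_smul' t y := by
    refine Prod.ext ?_ (Prod.ext ?_ (Prod.ext ?_ (Prod.ext ?_ ?_)))
    · simp only [Prod.smul_fst, Prod.smul_snd, RingHom.id_apply]
      module
    · simp only [Prod.smul_fst, Prod.smul_snd, RingHom.id_apply]
      module
    · simp only [Prod.smul_fst, Prod.smul_snd, RingHom.id_apply, dotProduct_add, dotProduct_smul,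
        smul_eq_mul]
      ring
    · simp only [Prod.smul_fst, Prod.smul_snd, RingHom.id_apply, mul_smul_comm]
    · simp only [Prod.smul_snd, RingHom.id_apply, mul_smul_comm]

theorem exampleL_apply (x y : ExampleSpace k l) : exampleL x y =
    ((1 + x.1 0) • y.1 + x.1 1 • y.2.1, x.2.1 0 • y.1 + (1 + x.2.1 1) • y.2.1,
      ((1 + x.1 0) * (1 + x.2.1 1) - x.1 1 * x.2.1 0) * y.2.2.1
        + 1 / 2 * (x.1 ⬝ᵥ (x.2.1 0 • y.1 + (1 + x.2.1 1) • y.2.1)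
          - x.2.1 ⬝ᵥ ((1 + x.1 0) • y.1 + x.1 1 • y.2.1)),
      (1 + x.2.2.2.1) * y.2.2.2.1, (1 + x.2.2.2.1) * y.2.2.2.2) := rfl

/-- The group law of the example. The columns `0` and `1` describe `GL₂`, acting on a Heisenberg
group with coordinates the other columns and `c`; each pair `(p_i, q_i)` describes the affine group
of the line. The alternating form on the columns that enters the coordinate `c` runs over all
columns, the first two included. On `gl₂` this adds to the bracket the coboundary of
`x ↦ (v 0 - u 1) / 2`, so the algebra is still isomorphic to `(gl₂ ⋉ heis) ⊕ aff(ℝ)^l`. -/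
def exampleLaw (k l : ℕ) : EtaleLaw (ExampleSpace k l) where
  L x := LinearMap.toContinuousLinearMap (exampleL x)
  contDiff_L := by
    rw [contDiff_clm_apply_iff]
    intro y
    simp only [LinearMap.coe_toContinuousLinearMap', exampleL_apply, dotProduct]
    fun_prop
  L_zero := by
    refine ContinuousLinearMap.ext fun y => ?_
    simp [exampleL_apply]
  L_mul x y := by
    refine ContinuousLinearMap.ext fun z => ?_
    change exampleL (x + exampleL x y) z = exampleL x (exampleL y z)
    simp only [exampleL_apply, Prod.fst_add, Prod.snd_add, Pi.add_apply, Pi.smul_apply, smul_eq_mul]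
    refine Prod.ext ?_ (Prod.ext ?_ (Prod.ext ?_ (Prod.ext ?_ ?_)))
    · simp only
      module
    · simp only
      module
    · simp only [dotProduct_add, dotProduct_smul, add_dotProduct, smul_dotProduct, smul_eq_mul]
      ring
    · simp only
      ring
    · simp only
      ring

/-- The Lie bracket of the group of the example. -/
def exampleBracket (x y : ExampleSpace k l) : ExampleSpace k l :=
  (x.1 0 • y.1 + x.1 1 • y.2.1 - (y.1 0 • x.1 + y.1 1 • x.2.1),
    x.2.1 0 • y.1 + x.2.1 1 • y.2.1 - (y.2.1 0 • x.1 + y.2.1 1 • x.2.1),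
    (x.1 0 + x.2.1 1) * y.2.2.1 - (y.1 0 + y.2.1 1) * x.2.2.1
      + (x.1 ⬝ᵥ y.2.1 - x.2.1 ⬝ᵥ y.1),
    0, x.2.2.2.1 * y.2.2.2.2 - y.2.2.2.1 * x.2.2.2.2)

theorem fderiv_exampleLaw (x y : ExampleSpace k l) : fderiv ℝ (exampleLaw k l).L 0 x y =
    (x.1 0 • y.1 + x.1 1 • y.2.1, x.2.1 0 • y.1 + x.2.1 1 • y.2.1,
      (x.1 0 + x.2.1 1) * y.2.2.1 + 1 / 2 * (x.1 ⬝ᵥ y.2.1 - x.2.1 ⬝ᵥ y.1),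
      x.2.2.2.1 * y.2.2.2.1, x.2.2.2.1 * y.2.2.2.2) := by
  refine (exampleLaw k l).fderiv_L_apply (c := (0, 0, (x.1 0 * x.2.1 1 - x.1 1 * x.2.1 0) * y.2.2.1
    + 1 / 2 * (x.1 ⬝ᵥ (x.2.1 0 • y.1 + x.2.1 1 • y.2.1) - x.2.1 ⬝ᵥ (x.1 0 • y.1 + x.1 1 • y.2.1)),
      0, 0)) fun t => ?_
  change exampleL (t • x) y = _
  rw [exampleL_apply]
  refine Prod.ext ?_ (Prod.ext ?_ (Prod.ext ?_ (Prod.ext ?_ ?_)))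
  · simp only [Prod.fst_add, Prod.smul_fst, Pi.smul_apply,
      smul_eq_mul]
    module
  · simp only [Prod.fst_add, Prod.snd_add, Prod.smul_fst, Prod.smul_snd, Pi.smul_apply,
      smul_eq_mul]
    module
  · simp only [Prod.fst_add, Prod.snd_add, Prod.smul_fst, Prod.smul_snd, Pi.smul_apply,
      smul_eq_mul, dotProduct_add, dotProduct_smul, smul_dotProduct]
    ring
  · simp only [Prod.fst_add, Prod.snd_add, Prod.smul_fst, Prod.smul_snd, smul_zero, add_zero,
      add_mul, one_mul, smul_mul_assoc]
  · simp only [Prod.snd_add, Prod.smul_fst, Prod.smul_snd, smul_zero, add_zero,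
      add_mul, one_mul, smul_mul_assoc]

theorem exampleBracket_eq (x y : ExampleSpace k l) :
    fderiv ℝ (exampleLaw k l).L 0 x y - fderiv ℝ (exampleLaw k l).L 0 y x = exampleBracket x y := by
  rw [fderiv_exampleLaw, fderiv_exampleLaw]
  refine Prod.ext ?_ (Prod.ext ?_ (Prod.ext ?_ (Prod.ext ?_ ?_)))
  · rfl
  · rfl
  · simp only [Prod.snd_sub, Prod.fst_sub, exampleBracket]
    rw [dotProduct_comm y.1, dotProduct_comm y.2.1]
    ring
  · simp only [Prod.snd_sub, Prod.fst_sub, exampleBracket]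
    ring
  · rfl

end ExampleGroup

section ExampleGroupBasis

/-- The `i`-th standard vector, counted from `1`; it is `0` for an index out of range. -/
def unitVec (N i : ℕ) : Fin N → ℝ := fun a => if (a : ℕ) + 1 = i then 1 else 0

theorem unitVec_dotProduct (N i j : ℕ) (h1 : 1 ≤ i) (h2 : i ≤ N) :
    unitVec N i ⬝ᵥ unitVec N j = if i = j then 1 else 0 := by
  rw [dotProduct, Finset.sum_eq_single ⟨i - 1, by omega⟩]
  · simp only [unitVec, Nat.sub_add_cancel h1, if_true, one_mul]
  · intro a _ ha
    rw [unitVec, if_neg, zero_mul]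
    intro h
    exact ha (Fin.ext (by simp only; omega))
  · intro h
    exact absurd (Finset.mem_univ _) h

theorem unitVec_mul (N i j : ℕ) :
    unitVec N i * unitVec N j = if i = j then unitVec N i else 0 := by
  funext a
  by_cases hij : i = j
  · subst hij
    simp [unitVec]
  · rw [if_neg hij, Pi.mul_apply, Pi.zero_apply, unitVec, unitVec]
    split_ifs <;> first | omega | simp

theorem unitVec_zero (k i : ℕ) : unitVec (k + 2) i 0 = if i = 1 then 1 else 0 := by
  simp [unitVec, eq_comm]

theorem unitVec_one (k i : ℕ) : unitVec (k + 2) i 1 = if i = 2 then 1 else 0 := by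
  simp [unitVec, eq_comm]

/-- The vector with columns `0` and `1` given by the matrix `(a, b; c, d)` and with `c`-coordinate
`z`. -/
def matVec (k l : ℕ) (a b c d z : ℝ) : ExampleSpace k l :=
  (a • unitVec _ 1 + b • unitVec _ 2, c • unitVec _ 1 + d • unitVec _ 2, z, 0, 0)

/-- The vector whose only non-zero column is `(s, t)`, at place `i` counted from `1`. -/
def colVec (k l : ℕ) (s t : ℝ) (i : ℕ) : ExampleSpace k l :=
  (s • unitVec _ i, t • unitVec _ i, 0, 0, 0)

/-- The vector whose only non-zero coordinates are `p = s` and `q = t`, at the place numbered `i`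
when the count starts from `k + 3`. -/
def pairVec (k l : ℕ) (s t : ℝ) (i : ℕ) : ExampleSpace k l :=
  (0, 0, 0, s • unitVec _ (i - (k + 2)), t • unitVec _ (i - (k + 2)))

/-- The vector `ξ` of the example: it acts on the columns as the diagonal matrix `(1, -1)`, so that
`X_i + Y_i / 2` and `Y_i` (`3 ≤ i ≤ k + 2`) are the columns `(1, 0)` and `(0, 1)`. -/
def exampleξ (k l : ℕ) : ExampleSpace k l := matVec k l 1 0 0 (-1) 0

/-- The vectors `X_i` of the example, for `m = k + 2`. For `i = 1, 2` the matrix is determined by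
the required brackets with the columns `X_j` and `Y_j` (`3 ≤ j ≤ m`), and the last coordinate by the
other brackets. For `i > m` the summand `-√2 ξ` produces `[X_j, X_i]` and `[X_i, Y_j]` for
`j ≤ m`. -/
def exampleX (k l i : ℕ) : ExampleSpace k l :=
  if i = 1 then matVec k l (√2 / 2) √2 (-√2 / 4) (-√2 / 2) (7 * √2 / 8)
  else if i = 2 then matVec k l (-√2 / 2) √2 (√2 / 4) (-√2 / 2) (3 * √2 / 8)
  else if i ≤ k + 2 then colVec k l 1 (-1 / 2) i
  else matVec k l (-√2) 0 0 √2 0 + pairVec k l 0 1 i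

/-- The vectors `Y_i` of the example. -/
def exampleY (k l i : ℕ) : ExampleSpace k l :=
  if i = 1 then matVec k l 0 0 (√2 / 2) √2 (-√2 / 2)
  else if i = 2 then matVec k l 0 0 (-√2 / 2) √2 0
  else if i ≤ k + 2 then colVec k l 0 1 i
  else pairVec k l √2 0 i

/-- The space carries the Lie bracket of its group. -/
instance exampleSpaceBracket (k l : ℕ) : Bracket (ExampleSpace k l) (ExampleSpace k l) :=
  ⟨exampleBracket⟩

variable {k l : ℕ}

theorem exampleSpace_ext {x y : ExampleSpace k l} (h1 : x.1 = y.1) (h2 : x.2.1 = y.2.1)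
    (h3 : x.2.2.1 = y.2.2.1) (h4 : x.2.2.2.1 = y.2.2.2.1) (h5 : x.2.2.2.2 = y.2.2.2.2) : x = y :=
  Prod.ext h1 (Prod.ext h2 (Prod.ext h3 (Prod.ext h4 h5)))

theorem exampleX_one : exampleX k l 1
    = matVec k l (√2 / 2) √2 (-√2 / 4) (-√2 / 2) (7 * √2 / 8) := rfl
theorem exampleX_two : exampleX k l 2
    = matVec k l (-√2 / 2) √2 (√2 / 4) (-√2 / 2) (3 * √2 / 8) := rfl
theorem exampleY_one : exampleY k l 1 = matVec k l 0 0 (√2 / 2) √2 (-√2 / 2) := rfl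
theorem exampleY_two : exampleY k l 2 = matVec k l 0 0 (-√2 / 2) √2 0 := rfl
theorem exampleX_mid {i : ℕ} (h1 : 3 ≤ i) (h2 : i ≤ k + 2) :
    exampleX k l i = colVec k l 1 (-1 / 2) i := by
  unfold exampleX; split_ifs <;> first | omega | rfl
theorem exampleY_mid {i : ℕ} (h1 : 3 ≤ i) (h2 : i ≤ k + 2) :
    exampleY k l i = colVec k l 0 1 i := by
  unfold exampleY; split_ifs <;> first | omega | rfl
theorem exampleX_high {i : ℕ} (h : k + 2 < i) :
    exampleX k l i = matVec k l (-√2) 0 0 √2 0 + pairVec k l 0 1 i := by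
  unfold exampleX; split_ifs <;> first | omega | rfl
theorem exampleY_high {i : ℕ} (h : k + 2 < i) :
    exampleY k l i = pairVec k l √2 0 i := by
  unfold exampleY; split_ifs <;> first | omega | rfl

theorem lie_mat_mat (a b c d z a' b' c' d' z' : ℝ) :
    ⁅matVec k l a b c d z, matVec k l a' b' c' d' z'⁆
      = matVec k l (b * c' - b' * c) (a * b' + b * d' - (a' * b + b' * d))
        (c * a' + d * c' - (c' * a + d' * c)) (c * b' - c' * b)
        ((a + d) * z' - (a' + d') * z + (a * c' + b * d' - c * a' - d * b')) := by
  refine exampleSpace_ext ?_ ?_ ?_ ?_ ?_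
  · change _ - _ = _
    simp [matVec, unitVec_zero, unitVec_one]
    module
  · change _ - _ = _
    simp [matVec, unitVec_zero, unitVec_one]
    module
  · change _ - _ + _ = _
    simp [matVec, unitVec_zero, unitVec_one, unitVec_dotProduct]
    ring
  · rfl
  · change _ - _ = _
    simp [matVec]

theorem lie_mat_col (a b c d z s t : ℝ) {i : ℕ} (h1 : 3 ≤ i) :
    ⁅matVec k l a b c d z, colVec k l s t i⁆ = colVec k l (a * s + b * t) (c * s + d * t) i := by
  have h3 : i ≠ 1 := by omega
  have h4 : i ≠ 2 := by omega
  refine exampleSpace_ext ?_ ?_ ?_ ?_ ?_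
  · change _ - _ = _
    simp [matVec, colVec, unitVec_zero, unitVec_one, h3, h4]
    module
  · change _ - _ = _
    simp [matVec, colVec, unitVec_zero, unitVec_one, h3, h4]
    module
  · change _ - _ + _ = _
    simp [matVec, colVec, unitVec_zero, unitVec_one, unitVec_dotProduct, h3, h4, h3.symm, h4.symm]
  · rfl
  · change _ - _ = _
    simp [matVec, colVec]

theorem lie_col_col (s t s' t' : ℝ) {i j : ℕ} (h1 : 3 ≤ i) (h2 : i ≤ k + 2) (h3 : 3 ≤ j) :
    ⁅colVec k l s t i, colVec k l s' t' j⁆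
      = matVec k l 0 0 0 0 (if i = j then s * t' - t * s' else 0) := by
  have h4 : i ≠ 1 := by omega
  have h5 : i ≠ 2 := by omega
  have h6 : j ≠ 1 := by omega
  have h7 : j ≠ 2 := by omega
  refine exampleSpace_ext ?_ ?_ ?_ ?_ ?_
  · change _ - _ = _
    simp [colVec, matVec, unitVec_zero, unitVec_one, h4, h5, h6, h7]
  · change _ - _ = _
    simp [colVec, matVec, unitVec_zero, unitVec_one, h4, h5, h6, h7]
  · change _ - _ + _ = _
    have h8 : 1 ≤ i := by omega
    simp [colVec, matVec, unitVec_zero, unitVec_one, unitVec_dotProduct, h4, h5, h6, h7, h8, h2]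
    split_ifs <;> ring
  · rfl
  · change _ - _ = _
    simp [colVec, matVec]

theorem lie_pair_of_eq_zero (x : ExampleSpace k l) (h : x.2.2.2 = 0) (s t : ℝ) (i : ℕ) :
    ⁅x, pairVec k l s t i⁆ = 0 := by
  refine exampleSpace_ext ?_ ?_ ?_ ?_ ?_
  · change _ - _ = _
    simp [pairVec]
  · change _ - _ = _
    simp [pairVec]
  · change _ - _ + _ = _
    simp [pairVec]
  · rfl
  · change _ - _ = _
    simp [h]

theorem lie_mat_pair (a b c d z s t : ℝ) (i : ℕ) :
    ⁅matVec k l a b c d z, pairVec k l s t i⁆ = 0 :=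
  lie_pair_of_eq_zero _ rfl s t i

theorem lie_col_pair (s t s' t' : ℝ) (i j : ℕ) : ⁅colVec k l s t i, pairVec k l s' t' j⁆ = 0 :=
  lie_pair_of_eq_zero _ rfl s' t' j

theorem lie_pair_pair (s t s' t' : ℝ) {i j : ℕ} (hi : k + 2 < i) (hj : k + 2 < j) :
    ⁅pairVec k l s t i, pairVec k l s' t' j⁆
      = pairVec k l 0 (if i = j then s * t' - s' * t else 0) i := by
  refine exampleSpace_ext ?_ ?_ ?_ ?_ ?_
  · change _ - _ = _
    simp [pairVec]
  · change _ - _ = _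
    simp [pairVec]
  · change _ - _ + _ = _
    simp [pairVec]
  · simp only [pairVec, zero_smul]
    rfl
  · change _ - _ = _
    by_cases hij : i = j
    · subst hij
      simp [pairVec, unitVec_mul, smul_smul, mul_comm, sub_smul]
    · have h : i - (k + 2) ≠ j - (k + 2) := by omega
      simp [pairVec, unitVec_mul, hij, h, h.symm]

theorem lie_swap (x y : ExampleSpace k l) : ⁅x, y⁆ = -⁅y, x⁆ := by
  change exampleBracket x y = - exampleBracket y x
  rw [← exampleBracket_eq, ← exampleBracket_eq, neg_sub]

theorem lie_add_left (x y z : ExampleSpace k l) : ⁅x + y, z⁆ = ⁅x, z⁆ + ⁅y, z⁆ := by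
  change exampleBracket (x + y) z = exampleBracket x z + exampleBracket y z
  simp only [← exampleBracket_eq, map_add, add_apply]
  abel

theorem lie_add_right (x y z : ExampleSpace k l) : ⁅x, y + z⁆ = ⁅x, y⁆ + ⁅x, z⁆ := by
  rw [lie_swap, lie_add_left, lie_swap y, lie_swap z, ← neg_add, neg_neg]

theorem neg_colVec (s t : ℝ) (i : ℕ) : - colVec k l s t i = colVec k l (-s) (-t) i := by
  refine exampleSpace_ext ?_ ?_ ?_ ?_ ?_ <;> simp [colVec]

theorem lie_col_mat (a b c d z s t : ℝ) {i : ℕ} (h1 : 3 ≤ i) :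
    ⁅colVec k l s t i, matVec k l a b c d z⁆
      = colVec k l (-(a * s + b * t)) (-(c * s + d * t)) i := by
  rw [lie_swap, lie_mat_col _ _ _ _ _ _ _ h1, neg_colVec]

theorem lie_pair_mat (a b c d z s t : ℝ) (i : ℕ) :
    ⁅pairVec k l s t i, matVec k l a b c d z⁆ = 0 := by
  rw [lie_swap, lie_mat_pair, neg_zero]

theorem lie_pair_col (s t s' t' : ℝ) (i j : ℕ) : ⁅pairVec k l s' t' j, colVec k l s t i⁆ = 0 := by
  rw [lie_swap, lie_col_pair, neg_zero]

theorem matVec_add (a b c d z a' b' c' d' z' : ℝ) : matVec k l a b c d z + matVec k l a' b' c' d' z'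
    = matVec k l (a + a') (b + b') (c + c') (d + d') (z + z') := by
  refine exampleSpace_ext ?_ ?_ rfl ?_ ?_ <;> simp [matVec] <;> module

theorem smul_matVec (t a b c d z : ℝ) : t • matVec k l a b c d z
    = matVec k l (t * a) (t * b) (t * c) (t * d) (t * z) := by
  refine exampleSpace_ext ?_ ?_ rfl ?_ ?_ <;> simp [matVec] <;> module

theorem neg_matVec (a b c d z : ℝ) : - matVec k l a b c d z
    = matVec k l (-a) (-b) (-c) (-d) (-z) := by
  refine exampleSpace_ext ?_ ?_ rfl ?_ ?_ <;> simp [matVec] <;> module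

theorem matVec_zero : matVec k l 0 0 0 0 0 = 0 := by
  refine exampleSpace_ext ?_ ?_ rfl ?_ ?_ <;> simp [matVec]

theorem colVec_add (s t s' t' : ℝ) (i : ℕ) : colVec k l s t i + colVec k l s' t' i
    = colVec k l (s + s') (t + t') i := by
  refine exampleSpace_ext ?_ ?_ ?_ ?_ ?_ <;> simp [colVec] <;> module

theorem smul_colVec (r s t : ℝ) (i : ℕ) : r • colVec k l s t i
    = colVec k l (r * s) (r * t) i := by
  refine exampleSpace_ext ?_ ?_ ?_ ?_ ?_ <;> simp [colVec] <;> module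

theorem smul_pairVec (r s t : ℝ) (i : ℕ) : r • pairVec k l s t i
    = pairVec k l (r * s) (r * t) i := by
  refine exampleSpace_ext ?_ ?_ ?_ ?_ ?_ <;> simp [pairVec] <;> module

theorem pairVec_zero (i : ℕ) : pairVec k l 0 0 i = 0 := by
  refine exampleSpace_ext ?_ ?_ ?_ ?_ ?_ <;> simp [pairVec]

theorem colVec_zero (i : ℕ) : colVec k l 0 0 i = 0 := by
  refine exampleSpace_ext ?_ ?_ ?_ ?_ ?_ <;> simp [colVec]

theorem sqrt_two_mul_self : √2 * √2 = (2 : ℝ) := Real.mul_self_sqrt (by norm_num)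

theorem lie_exampleξ_X (i : ℕ) (hi : 1 ≤ i) :
    ⁅exampleξ k l, exampleX k l i⁆ = bracketξX (k + 2) (exampleX k l) (exampleY k l) i := by
  have hr := sqrt_two_mul_self
  unfold exampleξ bracketξX
  split_ifs with h1 h2 h3
  · subst h1
    simp only [exampleX_one, exampleX_two, exampleY_one, lie_mat_mat, matVec_add]
    congr 1 <;> linarith
  · subst h2
    simp only [exampleX_one, exampleX_two, exampleY_two, lie_mat_mat, matVec_add]
    congr 1 <;> linarith
  · have h4 : 3 ≤ i := by omega
    simp only [exampleX_mid h4 h3, exampleY_mid h4 h3, lie_mat_col _ _ _ _ _ _ _ h4, colVec_add]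
    congr 1 <;> linarith
  · rw [exampleX_high (by omega), lie_add_right, lie_mat_pair, lie_mat_mat, add_zero,
      ← matVec_zero]
    congr 1 <;> linarith

theorem lie_exampleξ_Y (i : ℕ) (hi : 1 ≤ i) :
    ⁅exampleξ k l, exampleY k l i⁆ = bracketξY (k + 2) (exampleY k l) i := by
  have hr := sqrt_two_mul_self
  unfold exampleξ bracketξY
  split_ifs with h1 h2 h3
  · subst h1
    simp only [exampleY_one, exampleY_two, lie_mat_mat, matVec_add, neg_matVec]
    congr 1 <;> linarith
  · subst h2
    simp only [exampleY_one, exampleY_two, lie_mat_mat, matVec_add, sub_eq_add_neg, neg_matVec]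
    congr 1 <;> linarith
  · have h4 : 3 ≤ i := by omega
    simp only [exampleY_mid h4 h3, lie_mat_col _ _ _ _ _ _ _ h4, neg_colVec]
    congr 1 <;> linarith
  · rw [exampleY_high (by omega), lie_mat_pair]

theorem lie_exampleX_X (i j : ℕ) (hi : 1 ≤ i) (hij : i < j) :
    ⁅exampleX k l i, exampleX k l j⁆
      = bracketXX (k + 2) (exampleX k l) (exampleY k l) i j := by
  have hr := sqrt_two_mul_self
  rcases le_or_gt j (k + 2) with hj | hj
  · obtain ⟨rfl, rfl⟩ | ⟨rfl, h3⟩ | ⟨rfl, h3⟩ | h3 : (i = 1 ∧ j = 2) ∨ (i = 1 ∧ 3 ≤ j) ∨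
      (i = 2 ∧ 3 ≤ j) ∨ 3 ≤ i := by omega
    · rw [show bracketXX (k + 2) (exampleX k l) (exampleY k l) 1 2 = √2 • exampleX k l 1 by
        simp [bracketXX]]
      simp only [exampleX_one, exampleX_two, lie_mat_mat, smul_matVec]
      congr 1 <;> linarith
    · rw [show bracketXX (k + 2) (exampleX k l) (exampleY k l) 1 j = 0 by
        unfold bracketXX; split_ifs <;> first | omega | rfl]
      rw [exampleX_mid h3 hj, exampleX_one, lie_mat_col _ _ _ _ _ _ _ h3, ← colVec_zero j]
      congr 1 <;> linarith
    · rw [show bracketXX (k + 2) (exampleX k l) (exampleY k l) 2 j = -√2 • exampleX k l j by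
        unfold bracketXX; split_ifs <;> first | omega | rfl]
      rw [exampleX_mid h3 hj, exampleX_two, lie_mat_col _ _ _ _ _ _ _ h3, smul_colVec]
      congr 1 <;> linarith
    · rw [show bracketXX (k + 2) (exampleX k l) (exampleY k l) i j = 0 by
        unfold bracketXX; split_ifs <;> first | omega | rfl]
      rw [exampleX_mid h3 (by omega), exampleX_mid (by omega) hj, lie_col_col _ _ _ _ h3 (by omega)
        (by omega), if_neg hij.ne, matVec_zero]
  · rcases le_or_gt i (k + 2) with h | h
    · -- `X_j` is the sum of `-√2 ξ` and a vector commuting with `X_i`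
      rw [show bracketXX (k + 2) (exampleX k l) (exampleY k l) i j
          = √2 • bracketξX (k + 2) (exampleX k l) (exampleY k l) i by
        unfold bracketXX; split_ifs <;> first | omega | rfl, ← lie_exampleξ_X i hi, lie_swap,
        exampleX_high hj, lie_add_left]
      obtain rfl | rfl | h3 : i = 1 ∨ i = 2 ∨ 3 ≤ i := by omega
      · simp only [exampleξ, exampleX_one, lie_mat_mat, lie_pair_mat, add_zero, smul_matVec,
          neg_matVec]
        congr 1 <;> linarith
      · simp only [exampleξ, exampleX_two, lie_mat_mat, lie_pair_mat, add_zero, smul_matVec,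
          neg_matVec]
        congr 1 <;> linarith
      · rw [exampleξ, exampleX_mid h3 h, lie_mat_col _ _ _ _ _ _ _ h3, lie_pair_col,
          lie_mat_col _ _ _ _ _ _ _ h3, add_zero, neg_colVec, smul_colVec]
        congr 1 <;> linarith
    · rw [show bracketXX (k + 2) (exampleX k l) (exampleY k l) i j = 0 by
        unfold bracketXX; split_ifs <;> first | omega | rfl, exampleX_high h, exampleX_high hj,
        lie_add_left, lie_add_right, lie_add_right, lie_mat_mat, lie_mat_pair, lie_pair_mat,
        lie_pair_pair _ _ _ _ h hj, if_neg hij.ne, pairVec_zero, add_zero, add_zero, add_zero,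
        ← matVec_zero]
      congr 1 <;> linarith

theorem lie_exampleY_Y (i j : ℕ) (hi : 1 ≤ i) (hij : i < j) :
    ⁅exampleY k l i, exampleY k l j⁆ = bracketYY (k + 2) (exampleY k l) i j := by
  have hr := sqrt_two_mul_self
  rcases le_or_gt j (k + 2) with hj | hj
  · obtain ⟨rfl, rfl⟩ | ⟨rfl, h3⟩ | ⟨rfl, h3⟩ | h3 : (i = 1 ∧ j = 2) ∨ (i = 1 ∧ 3 ≤ j) ∨
      (i = 2 ∧ 3 ≤ j) ∨ 3 ≤ i := by omega
    · rw [show bracketYY (k + 2) (exampleY k l) 1 2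
        = √2 • (-exampleY k l 1 + exampleY k l 2) by simp [bracketYY]]
      simp only [exampleY_one, exampleY_two, lie_mat_mat, smul_matVec, neg_matVec, matVec_add]
      congr 1 <;> linarith
    · rw [show bracketYY (k + 2) (exampleY k l) 1 j = √2 • exampleY k l j by
        unfold bracketYY; split_ifs <;> first | omega | rfl]
      rw [exampleY_mid h3 hj, exampleY_one, lie_mat_col _ _ _ _ _ _ _ h3, smul_colVec]
      congr 1 <;> linarith
    · rw [show bracketYY (k + 2) (exampleY k l) 2 j = √2 • exampleY k l j by
        unfold bracketYY; split_ifs <;> first | omega | rfl]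
      rw [exampleY_mid h3 hj, exampleY_two, lie_mat_col _ _ _ _ _ _ _ h3, smul_colVec]
      congr 1 <;> linarith
    · rw [show bracketYY (k + 2) (exampleY k l) i j = 0 by
        unfold bracketYY; split_ifs <;> first | omega | rfl]
      rw [exampleY_mid h3 (by omega), exampleY_mid (by omega) hj, lie_col_col _ _ _ _ h3 (by omega)
        (by omega), if_neg hij.ne, matVec_zero]
  · rw [show bracketYY (k + 2) (exampleY k l) i j = 0 by
        unfold bracketYY; split_ifs <;> first | omega | rfl, exampleY_high hj]
    obtain rfl | rfl | ⟨h3, h4⟩ | h3 : i = 1 ∨ i = 2 ∨ (3 ≤ i ∧ i ≤ k + 2) ∨ k + 2 < i := by omega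
    · rw [exampleY_one, lie_mat_pair]
    · rw [exampleY_two, lie_mat_pair]
    · rw [exampleY_mid h3 h4, lie_col_pair]
    · rw [exampleY_high h3, lie_pair_pair _ _ _ _ h3 hj, if_neg hij.ne, pairVec_zero]

theorem lie_exampleX_Y_of_le (i j : ℕ) (hi : 1 ≤ i) (hi' : i ≤ k + 2) (hj : 1 ≤ j)
    (hj' : j ≤ k + 2) : ⁅exampleX k l i, exampleY k l j⁆
      = bracketXY (k + 2) (exampleξ k l) (exampleX k l) (exampleY k l) i j := by
  have hr := sqrt_two_mul_self
  unfold bracketXY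
  split_ifs with h1 h2 h3 h4 h5 h6 h7
  · subst h1 h2
    simp only [exampleξ, exampleX_one, exampleY_one, exampleX_two, exampleY_two, lie_mat_mat,
      smul_matVec, matVec_add]
    congr 1 <;> linarith
  · subst h1 h3
    simp only [exampleξ, exampleX_one, exampleX_two, exampleY_two, lie_mat_mat, smul_matVec,
      matVec_add]
    congr 1 <;> linarith
  · subst h1
    have h0 : 3 ≤ i := by omega
    rw [exampleX_mid h0 hi', exampleY_mid h0 hi', lie_col_col _ _ _ _ h0 hi' h0, if_pos rfl]
    simp only [exampleξ, exampleX_one, exampleX_two, exampleY_two, smul_matVec, sub_eq_add_neg,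
      neg_matVec, matVec_add]
    congr 1 <;> linarith
  · obtain ⟨rfl, rfl⟩ := h4
    simp only [exampleX_one, exampleY_one, exampleX_two, exampleY_two, lie_mat_mat, smul_matVec,
      matVec_add]
    congr 1 <;> linarith
  · obtain ⟨rfl, rfl⟩ := h5
    simp only [exampleX_one, exampleY_one, exampleX_two, lie_mat_mat, smul_matVec]
    congr 1 <;> linarith
  · rw [exampleX_mid h6.2.1 h6.2.2, exampleY_mid h6.2.1 h6.2.2]
    obtain rfl | rfl : i = 1 ∨ i = 2 := by omega
    · rw [exampleX_one, lie_mat_col _ _ _ _ _ _ _ h6.2.1, smul_colVec]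
      congr 1 <;> linarith
    · rw [exampleX_two, lie_mat_col _ _ _ _ _ _ _ h6.2.1, smul_colVec]
      congr 1 <;> linarith
  · obtain ⟨h9, h10, rfl⟩ := h7
    rw [exampleX_mid h9 h10, exampleY_two, lie_col_mat _ _ _ _ _ _ _ h9, exampleY_mid h9 h10,
      smul_colVec]
    congr 1 <;> linarith
  · omega
  · obtain ⟨rfl, h9⟩ | ⟨h9, h10⟩ : j = 1 ∧ 3 ≤ i ∨ 3 ≤ i ∧ 3 ≤ j := by omega
    · rw [exampleX_mid h9 hi', exampleY_one, lie_col_mat _ _ _ _ _ _ _ h9, ← colVec_zero i]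
      congr 1 <;> linarith
    · rw [exampleX_mid h9 hi', exampleY_mid h10 hj', lie_col_col _ _ _ _ h9 hi' h10, if_neg h1,
        matVec_zero]

theorem lie_exampleX_Y (i j : ℕ) (hi : 1 ≤ i) (hj : 1 ≤ j) : ⁅exampleX k l i, exampleY k l j⁆
      = bracketXY (k + 2) (exampleξ k l) (exampleX k l) (exampleY k l) i j := by
  have hr := sqrt_two_mul_self
  rcases le_or_gt i (k + 2) with h | h <;> rcases le_or_gt j (k + 2) with h' | h'
  · exact lie_exampleX_Y_of_le i j hi h hj h'
  · rw [show bracketXY (k + 2) (exampleξ k l) (exampleX k l) (exampleY k l) i j = 0 by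
        unfold bracketXY; split_ifs <;> first | omega | rfl, exampleY_high h']
    obtain rfl | rfl | h3 : i = 1 ∨ i = 2 ∨ 3 ≤ i := by omega
    · rw [exampleX_one, lie_mat_pair]
    · rw [exampleX_two, lie_mat_pair]
    · rw [exampleX_mid h3 h, lie_col_pair]
  · rw [show bracketXY (k + 2) (exampleξ k l) (exampleX k l) (exampleY k l) i j
          = -√2 • bracketξY (k + 2) (exampleY k l) j by
        unfold bracketXY; split_ifs <;> first | omega | rfl, ← lie_exampleξ_Y j hj,
        exampleX_high h, lie_add_left]
    obtain rfl | rfl | h3 : j = 1 ∨ j = 2 ∨ 3 ≤ j := by omega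
    · simp only [exampleξ, exampleY_one, lie_mat_mat, lie_pair_mat, add_zero, smul_matVec]
      congr 1 <;> linarith
    · simp only [exampleξ, exampleY_two, lie_mat_mat, lie_pair_mat, add_zero, smul_matVec]
      congr 1 <;> linarith
    · rw [exampleξ, exampleY_mid h3 h', lie_mat_col _ _ _ _ _ _ _ h3, lie_pair_col,
        lie_mat_col _ _ _ _ _ _ _ h3, add_zero, smul_colVec]
      congr 1 <;> linarith
  · rw [exampleY_high h']
    by_cases hij : i = j
    · subst hij
      rw [show bracketXY (k + 2) (exampleξ k l) (exampleX k l) (exampleY k l) i i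
          = (-2 : ℝ) • exampleξ k l - √2 • exampleX k l i by
        unfold bracketXY; split_ifs <;> first | omega | rfl, exampleX_high h, lie_add_left,
        lie_mat_pair, lie_pair_pair _ _ _ _ h h, if_pos rfl, zero_add]
      have h0 : (-2 : ℝ) • exampleξ k l - √2 • matVec k l (-√2) 0 0 √2 0 = 0 := by
        rw [exampleξ, smul_matVec, smul_matVec, sub_eq_add_neg, neg_matVec, matVec_add,
          ← matVec_zero]
        congr 1 <;> linarith
      rw [smul_add, ← sub_sub, h0, zero_sub, ← neg_smul, smul_pairVec]
      congr 1 <;> linarith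
    · rw [show bracketXY (k + 2) (exampleξ k l) (exampleX k l) (exampleY k l) i j = 0 by
        unfold bracketXY; split_ifs <;> first | omega | rfl, exampleX_high h, lie_add_left,
        lie_mat_pair, lie_pair_pair _ _ _ _ h h', if_neg hij, pairVec_zero, add_zero]

end ExampleGroupBasis

section ExampleGroupExistence

variable {k l : ℕ}

theorem single_eq_unitVec (N : ℕ) (a : Fin N) :
    (Pi.single a 1 : Fin N → ℝ) = unitVec N (a + 1) := by
  funext c
  rw [Pi.single_apply, unitVec]
  exact if_congr (by rw [Fin.ext_iff]; omega) rfl rfl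

theorem matVec_congr {a b c d z a' b' c' d' z' : ℝ} (ha : a = a') (hb : b = b') (hc : c = c')
    (hd : d = d') (hz : z = z') : matVec k l a b c d z = matVec k l a' b' c' d' z' := by
  rw [ha, hb, hc, hd, hz]

/-- The five vectors `ξ, X_1, X_2, Y_1, Y_2` span the part of the space with coordinates the first
two columns and `c`. -/
theorem matVec_mem (S : Submodule ℝ (ExampleSpace k l)) (hξ : exampleξ k l ∈ S)
    (hX1 : exampleX k l 1 ∈ S) (hX2 : exampleX k l 2 ∈ S)
    (hY1 : exampleY k l 1 ∈ S) (hY2 : exampleY k l 2 ∈ S) :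
    matVec k l 1 0 0 0 0 ∈ S ∧ matVec k l 0 1 0 0 0 ∈ S ∧ matVec k l 0 0 1 0 0 ∈ S ∧
      matVec k l 0 0 0 1 0 ∈ S ∧ matVec k l 0 0 0 0 1 ∈ S := by
  have hr := sqrt_two_mul_self
  have hz : matVec k l 0 0 0 0 1
      = √2 • (exampleX k l 1 - exampleX k l 2 - exampleY k l 2 - √2 • exampleξ k l) := by
    simp only [exampleξ, exampleX_one, exampleX_two, exampleY_two, sub_eq_add_neg, smul_matVec,
      neg_matVec, matVec_add]
    apply matVec_congr <;> linarith
  have h22 : matVec k l 0 0 0 1 0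
      = (√2 / 4) • (exampleY k l 1 + exampleY k l 2) + (1 / 4 : ℝ) • matVec k l 0 0 0 0 1 := by
    simp only [exampleY_one, exampleY_two, smul_matVec, matVec_add]
    apply matVec_congr <;> linarith
  have h21 : matVec k l 0 0 1 0 0
      = (√2 / 2) • (exampleY k l 1 - exampleY k l 2) + (1 / 2 : ℝ) • matVec k l 0 0 0 0 1 := by
    simp only [exampleY_one, exampleY_two, sub_eq_add_neg, neg_matVec, smul_matVec, matVec_add]
    apply matVec_congr <;> linarith
  have h11 : matVec k l 1 0 0 0 0 = exampleξ k l + matVec k l 0 0 0 1 0 := by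
    simp only [exampleξ, matVec_add]
    apply matVec_congr <;> linarith
  have h12 : matVec k l 0 1 0 0 0 = (√2 / 4) • (exampleX k l 1 + exampleX k l 2
      + √2 • matVec k l 0 0 0 1 0 - (5 * √2 / 4) • matVec k l 0 0 0 0 1) := by
    simp only [exampleX_one, exampleX_two, sub_eq_add_neg, neg_matVec, smul_matVec, matVec_add]
    apply matVec_congr <;> linarith
  have mz : matVec k l 0 0 0 0 1 ∈ S := by
    rw [hz]
    exact S.smul_mem _ (S.sub_mem (S.sub_mem (S.sub_mem hX1 hX2) hY2) (S.smul_mem _ hξ))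
  have m22 : matVec k l 0 0 0 1 0 ∈ S := by
    rw [h22]
    exact S.add_mem (S.smul_mem _ (S.add_mem hY1 hY2)) (S.smul_mem _ mz)
  refine ⟨?_, ?_, ?_, m22, mz⟩
  · rw [h11]
    exact S.add_mem hξ m22
  · rw [h12]
    exact S.smul_mem _ (S.sub_mem (S.add_mem (S.add_mem hX1 hX2) (S.smul_mem _ m22))
      (S.smul_mem _ mz))
  · rw [h21]
    exact S.add_mem (S.smul_mem _ (S.sub_mem hY1 hY2)) (S.smul_mem _ mz)

theorem exampleSpace_eq_top (S : Submodule ℝ (ExampleSpace k l)) (h11 : matVec k l 1 0 0 0 0 ∈ S)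
    (h12 : matVec k l 0 1 0 0 0 ∈ S) (h21 : matVec k l 0 0 1 0 0 ∈ S)
    (h22 : matVec k l 0 0 0 1 0 ∈ S) (hz : matVec k l 0 0 0 0 1 ∈ S)
    (hu : ∀ i, 3 ≤ i → i ≤ k + 2 → colVec k l 1 0 i ∈ S)
    (hv : ∀ i, 3 ≤ i → i ≤ k + 2 → colVec k l 0 1 i ∈ S)
    (hp : ∀ i, k + 2 < i → i ≤ k + 2 + l → pairVec k l 1 0 i ∈ S)
    (hq : ∀ i, k + 2 < i → i ≤ k + 2 + l → pairVec k l 0 1 i ∈ S) : S = ⊤ := by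
  have key : S.mkQ = 0 := by
    refine LinearMap.prod_ext (LinearMap.pi_ext' fun a => LinearMap.ext_ring ?_) (LinearMap.prod_ext
      (LinearMap.pi_ext' fun a => LinearMap.ext_ring ?_) (LinearMap.prod_ext
        (LinearMap.ext_ring ?_) (LinearMap.prod_ext (LinearMap.pi_ext' fun a => LinearMap.ext_ring ?_)
          (LinearMap.pi_ext' fun a => LinearMap.ext_ring ?_))))
    · change S.mkQ (Pi.single a 1, 0, 0, 0, 0) = 0
      rw [Submodule.mkQ_apply, Submodule.Quotient.mk_eq_zero, single_eq_unitVec]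
      obtain h | h | h : (a : ℕ) + 1 = 1 ∨ (a : ℕ) + 1 = 2 ∨ 3 ≤ (a : ℕ) + 1 := by omega
      · rw [h]
        simpa [matVec] using h11
      · rw [h]
        simpa [matVec] using h12
      · simpa [colVec] using hu _ h (by omega)
    · change S.mkQ (0, Pi.single a 1, 0, 0, 0) = 0
      rw [Submodule.mkQ_apply, Submodule.Quotient.mk_eq_zero, single_eq_unitVec]
      obtain h | h | h : (a : ℕ) + 1 = 1 ∨ (a : ℕ) + 1 = 2 ∨ 3 ≤ (a : ℕ) + 1 := by omega
      · rw [h]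
        simpa [matVec] using h21
      · rw [h]
        simpa [matVec] using h22
      · simpa [colVec] using hv _ h (by omega)
    · change S.mkQ (0, 0, 1, 0, 0) = 0
      rw [Submodule.mkQ_apply, Submodule.Quotient.mk_eq_zero]
      simpa [matVec] using hz
    · change S.mkQ (0, 0, 0, Pi.single a 1, 0) = 0
      rw [Submodule.mkQ_apply, Submodule.Quotient.mk_eq_zero, single_eq_unitVec]
      have h := hp (k + 2 + (a + 1)) (by omega) (by omega)
      simpa [pairVec] using h
    · change S.mkQ (0, 0, 0, 0, Pi.single a 1) = 0
      rw [Submodule.mkQ_apply, Submodule.Quotient.mk_eq_zero, single_eq_unitVec]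
      have h := hq (k + 2 + (a + 1)) (by omega) (by omega)
      simpa [pairVec] using h
  rw [← Submodule.ker_mkQ S, key, LinearMap.ker_zero]

theorem span_example : Submodule.span ℝ (Set.range
    (frame (k + 2 + l) (exampleξ k l) (exampleX k l) (exampleY k l))) = ⊤ := by
  have hr := sqrt_two_mul_self
  obtain ⟨S, hS⟩ : ∃ S, S = Submodule.span ℝ (Set.range
    (frame (k + 2 + l) (exampleξ k l) (exampleX k l) (exampleY k l))) := ⟨_, rfl⟩
  have hξ : exampleξ k l ∈ S := by
    rw [hS]
    exact Submodule.subset_span ⟨none, rfl⟩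
  have hX : ∀ i, 1 ≤ i → i ≤ k + 2 + l → exampleX k l i ∈ S := by
    intro i h1 h2
    rw [hS]
    refine Submodule.subset_span ⟨some (Sum.inl ⟨i - 1, by omega⟩), ?_⟩
    exact congrArg (exampleX k l) (by simp only; omega)
  have hY : ∀ i, 1 ≤ i → i ≤ k + 2 + l → exampleY k l i ∈ S := by
    intro i h1 h2
    rw [hS]
    refine Submodule.subset_span ⟨some (Sum.inr ⟨i - 1, by omega⟩), ?_⟩
    exact congrArg (exampleY k l) (by simp only; omega)
  rw [← hS]
  have hX1 := hX 1 (by omega) (by omega)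
  have hX2 := hX 2 (by omega) (by omega)
  have hY1 := hY 1 (by omega) (by omega)
  have hY2 := hY 2 (by omega) (by omega)
  obtain ⟨h11, h12, h21, h22, hz⟩ := matVec_mem S hξ hX1 hX2 hY1 hY2
  have hv : ∀ i, 3 ≤ i → i ≤ k + 2 → colVec k l 0 1 i ∈ S := by
    intro i h1 h2
    rw [← exampleY_mid h1 h2]
    exact hY i (by omega) (by omega)
  have hu : ∀ i, 3 ≤ i → i ≤ k + 2 → colVec k l 1 0 i ∈ S := by
    intro i h1 h2
    have h : colVec k l 1 0 i = colVec k l 1 (-1 / 2) i + (1 / 2 : ℝ) • colVec k l 0 1 i := by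
      rw [smul_colVec, colVec_add]
      norm_num
    rw [h, ← exampleX_mid h1 h2]
    exact S.add_mem (hX i (by omega) (by omega)) (S.smul_mem _ (hv i h1 h2))
  have hp : ∀ i, k + 2 < i → i ≤ k + 2 + l → pairVec k l 1 0 i ∈ S := by
    intro i h1 h2
    have h : pairVec k l 1 0 i = (√2 / 2) • exampleY k l i := by
      rw [exampleY_high h1, smul_pairVec, mul_zero, show √2 / 2 * √2 = 1 by linarith]
    rw [h]
    exact S.smul_mem _ (hY i (by omega) (by omega))
  have hq : ∀ i, k + 2 < i → i ≤ k + 2 + l → pairVec k l 0 1 i ∈ S := by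
    intro i h1 h2
    have h : pairVec k l 0 1 i = exampleX k l i + √2 • exampleξ k l := by
      have h0 : matVec k l (-√2) 0 0 √2 0 = -(√2 • exampleξ k l) := by
        rw [exampleξ, smul_matVec, neg_matVec]
        apply matVec_congr <;> linarith
      rw [exampleX_high h1, h0, neg_add_eq_sub, sub_add_cancel]
    rw [h]
    exact S.add_mem (hX i (by omega) (by omega)) (S.smul_mem _ hξ)
  exact exampleSpace_eq_top S h11 h12 h21 h22 hz hu hv hp hq

theorem finrank_exampleSpace (k l : ℕ) :
    Module.finrank ℝ (ExampleSpace k l) = 2 * (k + 2 + l) + 1 := by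
  simp only [Module.finrank_prod, Module.finrank_fin_fun, Module.finrank_self]
  ring

theorem isExampleBasis_example (k l : ℕ) :
    IsExampleBasis (k + 2 + l) (k + 2) (exampleξ k l) (exampleX k l) (exampleY k l) where
  linearIndependent := linearIndependent_of_top_le_span_of_card_eq_finrank span_example.ge (by
    rw [finrank_exampleSpace]
    simp
    ring)
  span_eq_top := span_example
  lie_ξ_X i hi := lie_exampleξ_X i (Finset.mem_Icc.mp hi).1
  lie_ξ_Y i hi := lie_exampleξ_Y i (Finset.mem_Icc.mp hi).1
  lie_X_X i hi j _ h := lie_exampleX_X i j (Finset.mem_Icc.mp hi).1 h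
  lie_Y_Y i hi j _ h := lie_exampleY_Y i j (Finset.mem_Icc.mp hi).1 h
  lie_X_Y i hi j hj := lie_exampleX_Y i j (Finset.mem_Icc.mp hi).1 (Finset.mem_Icc.mp hj).1

/-- The defining brackets are preserved by linear isomorphisms compatible with the brackets. -/
theorem IsExampleBasis.map {V W : Type*} [AddCommGroup V] [Module ℝ V] [Bracket V V]
    [AddCommGroup W] [Module ℝ W] [Bracket W W] {n m : ℕ} {ξ : V} {X Y : ℕ → V}
    (B : IsExampleBasis n m ξ X Y) (f : V ≃ₗ[ℝ] W) (hf : ∀ x y, ⁅f x, f y⁆ = f ⁅x, y⁆) :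
    IsExampleBasis n m (f ξ) (fun i => f (X i)) (fun i => f (Y i)) := by
  have hframe : frame n (f ξ) (fun i => f (X i)) (fun i => f (Y i)) = f ∘ frame n ξ X Y := by
    funext a
    rcases a with _ | i | i <;> rfl
  have hξX : ∀ i, bracketξX m (fun i => f (X i)) (fun i => f (Y i)) i = f (bracketξX m X Y i) := by
    intro i
    unfold bracketξX
    split_ifs <;> simp
  have hξY : ∀ i, bracketξY m (fun i => f (Y i)) i = f (bracketξY m Y i) := by
    intro i
    unfold bracketξY
    split_ifs <;> simp
  refine ⟨?_, ?_, ?_, ?_, ?_, ?_, ?_⟩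
  · rw [hframe]
    exact B.linearIndependent.map' (f : V →ₗ[ℝ] W) f.ker
  · rw [hframe, Set.range_comp, ← LinearEquiv.coe_coe, Submodule.span_image, B.span_eq_top,
      Submodule.map_top, LinearEquiv.range]
  · intro i hi
    rw [hf, B.lie_ξ_X i hi, hξX]
  · intro i hi
    rw [hf, B.lie_ξ_Y i hi, hξY]
  · intro i hi j hj hij
    rw [hf, B.lie_X_X i hi j hj hij]
    unfold bracketXX
    simp only [hξX]
    split_ifs <;> simp
  · intro i hi j hj hij
    rw [hf, B.lie_Y_Y i hi j hj hij]
    unfold bracketYY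
    split_ifs <;> simp
  · intro i hi j hj
    rw [hf, B.lie_X_Y i hi j hj]
    unfold bracketXY
    simp only [hξY]
    split_ifs <;> simp

/-- The points of `exampleLaw`, transported to a Euclidean space to have the model demanded of a
manifold of dimension `2 n + 1`, form a Lie group with the Lie algebra of the example. -/
theorem exists_exampleGroup {n m : ℕ} (h2 : 2 ≤ m) (hm : m ≤ n) :
    ∃ (G : Type) (_ : TopologicalSpace G)
      (_ : ChartedSpace (EuclideanSpace ℝ (Fin (2 * n + 1))) G) (_ : Group G)
      (_ : LieGroup (𝓡 (2 * n + 1)) ∞ G) (_ : T2Space G) (_ : SecondCountableTopology G)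
      (ξ : GroupLieAlgebra (𝓡 (2 * n + 1)) G) (X Y : ℕ → GroupLieAlgebra (𝓡 (2 * n + 1)) G),
      IsExampleBasis n m ξ X Y := by
  obtain ⟨k, rfl⟩ : ∃ k, m = k + 2 := ⟨m - 2, by omega⟩
  obtain ⟨l, rfl⟩ : ∃ l, n = k + 2 + l := ⟨n - (k + 2), by omega⟩
  let Φ : EuclideanSpace ℝ (Fin (2 * (k + 2 + l) + 1)) ≃L[ℝ] ExampleSpace k l :=
    ContinuousLinearEquiv.ofFinrankEq (by rw [finrank_exampleSpace, finrank_euclideanSpace_fin])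
  let A := (exampleLaw k l).conj Φ
  have hA : ∀ v w, fderiv ℝ A.L 0 v w = Φ.symm (fderiv ℝ (exampleLaw k l).L 0 (Φ v) (Φ w)) := by
    intro v w
    have h1 : HasFDerivAt (fun x => Φ.symm ((exampleLaw k l).L (Φ x) (Φ w)))
        ((Φ.symm : ExampleSpace k l →L[ℝ] _) ∘L
          fderiv ℝ (fun y => (exampleLaw k l).L y (Φ w)) (Φ 0) ∘L (Φ : _ →L[ℝ] ExampleSpace k l))
        0 :=
      Φ.symm.hasFDerivAt.comp 0 (HasFDerivAt.comp 0 (DifferentiableAt.hasFDerivAt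
        (((exampleLaw k l).contDiff_field (Φ w)).differentiable (by simp) (Φ 0))) Φ.hasFDerivAt)
    rw [← EtaleLaw.fderiv_field]
    change fderiv ℝ (fun x => Φ.symm ((exampleLaw k l).L (Φ x) (Φ w))) 0 v = _
    rw [h1.fderiv, map_zero, ← EtaleLaw.fderiv_field]
    rfl
  have B := (isExampleBasis_example k l).map (W := GroupLieAlgebra (𝓡 (2 * (k + 2 + l) + 1)) A.Pts)
    Φ.symm.toLinearEquiv (fun x y => by
      refine (A.lieBracketBilin_eq (Φ.symm x) (Φ.symm y)).trans ?_
      rw [hA, hA, Φ.apply_symm_apply, Φ.apply_symm_apply, ← map_sub, exampleBracket_eq]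
      rfl)
  exact ⟨A.Pts, inferInstance, inferInstance, inferInstance, inferInstance, inferInstance,
    inferInstance, _, _, _, B⟩

end ExampleGroupExistence

/-! ### Structures with `h` of rank one -/

section RankOne

/-- A smooth frame on the vector space `E`, given by linear isomorphisms `F x`, whose fields
`x ↦ F x v` have constant structure functions `br`. -/
structure FrameLaw (E : Type*) [NormedAddCommGroup E] [NormedSpace ℝ E] where
  F : E → E ≃L[ℝ] E
  contDiff_F : ∀ v, ContDiff ℝ ∞ fun x => F x v
  br : E →ₗ[ℝ] E →ₗ[ℝ] E
  lieBracket_F : ∀ v w x, lieBracket ℝ (fun y => F y v) (fun y => F y w) x = F x (br v w)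

namespace FrameLaw

variable {E V : Type*} [NormedAddCommGroup E] [NormedSpace ℝ E] [NormedAddCommGroup V]
  [NormedSpace ℝ V]

/-- Transport of a frame along a linear isomorphism. -/
def conj (A : FrameLaw V) (Φ : E ≃L[ℝ] V) : FrameLaw E where
  F x := (Φ.trans (A.F (Φ x))).trans Φ.symm
  contDiff_F v := Φ.symm.contDiff.comp ((A.contDiff_F (Φ v)).comp Φ.contDiff)
  br := (A.br.compl₁₂ (Φ : E →ₗ[ℝ] V) (Φ : E →ₗ[ℝ] V)).compr₂ (Φ.symm : V →ₗ[ℝ] E)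
  lieBracket_F v w x := by
    have h : ∀ v, HasFDerivAt (fun x => Φ.symm (A.F (Φ x) (Φ v)))
        ((Φ.symm : V →L[ℝ] E) ∘L fderiv ℝ (fun y => A.F y (Φ v)) (Φ x) ∘L (Φ : E →L[ℝ] V)) x :=
      fun v => Φ.symm.hasFDerivAt.comp x (HasFDerivAt.comp x (DifferentiableAt.hasFDerivAt
        ((A.contDiff_F (Φ v)).differentiable (by simp) (Φ x))) Φ.hasFDerivAt)
    have h1 := congrArg Φ.symm (A.lieBracket_F (Φ v) (Φ w) (Φ x))
    rw [lieBracket_eq] at h1 ⊢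
    change fderiv ℝ (fun x => Φ.symm (A.F (Φ x) (Φ w))) x (Φ.symm (A.F (Φ x) (Φ v)))
      - fderiv ℝ (fun x => Φ.symm (A.F (Φ x) (Φ v))) x (Φ.symm (A.F (Φ x) (Φ w)))
      = Φ.symm (A.F (Φ x) (Φ (Φ.symm (A.br (Φ v) (Φ w)))))
    rw [(h v).fderiv, (h w).fderiv, Φ.apply_symm_apply, ← h1, map_sub]
    simp

theorem conj_br (A : FrameLaw V) (Φ : E ≃L[ℝ] V) (v w : E) :
    (A.conj Φ).br v w = Φ.symm (A.br (Φ v) (Φ w)) := rfl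

/-- A frame as a parallelization of the vector space. -/
def parallelization [FiniteDimensional ℝ E] (A : FrameLaw E) : Parallelization 𝓘(ℝ, E) E where
  F := A.F
  contMDiff_F v := fun x => contMDiffAt_vectorSpace_iff_contDiffAt.mpr (A.contDiff_F v).contDiffAt
  br := A.br
  mlieBracket_F v w x := by
    rw [← mlieBracketWithin_univ, mlieBracketWithin_eq_lieBracketWithin]
    refine Eq.trans ?_ (A.lieBracket_F v w x)
    rw [← lieBracketWithin_univ]
    rfl

end FrameLaw

/-- Coordinates `(x, t, y, z, w)`. -/
abbrev RankOneSpace (l : ℕ) : Type := ℝ × ℝ × ℝ × (Fin l → ℝ) × (Fin l → ℝ)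

variable {l : ℕ}

/-- The frame `∂_x`, `-x ∂_x + ∂_t`, `-x² ∂_x + 2 x ∂_t + exp (-t) ∂_y`, `∂_{z_i}`,
`2 z_i ∂_{z_i} + ∂_{w_i}`. -/
def rankOneF (x : RankOneSpace l) : RankOneSpace l ≃ₗ[ℝ] RankOneSpace l where
  toFun v := (v.1 - v.2.1 * x.1 - v.2.2.1 * x.1 ^ 2, v.2.1 + 2 * v.2.2.1 * x.1,
    v.2.2.1 * Real.exp (-x.2.1), v.2.2.2.1 + (2 : ℝ) • (x.2.2.2.1 * v.2.2.2.2), v.2.2.2.2)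
  map_add' v w := by
    refine Prod.ext ?_ (Prod.ext ?_ (Prod.ext ?_ (Prod.ext ?_ ?_))) <;>
    simp only [Prod.fst_add, Prod.snd_add, mul_add, smul_add] <;> ring
  map_smul' t v := by
    refine Prod.ext ?_ (Prod.ext ?_ (Prod.ext ?_ (Prod.ext ?_ ?_)))
    · simp only [Prod.smul_fst, Prod.smul_snd, smul_eq_mul, RingHom.id_apply]; ring
    · simp only [Prod.smul_fst, Prod.smul_snd, smul_eq_mul, RingHom.id_apply]; ring
    · simp only [Prod.smul_fst, Prod.smul_snd, smul_eq_mul, RingHom.id_apply]; ring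
    · simp only [Prod.smul_fst, Prod.smul_snd, RingHom.id_apply, mul_smul_comm, smul_add]
      rw [smul_comm]
    · simp
  invFun v := (v.1 + (v.2.1 - 2 * (v.2.2.1 * Real.exp x.2.1) * x.1) * x.1
      + v.2.2.1 * Real.exp x.2.1 * x.1 ^ 2, v.2.1 - 2 * (v.2.2.1 * Real.exp x.2.1) * x.1,
    v.2.2.1 * Real.exp x.2.1, v.2.2.2.1 - (2 : ℝ) • (x.2.2.2.1 * v.2.2.2.2), v.2.2.2.2)
  left_inv v := by
    have h : v.2.2.1 * Real.exp (-x.2.1) * Real.exp x.2.1 = v.2.2.1 := by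
      rw [mul_assoc, ← Real.exp_add, neg_add_cancel, Real.exp_zero, mul_one]
    refine Prod.ext ?_ (Prod.ext ?_ (Prod.ext h (Prod.ext ?_ rfl)))
    · simp only [h]; ring
    · simp only [h]; ring
    · simp
  right_inv v := by
    have h : v.2.2.1 * Real.exp x.2.1 * Real.exp (-x.2.1) = v.2.2.1 := by
      rw [mul_assoc, ← Real.exp_add, add_neg_cancel, Real.exp_zero, mul_one]
    refine Prod.ext ?_ (Prod.ext ?_ (Prod.ext h (Prod.ext ?_ rfl)))
    · simp only; ring
    · simp only; ring
    · simp

/-- The structure functions of `rankOneF`: the direct sum of `sl₂` and affine algebras. -/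
def rankOneBr (l : ℕ) : RankOneSpace l →ₗ[ℝ] RankOneSpace l →ₗ[ℝ] RankOneSpace l :=
  LinearMap.mk₂ ℝ (fun v w => (v.2.1 * w.1 - w.2.1 * v.1, 2 * (v.1 * w.2.2.1 - w.1 * v.2.2.1),
    w.2.1 * v.2.2.1 - v.2.1 * w.2.2.1, (2 : ℝ) • (v.2.2.2.1 * w.2.2.2.2 - w.2.2.2.1 * v.2.2.2.2),
    0))
    (fun u v w => by
      refine Prod.ext ?_ (Prod.ext ?_ (Prod.ext ?_ (Prod.ext ?_ (add_zero _).symm))) <;>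
      simp only [Prod.fst_add, Prod.snd_add, ← smul_add]
      · ring
      · ring
      · ring
      · congr 1; ring)
    (fun t v w => by
      refine Prod.ext ?_ (Prod.ext ?_ (Prod.ext ?_ (Prod.ext ?_ (smul_zero _).symm))) <;>
      simp only [Prod.smul_fst, Prod.smul_snd, smul_eq_mul]
      · ring
      · ring
      · ring
      · rw [smul_comm t]; congr 1; simp only [smul_mul_assoc, mul_smul_comm, smul_sub])
    (fun u v w => by
      refine Prod.ext ?_ (Prod.ext ?_ (Prod.ext ?_ (Prod.ext ?_ (add_zero _).symm))) <;>
      simp only [Prod.fst_add, Prod.snd_add, ← smul_add]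
      · ring
      · ring
      · ring
      · congr 1; ring)
    (fun t v w => by
      refine Prod.ext ?_ (Prod.ext ?_ (Prod.ext ?_ (Prod.ext ?_ (smul_zero _).symm))) <;>
      simp only [Prod.smul_fst, Prod.smul_snd, smul_eq_mul]
      · ring
      · ring
      · ring
      · rw [smul_comm t]; congr 1; simp only [smul_mul_assoc, mul_smul_comm, smul_sub])

theorem contDiff_rankOneF (v : RankOneSpace l) : ContDiff ℝ ∞ fun y => rankOneF y v := by
  change ContDiff ℝ ∞ fun x : RankOneSpace l =>
    (v.1 - v.2.1 * x.1 - v.2.2.1 * x.1 ^ 2, v.2.1 + 2 * v.2.2.1 * x.1,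
    v.2.2.1 * Real.exp (-x.2.1), v.2.2.2.1 + (2 : ℝ) • (x.2.2.2.1 * v.2.2.2.2), v.2.2.2.2)
  fun_prop

theorem fderiv_rankOneF (v x u : RankOneSpace l) : fderiv ℝ (fun y => rankOneF y v) x u
    = (-(v.2.1 * u.1) - 2 * v.2.2.1 * x.1 * u.1, 2 * v.2.2.1 * u.1,
      -(v.2.2.1 * Real.exp (-x.2.1) * u.2.1), (2 : ℝ) • (u.2.2.2.1 * v.2.2.2.2), 0) := by
  have h1 : HasDerivAt (fun t : ℝ => rankOneF (x + t • u) v) (fderiv ℝ (fun y => rankOneF y v) x u)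
      0 := ((contDiff_rankOneF v).differentiable (by simp) x).hasFDerivAt.hasLineDerivAt u
  have hx : ∀ r s : ℝ, HasDerivAt (fun t : ℝ => r + t * s) s 0 := fun r s => by
    simpa using ((hasDerivAt_id' (0 : ℝ)).mul_const s).const_add r
  refine h1.unique (HasDerivAt.prodMk ?_ (HasDerivAt.prodMk ?_ (HasDerivAt.prodMk ?_
    (HasDerivAt.prodMk ?_ (hasDerivAt_const _ _)))))
  · have := (((hx x.1 u.1).const_mul v.2.1).const_sub v.1).fun_sub
      (((hx x.1 u.1).fun_pow 2).const_mul v.2.2.1)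
    refine this.congr_deriv ?_
    simp
    ring
  · exact ((hx x.1 u.1).const_mul (2 * v.2.2.1)).const_add v.2.1
  · have := ((hx x.2.1 u.2.1).fun_neg.exp).const_mul v.2.2.1
    refine this.congr_deriv ?_
    simp
    ring
  · rw [hasDerivAt_pi]
    intro a
    have := (((hx (x.2.2.2.1 a) (u.2.2.2.1 a)).mul_const (v.2.2.2.2 a)).const_mul 2).const_add
      (v.2.2.2.1 a)
    exact this

/-- The frame of `rankOneF` with its structure functions. -/
def rankOneLaw (l : ℕ) : FrameLaw (RankOneSpace l) where
  F x := (rankOneF x).toContinuousLinearEquiv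
  contDiff_F := contDiff_rankOneF
  br := rankOneBr l
  lieBracket_F v w x := by
    rw [lieBracket_eq]
    change fderiv ℝ (fun y => rankOneF y w) x (rankOneF x v)
      - fderiv ℝ (fun y => rankOneF y v) x (rankOneF x w) = rankOneF x (rankOneBr l v w)
    rw [fderiv_rankOneF, fderiv_rankOneF]
    refine Prod.ext ?_ (Prod.ext ?_ (Prod.ext ?_ (Prod.ext ?_ ?_)))
    · simp [rankOneF, rankOneBr]; ring
    · simp [rankOneF, rankOneBr]; ring
    · simp [rankOneF, rankOneBr]; ring
    · funext a
      simp [rankOneF, rankOneBr]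
      ring
    · simp [rankOneF, rankOneBr]

/-- The multiplication table, in a basis `ξ, X_i, Y_i`, of the frame of `rankOneF`. -/
structure IsRankOneTable {E : Type*} [NormedAddCommGroup E] [NormedSpace ℝ E]
    [FiniteDimensional ℝ E] (b : Module.Basis (Option (Fin (l + 1) ⊕ Fin (l + 1))) ℝ E)
    (br : E →ₗ[ℝ] E →ₗ[ℝ] E) : Prop where
  skew : ∀ v w, br v w = - br w v
  jacobi : ∀ u v w, br u (br v w) = br (br u v) w + br v (br u w)
  br_ξ_X_zero : br (basisξ b) (basisX b 0) = basisX b 0 + basisY b 0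
  br_ξ_X : ∀ i : Fin l, br (basisξ b) (basisX b i.succ) = 0
  br_ξ_Y_zero : br (basisξ b) (basisY b 0) = - basisY b 0
  br_ξ_Y : ∀ i : Fin l, br (basisξ b) (basisY b i.succ) = 0
  br_X_X_zero : ∀ j : Fin l, br (basisX b 0) (basisX b j.succ) = basisX b 0 + basisY b 0
  br_X_X : ∀ i j : Fin l, br (basisX b i.succ) (basisX b j.succ) = 0
  br_Y_Y : ∀ i j, br (basisY b i) (basisY b j) = 0
  br_X_Y_zero_zero : br (basisX b 0) (basisY b 0) = (2 : ℝ) • basisξ b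
  br_X_Y_zero : ∀ j : Fin l, br (basisX b 0) (basisY b j.succ) = 0
  br_X_zero_Y : ∀ i : Fin l, br (basisX b i.succ) (basisY b 0) = basisY b 0
  br_X_Y : ∀ i j : Fin l, br (basisX b i.succ) (basisY b j.succ)
    = if i = j then (2 : ℝ) • basisξ b + (2 : ℝ) • basisX b i.succ else 0

/-- The `1`-eigenspace of `-φ - h` is abelian here, and its `(-1)`-eigenspace is spanned by
`X_1 + Y_1 / 2` and commuting vectors `X_i` that act on it by scalars. -/
theorem IsRankOneTable.isNullBasis {E : Type*} [NormedAddCommGroup E] [NormedSpace ℝ E]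
    [FiniteDimensional ℝ E] {b : Module.Basis (Option (Fin (l + 1) ⊕ Fin (l + 1))) ℝ E}
    {br : E →ₗ[ℝ] E →ₗ[ℝ] E} (T : IsRankOneTable b br) :
    IsNullBasis b br (fun _ => 1) (rankCoeff 1) := by
  have e0 : rankCoeff 1 (0 : Fin (l + 1)) = 1 := by simp [rankCoeff]
  have e1 : ∀ i : Fin l, rankCoeff 1 i.succ = 0 := fun i => by simp [rankCoeff]
  refine ⟨T.skew, T.jacobi, fun _ => one_ne_zero, ?_, ?_, ?_, ?_, ?_, ?_, ?_, ?_, ?_⟩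
  · intro i
    refine Fin.cases ?_ (fun i => ?_) i
    · simp [T.br_ξ_X_zero]
    · simp [T.br_ξ_X]
  · intro i j hij
    obtain ⟨j, rfl⟩ := Fin.eq_succ_of_ne_zero (Fin.ne_zero_of_lt hij)
    refine Fin.cases ?_ (fun i => ?_) i
    · simp [T.br_X_X_zero]
    · simp [T.br_X_X]
  · intro i j
    refine Fin.cases ?_ (fun i => ?_) i <;> refine Fin.cases ?_ (fun j => ?_) j
    · simp [T.br_X_Y_zero_zero]
    · simp [T.br_X_Y_zero, (Fin.succ_ne_zero j).symm]
    · simp [T.br_X_zero_Y]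
    · rw [T.br_X_Y]
      by_cases h : i = j <;> simp [h]
  · intro i
    refine Fin.cases ?_ (fun i => ?_) i
    · simp [T.br_ξ_Y_zero]
    · simp [T.br_ξ_Y]
  · intro i
    refine Fin.cases ?_ (fun i => ?_) i
    · simp only [T.br_ξ_X_zero, map_add, basisφ_X, basisφ_Y, e0]
      module
    · simp [T.br_ξ_X, e1]
  · intro i
    refine Fin.cases ?_ (fun i => ?_) i
    · simp only [map_add, map_smul, T.br_ξ_X_zero, T.br_ξ_Y_zero, basisφ_X, basisφ_Y, basish_X,
        basish_Y, e0]
      module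
    · simp [T.br_ξ_X, e1]
  · intro i j _
    simp [T.br_Y_Y]
  · intro i j hij z hz
    obtain ⟨j, rfl⟩ := Fin.eq_succ_of_ne_zero (Fin.ne_zero_of_lt hij)
    rw [e1, zero_div, zero_smul, add_zero] at hz
    revert hz
    refine Fin.cases (fun hz => ?_) (fun i hz => ?_) i
    · rw [map_add, map_smul, LinearMap.add_apply, LinearMap.smul_apply, T.br_X_X_zero,
        T.skew (basisY b 0), T.br_X_zero_Y, e0] at hz
      rw [hz]
      simp only [map_add, map_smul, map_neg, basisφ_X, basisφ_Y, basish_X, basish_Y, e0]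
      module
    · rw [e1, zero_div, zero_smul, add_zero, T.br_X_X] at hz
      simp [hz]
  · intro i j k
    have h1 : ∀ i : Fin l, basisg b (fun _ => 1) (br (basisX b i.succ) (basisY b j)) (basisY b 0)
        = 0 := by
      intro i
      refine Fin.cases ?_ (fun j => ?_) j
      · simp [T.br_X_zero_Y]
      · rw [T.br_X_Y]
        split_ifs <;> simp
    refine Fin.cases ?_ (fun i => ?_) i <;> refine Fin.cases ?_ (fun k => ?_) k
    · refine Fin.cases ?_ (fun j => ?_) j
      · simp [T.br_X_Y_zero_zero]
      · simp [T.br_X_Y_zero]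
    · simp [e1, h1]
    · simp [e1, h1]
    · simp [e1]

/-- The basis of `RankOneSpace l` given by `ξ = -x ∂_x + ∂_t`, `X_1 = ∂_x - Y_1 / 2`,
`X_{i + 1} = ∂_{z_i} - ξ`, and the remaining fields `Y_i` of the frame. -/
def rankOneVec (l : ℕ) : Option (Fin (l + 1) ⊕ Fin (l + 1)) → RankOneSpace l
  | none => (0, 1, 0, 0, 0)
  | some (Sum.inl i) => Fin.cases (1, 0, -1 / 2, 0, 0) (fun i => (0, -1, 0, Pi.single i 1, 0)) i
  | some (Sum.inr i) => Fin.cases (0, 0, 1, 0, 0) (fun i => (0, 0, 0, 0, Pi.single i 1)) i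

theorem span_rankOneVec (l : ℕ) : Submodule.span ℝ (Set.range (rankOneVec l)) = ⊤ := by
  obtain ⟨S, hS⟩ : ∃ S, S = Submodule.span ℝ (Set.range (rankOneVec l)) := ⟨_, rfl⟩
  have h : ∀ a, rankOneVec l a ∈ S := fun a => by
    rw [hS]
    exact Submodule.subset_span ⟨a, rfl⟩
  rw [← hS]
  have hξ := h none
  have hY : ((0, 0, 1, 0, 0) : RankOneSpace l) ∈ S := h (some (Sum.inr 0))
  have hX : ((1, 0, -1 / 2, 0, 0) : RankOneSpace l) ∈ S := h (some (Sum.inl 0))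
  have key : S.mkQ = 0 := by
    refine LinearMap.prod_ext (LinearMap.ext_ring ?_) (LinearMap.prod_ext (LinearMap.ext_ring ?_)
      (LinearMap.prod_ext (LinearMap.ext_ring ?_) (LinearMap.prod_ext
        (LinearMap.pi_ext' fun a => LinearMap.ext_ring ?_)
          (LinearMap.pi_ext' fun a => LinearMap.ext_ring ?_))))
    · change S.mkQ (1, 0, 0, 0, 0) = 0
      rw [Submodule.mkQ_apply, Submodule.Quotient.mk_eq_zero]
      have := S.add_mem hX (S.smul_mem (1 / 2) hY)
      simpa [show (-1 / 2 + 2⁻¹ : ℝ) = 0 by norm_num] using this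
    · change S.mkQ (0, 1, 0, 0, 0) = 0
      rw [Submodule.mkQ_apply, Submodule.Quotient.mk_eq_zero]
      exact hξ
    · change S.mkQ (0, 0, 1, 0, 0) = 0
      rw [Submodule.mkQ_apply, Submodule.Quotient.mk_eq_zero]
      exact hY
    · change S.mkQ (0, 0, 0, Pi.single a 1, 0) = 0
      rw [Submodule.mkQ_apply, Submodule.Quotient.mk_eq_zero]
      have := S.add_mem (h (some (Sum.inl a.succ))) hξ
      simpa [rankOneVec] using this
    · change S.mkQ (0, 0, 0, 0, Pi.single a 1) = 0
      rw [Submodule.mkQ_apply, Submodule.Quotient.mk_eq_zero]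
      exact h (some (Sum.inr a.succ))
  rw [← Submodule.ker_mkQ S, key, LinearMap.ker_zero]

theorem finrank_rankOneSpace (l : ℕ) : Module.finrank ℝ (RankOneSpace l) = 2 * (l + 1) + 1 := by
  simp only [Module.finrank_prod, Module.finrank_fin_fun, Module.finrank_self]
  ring

theorem linearIndependent_rankOneVec (l : ℕ) : LinearIndependent ℝ (rankOneVec l) :=
  linearIndependent_of_top_le_span_of_card_eq_finrank (span_rankOneVec l).ge (by
    rw [finrank_rankOneSpace]
    simp
    ring)

/-- `rankOneVec l` as a basis. -/
def rankOneBasis (l : ℕ) : Module.Basis (Option (Fin (l + 1) ⊕ Fin (l + 1))) ℝ (RankOneSpace l) :=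
  Module.Basis.mk (linearIndependent_rankOneVec l) (span_rankOneVec l).ge

theorem rankOneBr_apply (v w : RankOneSpace l) : rankOneBr l v w
    = (v.2.1 * w.1 - w.2.1 * v.1, 2 * (v.1 * w.2.2.1 - w.1 * v.2.2.1),
      w.2.1 * v.2.2.1 - v.2.1 * w.2.2.1, (2 : ℝ) • (v.2.2.2.1 * w.2.2.2.2 - w.2.2.2.1 * v.2.2.2.2),
      0) := rfl

/-- An adapted basis with `h` of rank one exists for a parallelization of `ℝ^(2 n + 1)`. -/
theorem exists_rankOne {n : ℕ} (hn : 1 ≤ n) :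
    ∃ (P : Parallelization (𝓡 (2 * n + 1)) (EuclideanSpace ℝ (Fin (2 * n + 1))))
      (b : Module.Basis (Option (Fin n ⊕ Fin n)) ℝ (EuclideanSpace ℝ (Fin (2 * n + 1)))),
      IsNullBasis b P.br (fun _ => 1) (rankCoeff 1) := by
  obtain ⟨l, rfl⟩ : ∃ l, n = l + 1 := ⟨n - 1, by omega⟩
  let Φ : EuclideanSpace ℝ (Fin (2 * (l + 1) + 1)) ≃L[ℝ] RankOneSpace l :=
    ContinuousLinearEquiv.ofFinrankEq (by rw [finrank_rankOneSpace, finrank_euclideanSpace_fin])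
  let P := ((rankOneLaw l).conj Φ).parallelization
  let b := (rankOneBasis l).map Φ.symm.toLinearEquiv
  have hb : ∀ a, b a = Φ.symm (rankOneVec l a) := fun a => by
    simp [b, rankOneBasis]
  have hbr : ∀ v w, P.br (Φ.symm v) (Φ.symm w) = Φ.symm (rankOneBr l v w) := fun v w => by
    refine ((rankOneLaw l).conj_br Φ _ _).trans ?_
    rw [Φ.apply_symm_apply, Φ.apply_symm_apply]
    rfl
  have hξ : basisξ b = Φ.symm (0, 1, 0, 0, 0) := hb none
  have hX0 : basisX b 0 = Φ.symm (1, 0, -1 / 2, 0, 0) := hb (some (Sum.inl 0))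
  have hX : ∀ i : Fin l, basisX b i.succ = Φ.symm (0, -1, 0, Pi.single i 1, 0) :=
    fun i => hb (some (Sum.inl i.succ))
  have hY0 : basisY b 0 = Φ.symm (0, 0, 1, 0, 0) := hb (some (Sum.inr 0))
  have hY : ∀ i : Fin l, basisY b i.succ = Φ.symm (0, 0, 0, 0, Pi.single i 1) :=
    fun i => hb (some (Sum.inr i.succ))
  have T : IsRankOneTable b P.br :=
    { skew := P.br_skew 0
      jacobi := P.br_jacobi 0
      br_ξ_X_zero := by
        rw [hξ, hX0, hY0, hbr, ← map_add, rankOneBr_apply]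
        congr 1
        simp
        norm_num
      br_ξ_X := fun i => by
        rw [hξ, hX, hbr, rankOneBr_apply, ← map_zero Φ.symm]
        congr 1
        simp
      br_ξ_Y_zero := by
        rw [hξ, hY0, hbr, ← map_neg, rankOneBr_apply]
        congr 1
        simp
      br_ξ_Y := fun i => by
        rw [hξ, hY, hbr, rankOneBr_apply, ← map_zero Φ.symm]
        congr 1
        simp
      br_X_X_zero := fun j => by
        rw [hX0, hX, hY0, hbr, ← map_add, rankOneBr_apply]
        congr 1
        simp
        norm_num
      br_X_X := fun i j => by
        rw [hX, hX, hbr, rankOneBr_apply, ← map_zero Φ.symm]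
        congr 1
        simp
      br_Y_Y := fun i j => by
        refine Fin.cases ?_ (fun i => ?_) i <;> refine Fin.cases ?_ (fun j => ?_) j <;>
        simp only [hY0, hY, hbr, rankOneBr_apply] <;>
        rw [← map_zero Φ.symm] <;>
        congr 1 <;>
        simp
      br_X_Y_zero_zero := by
        rw [hξ, hX0, hY0, hbr, ← map_smul, rankOneBr_apply]
        congr 1
        simp
      br_X_Y_zero := fun j => by
        rw [hX0, hY, hbr, rankOneBr_apply, ← map_zero Φ.symm]
        congr 1
        simp
      br_X_zero_Y := fun i => by
        rw [hX, hY0, hbr, rankOneBr_apply]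
        congr 1
        simp
      br_X_Y := fun i j => by
        rw [hX, hY, hξ, hbr, rankOneBr_apply]
        split_ifs with h
        · subst h
          rw [← map_smul, ← map_smul, ← map_add]
          congr 1
          simp [← Pi.single_mul]
        · rw [← map_zero Φ.symm]
          congr 1
          have h1 : (Pi.single i 1 * Pi.single j 1 : Fin l → ℝ) = 0 := by
            funext a
            simp only [Pi.mul_apply, Pi.single_apply, Pi.zero_apply]
            split_ifs <;> simp_all
          simp [h1] }
  exact ⟨P, b, T.isNullBasis⟩

end RankOne

/-- For `m ≥ 2` the example has such a structure, and for `m = 1` a parallelized vector space. -/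
theorem exists_nullStructure {n m : ℕ} (h1 : 1 ≤ m) (hm : m ≤ n) :
    ∃ (M : Type) (_ : TopologicalSpace M)
      (_ : ChartedSpace (EuclideanSpace ℝ (Fin (2 * n + 1))) M)
      (_ : IsManifold (𝓡 (2 * n + 1)) ∞ M) (_ : T2Space M) (_ : SecondCountableTopology M)
      (_ : Nonempty M) (S : ParacontactMetricStructure (𝓡 (2 * n + 1)) M n),
      S.IsKappaMuSpace (-1) 0 ∧ (∀ p, S.h p ∘L S.h p = 0) ∧
        ∀ p, Module.finrank ℝ (S.h p).range = m := by
  obtain rfl | h2 : m = 1 ∨ 2 ≤ m := by omega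
  · obtain ⟨P, b, N⟩ := exists_rankOne hm
    exact ⟨_, inferInstance, inferInstance, inferInstance, inferInstance, inferInstance,
      inferInstance, N.structure, N.structure_isKappaMuSpace, N.structure_h_comp_h,
      N.finrank_range_structure_h hm rfl⟩
  · obtain ⟨G, i1, i2, i3, i4, i5, i6, ξ, X, Y, B⟩ := exists_exampleGroup h2 hm
    have N := (B.isExampleTable h2 hm).isNullBasis
    exact ⟨G, inferInstance, inferInstance, inferInstance, inferInstance, inferInstance, ⟨1⟩,
      N.structure, N.structure_isKappaMuSpace, N.structure_h_comp_h,
      N.finrank_range_structure_h hm rfl⟩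

end

end Paracontact

theorem mainTheorem2 :
    (∀ n m : ℕ, 2 ≤ n → 2 ≤ m → m ≤ n →
      (∃ (G : Type) (_ : TopologicalSpace G)
          (_ : ChartedSpace (EuclideanSpace ℝ (Fin (2 * n + 1))) G) (_ : Group G)
          (_ : LieGroup (𝓡 (2 * n + 1)) ∞ G) (_ : T2Space G) (_ : SecondCountableTopology G)
          (ξ : GroupLieAlgebra (𝓡 (2 * n + 1)) G) (X Y : ℕ → GroupLieAlgebra (𝓡 (2 * n + 1)) G),
          Paracontact.IsExampleBasis n m ξ X Y) ∧
      (∀ (G : Type*) [TopologicalSpace G]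
          [ChartedSpace (EuclideanSpace ℝ (Fin (2 * n + 1))) G] [Group G]
          [LieGroup (𝓡 (2 * n + 1)) ∞ G]
          (ξ : GroupLieAlgebra (𝓡 (2 * n + 1)) G) (X Y : ℕ → GroupLieAlgebra (𝓡 (2 * n + 1)) G),
          Paracontact.IsExampleBasis n m ξ X Y →
          ∃ S : Paracontact.ParacontactMetricStructure (𝓡 (2 * n + 1)) G n,
            S.IsLeftInvariant ∧ Paracontact.HasExampleValues S ξ X Y ∧
            S.h 1 ξ = 0 ∧
            (∀ i ∈ Finset.Icc 1 m, S.h 1 (X i) = Y i) ∧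
            (∀ i ∈ Finset.Icc (m + 1) n, S.h 1 (X i) = 0) ∧
            (∀ i ∈ Finset.Icc 1 n, S.h 1 (Y i) = 0) ∧
            (∀ p, S.h p ∘L S.h p = 0) ∧
            (∀ p, Module.finrank ℝ (S.h p).range = m) ∧
            (∀ p, S.h p ≠ 0) ∧
            S.IsKappaMuSpace (-1) 0)) ∧
    (∀ n m : ℕ, 1 ≤ m → m ≤ n →
      ∃ (M : Type) (_ : TopologicalSpace M)
        (_ : ChartedSpace (EuclideanSpace ℝ (Fin (2 * n + 1))) M)
        (_ : IsManifold (𝓡 (2 * n + 1)) ∞ M) (_ : T2Space M) (_ : SecondCountableTopology M)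
        (_ : Nonempty M) (S : Paracontact.ParacontactMetricStructure (𝓡 (2 * n + 1)) M n),
        S.IsKappaMuSpace (-1) 0 ∧ (∀ p, S.h p ∘L S.h p = 0) ∧
          ∀ p, Module.finrank ℝ (S.h p).range = m) := by
  refine ⟨fun n m hn h2 hm => ⟨Paracontact.exists_exampleGroup h2 hm, ?_⟩,
    fun n m h1 hm => Paracontact.exists_nullStructure h1 hm⟩
  intro G _ _ _ _ ξ X Y B
  exact B.exists_structure h2 hm
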